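/- **Data.** Let $\mathcal B$ be a connected (Hausdorff, second countable) complex manifold of dimension $r$, $\mathcal B''\subset\mathcal B$ the support of a divisor (a closed subset that is locally the zero locus of a holomorphic function not vanishing identically near any point), and $\mathcal B'=\mathcal B\setminus\mathcal B''$. Over $\mathcal B'$ let the following be given. * An exact sequence $0\to\Gamma_f\to\widehat\Gamma\to\Gamma\to0$ of local systems of lattices (free abelian groups of finite rank), with $\Gamma_f$ trivial and $\Gamma$ of rank $2r$. * A flat antisymmetric pairing $\langle\,,\rangle:\widehat\Gamma_u\times\widehat\Gamma_u\to\mathbb Z$ whose radical is $\Gamma_f$ for every $u\in\mathcal B'$. It induces a nondegenerate pairing on $\Gamma_u$ and a pairing on $\Gamma_u^*\otimes\mathbb C$, $\langle a,b\rangle=\langle\Psi(a),\Psi(b)\rangle$, where $\Psi(a)\in\Gamma_u\otimes\mathbb C$ is defined by $a=\langle\Psi(a),\cdot\rangle$. * Homomorphisms $Z(u):\widehat\Gamma_u\to\mathbb C$, constant in $u$ on $\Gamma_f$, such that $Z_\gamma$ is holomorphic for every flat local section $\gamma$ of $\widehat\Gamma$, and such that, for the $\Gamma^*\otimes\mathbb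 C$-valued $1$-form $dZ$, $\langle dZ\wedge dZ\rangle=0$ and $\langle dZ\wedge d\bar Z\rangle$ is a (positive) Kähler form on $\mathcal B'$. Here $\langle\alpha\wedge\beta\rangle(v,w)=\langle\alpha(v),\beta(w)\rangle-\langle\alpha(w),\beta(v)\rangle$. * A homomorphism $\theta_f:\Gamma_f\to\mathbb R/2\pi\mathbb Z$. Let $\mathcal M'$ be the set of pairs $(u,\theta)$ with $u\in\mathcal B'$ and $\theta:\widehat\Gamma_u\to\mathbb R/2\pi\mathbb Z$ such that $\theta_{\gamma+\gamma'}=\theta_\gamma+\theta_{\gamma'}+\pi\langle\gamma,\gamma'\rangle$ and $\theta|_{\Gamma_f}=\theta_f$, with projection $\pi(u,\theta)=u$. For $\zeta\in\mathbb C^\times$ put $\mathcal X^{\rm sf}_\gamma(\zeta)=\exp(\zeta^{-1}Z_\gamma+i\theta_\gamma+\zeta\overline{Z_\gamma})$ and $$\varpi^{\rm sf}(\zeta)=\tfrac1{8\pi}\langle d\log\mathcal X^{\rm sf}(\zeta)\wedge d\log\mathcal X^{\rm sf}(\zeta)\rangle,\qquad \omega^{\rm sf}_+=-\tfrac1{2\pi}\langle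 dZ\wedge d\theta\rangle,\qquad \omega_3^{\rm sf}=\tfrac1{8\pi}\bigl(2\langle dZ\wedge d\bar Z\rangle-\langle d\theta\wedge d\theta\rangle\bigr).$$ **Theorem (semi-flat hyper-Kähler structure).** Every point of $\mathcal B'$ has an open neighbourhood $U$ over which there are flat sections $\gamma_1,\dots,\gamma_{2r}$ of $\widehat\Gamma$ whose images form a basis of $\Gamma_u$ for each $u\in U$. There is a Hausdorff, second countable smooth manifold structure on $\mathcal M'$ for which all the maps $(\pi,\theta_{\gamma_1},\dots,\theta_{\gamma_{2r}}):\pi^{-1}(U)\to U\times(\mathbb R/2\pi\mathbb Z)^{2r}$ given by such $U$ and $\gamma_i$ are diffeomorphisms, so that $\pi:\mathcal M'\to\mathcal B'$ is a fibration by $2r$-tori, and with this structure the following hold. 1. For every $\zeta\in\mathbb C^\times$ the $2$-form $\varpi^{\rm sf}(\zeta)$ is holomorphic symplectic, that is, it is a smooth closed complex $2$-form $\Omega$ with $T_{\mathbb C}\mathcal M'=\ker\Omega\oplus\ker\overline\Omega$; so is $\omega_+^{\rm sf}$. 2. There is a hyper-Kähler structure on $\mathcal M'$, called the semi-flat structure: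 a (positive definite) Riemannian metric $g$ and integrable $g$-orthogonal complex structures $J_1,J_2,J_3$ with $J_1J_2=J_3$, whose Kähler forms $\omega_i=g(J_i\cdot,\cdot)$ are closed, such that $\omega_+^{\rm sf}=\omega_1+i\omega_2$, $\omega_3^{\rm sf}=\omega_3$, and for all $\zeta\in\mathbb C^\times$ $$\varpi^{\rm sf}(\zeta)=-\tfrac{i}{2\zeta}(\omega_1+i\omega_2)+\omega_3-\tfrac{i}{2}\zeta(\omega_1-i\omega_2).$$ -/

import Mathlib

open scoped Manifold ContDiff TensorProduct Topology

universe u v w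

noncomputable section

/-! ### Local systems -/

/-- A local system of abelian groups on `X`, given by its étalé space `Σ x, fiber x`: near every
point `x` the space is covered by disjoint open copies `y ↦ e y γ` of a neighbourhood `U` of `x`,
one for each `γ` in the fiber at `x`, where each `e y` (`y ∈ U`) is an isomorphism of groups. -/
structure LocalSystem (X : Type u) [TopologicalSpace X] where
  fiber : X → Type v
  [grp : ∀ x, AddCommGroup (fiber x)]
  [top : TopologicalSpace (Σ x, fiber x)]
  locally_trivial : ∀ x : X, ∃ U : Set X, IsOpen U ∧ x ∈ U ∧
    ∃ e : ∀ y, fiber x →+ fiber y,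
      (∀ γ, e x γ = γ) ∧ (∀ y ∈ U, Function.Bijective (e y)) ∧
      ∀ γ : fiber x, Topology.IsOpenEmbedding (fun y : U => (⟨y, e y γ⟩ : Σ x, fiber x))

namespace LocalSystem

variable {X : Type u} [TopologicalSpace X]

instance (L : LocalSystem.{u, v} X) (x : X) : AddCommGroup (L.fiber x) := L.grp x

instance (L : LocalSystem.{u, v} X) : TopologicalSpace (Σ x, L.fiber x) := L.top

/-- `s` restricts to a flat (that is, continuous) section of the local system over `U`. -/
def IsFlatOn (L : LocalSystem.{u, v} X) (s : ∀ x, L.fiber x) (U : Set X) : Prop :=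
  ContinuousOn (fun x => (⟨x, s x⟩ : Σ x, L.fiber x)) U

theorem exists_flat (L : LocalSystem.{u, v} X) (x : X) (γ : L.fiber x) :
    ∃ s : ∀ y, L.fiber y, s x = γ ∧ ∃ U : Set X, IsOpen U ∧ x ∈ U ∧ L.IsFlatOn s U := by
  obtain ⟨U, hU, hx, e, he, -, h⟩ := L.locally_trivial x
  exact ⟨fun y => e y γ, he γ, U, hU, hx, continuousOn_iff_continuous_domRestrict.2 (h γ).continuous⟩

/-- A section through `γ` that is flat near `x`. Its germ at `x` is uniquely determined. -/
def flatExt (L : LocalSystem.{u, v} X) (x : X) (γ : L.fiber x) : ∀ y, L.fiber y :=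
  (L.exists_flat x γ).choose

end LocalSystem

/-! ### The pairing on the dual of a lattice -/

/-- For a bilinear form on a lattice `L` and a functional `a : L → ℂ`, an element `Ψ(a)` of `ℂ ⊗ L`
with `a = ⟨Ψ(a), ·⟩`. -/
def sharp {L : Type v} [AddCommGroup L] (b : LinearMap.BilinForm ℤ L) (a : L → ℂ) : ℂ ⊗[ℤ] L :=
  Classical.epsilon fun x => ∀ γ : L, b.baseChange ℂ x (1 ⊗ₜ[ℤ] γ) = a γ

/-- The inherited pairing `⟨a, a'⟩ = ⟨Ψ(a), Ψ(a')⟩` of functionals. For an antisymmetric form with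
radical `R` it is well defined on the homomorphisms `L → ℂ` that vanish on `R`, that is, on
`(L / R)^* ⊗ ℂ`, and there it is the pairing dual to the one of `L / R`. -/
def dualPairing {L : Type v} [AddCommGroup L] (b : LinearMap.BilinForm ℤ L) (a a' : L → ℂ) : ℂ :=
  b.baseChange ℂ (sharp b a) (sharp b a')

/-! ### Two-forms on manifolds -/

section Forms

variable {E : Type u} [NormedAddCommGroup E] [NormedSpace ℝ E] {H : Type v} [TopologicalSpace H]
  (I : ModelWithCorners ℝ E H) {M : Type w} [TopologicalSpace M] [ChartedSpace H M]

/-- The differential of a complex-valued function at a point of a real manifold. -/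
def cdiff (f : M → ℂ) (m : M) : TangentSpace I m →L[ℝ] ℂ := mfderiv I 𝓘(ℝ, ℂ) f m

/-- The expression of an `F`-valued 2-form in the preferred chart at `m₀`. -/
def chartForm {F : Type*} [NormedAddCommGroup F] [NormedSpace ℝ F]
    (Ω : ∀ m : M, TangentSpace I m [⋀^Fin 2]→L[ℝ] F) (m₀ : M) (y : E) : E [⋀^Fin 2]→L[ℝ] F :=
  (Ω ((extChartAt I m₀).symm y)).compContinuousLinearMap
    (mfderiv 𝓘(ℝ, E) I (extChartAt I m₀).symm y)

/-- A smooth closed 2-form on a manifold without boundary. -/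
def IsClosedForm {F : Type*} [NormedAddCommGroup F] [NormedSpace ℝ F]
    (Ω : ∀ m : M, TangentSpace I m [⋀^Fin 2]→L[ℝ] F) : Prop :=
  ∀ m₀ : M, ContDiffOn ℝ ∞ (chartForm I Ω m₀) (extChartAt I m₀).target ∧
    ∀ y ∈ (extChartAt I m₀).target, extDeriv (chartForm I Ω m₀) y = 0

/-- The kernel of the complex-bilinear extension of a complex 2-form at a point, as a subspace of
the complexified tangent space. -/
def formKer {T : Type*} [AddCommGroup T] [Module ℝ T] [TopologicalSpace T]
    (Ω : T [⋀^Fin 2]→L[ℝ] ℂ) : Submodule ℂ (ℂ ⊗[ℝ] T) :=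
  LinearMap.ker (LinearMap.liftBaseChange ℂ Ω.toAlternatingMap.curryLeft)

/-- The complex conjugate of a complex 2-form at a point. -/
def conjForm {T : Type*} [AddCommGroup T] [Module ℝ T] [TopologicalSpace T]
    (Ω : T [⋀^Fin 2]→L[ℝ] ℂ) : T [⋀^Fin 2]→L[ℝ] ℂ :=
  (Complex.conjCLE : ℂ →L[ℝ] ℂ).compContinuousAlternatingMap Ω

/-- A holomorphic symplectic form on a real manifold: a smooth closed complex 2-form `Ω` such that
the complexified tangent space is the direct sum of the kernels of `Ω` and of its conjugate. -/
structure IsHolomorphicSymplectic (Ω : ∀ m : M, TangentSpace I m [⋀^Fin 2]→L[ℝ] ℂ) : Prop where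
  closed : IsClosedForm I Ω
  isCompl : ∀ m, IsCompl (formKer (Ω m)) (formKer (conjForm (Ω m)))

/-- `J` is an (integrable) complex structure: `J² = -1`, and near every point there are smooth
complex coordinates that are holomorphic for `J`. -/
structure IsComplexStructure (J : ∀ m : M, TangentSpace I m →L[ℝ] TangentSpace I m) : Prop where
  sq : ∀ m v, J m (J m v) = -v
  integrable : ∀ m₀ : M, ∃ (N : ℕ) (f : M → (Fin N → ℂ)), ∀ᶠ m in 𝓝 m₀,
    ContMDiffAt I 𝓘(ℝ, Fin N → ℂ) ∞ f m ∧
    Function.Bijective (mfderiv I 𝓘(ℝ, Fin N → ℂ) f m) ∧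
    ∀ (v : TangentSpace I m) (i : Fin N),
      (mfderiv I 𝓘(ℝ, Fin N → ℂ) f m (J m v) : Fin N → ℂ) i =
        Complex.I * (mfderiv I 𝓘(ℝ, Fin N → ℂ) f m v : Fin N → ℂ) i

variable (M) in
/-- A hyper-Kähler structure: a (positive definite) Riemannian metric `g` with three `g`-orthogonal
complex structures `J₁, J₂, J₃` (indexed by `0, 1, 2`) satisfying `J₁ J₂ = J₃`, and hence the
quaternion relations, whose Kähler forms `ω_i = g (J_i ·, ·)` are closed. -/
structure HyperKahlerStructure [IsManifold I ∞ M] where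
  g : Bundle.ContMDiffRiemannianMetric I ∞ E (fun m : M => TangentSpace I m)
  J : Fin 3 → ∀ m : M, TangentSpace I m →L[ℝ] TangentSpace I m
  form : Fin 3 → ∀ m : M, TangentSpace I m [⋀^Fin 2]→L[ℝ] ℝ
  isComplexStructure : ∀ i, IsComplexStructure I (J i)
  quaternion : ∀ m v, J 0 m (J 1 m v) = J 2 m v
  orthogonal : ∀ i m v w, g.inner m (J i m v) (J i m w) = g.inner m v w
  form_eq : ∀ i m v w, form i m ![v, w] = g.inner m (J i m v) w
  closed : ∀ i, IsClosedForm I (form i)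

end Forms

/-! ### The base -/

/-- `S` is (the support of) a divisor in the complex manifold `B`: a closed subset that is locally
the zero locus of a holomorphic function which does not vanish identically near any point. -/
structure IsDivisor (r : ℕ) {B : Type u} [TopologicalSpace B] [ChartedSpace (Fin r → ℂ) B]
    (S : Set B) : Prop where
  isClosed : IsClosed S
  locally_zeros : ∀ x : B, ∃ (U : Set B) (f : B → ℂ), IsOpen U ∧ x ∈ U ∧
    MDifferentiableOn 𝓘(ℂ, Fin r → ℂ) 𝓘(ℂ) f U ∧
    (∀ y ∈ U, y ∈ S ↔ f y = 0) ∧ ∀ y ∈ U, ¬ ∀ᶠ z in 𝓝 y, f z = 0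

/-- The regular locus, the complement of the divisor. -/
def regularLocus {r : ℕ} {B : Type u} [TopologicalSpace B] [ChartedSpace (Fin r → ℂ) B]
    {S : Set B} (hS : IsDivisor r S) : TopologicalSpace.Opens B :=
  ⟨Sᶜ, hS.isClosed.isOpen_compl⟩

/-- A Kähler form on a complex manifold of dimension `r`: a real closed 2-form, invariant under
multiplication by `i`, with `κ(v, i v) > 0` for `v ≠ 0`. -/
structure IsKahlerForm {r : ℕ} {X : Type u} [TopologicalSpace X] [ChartedSpace (Fin r → ℂ) X]
    (κ : ∀ x : X, TangentSpace 𝓘(ℝ, Fin r → ℂ) x [⋀^Fin 2]→L[ℝ] ℝ) : Prop where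
  closed : IsClosedForm 𝓘(ℝ, Fin r → ℂ) κ
  invariant : ∀ (x : X) (v w : Fin r → ℂ), κ x ![Complex.I • v, Complex.I • w] = κ x ![v, w]
  positive : ∀ (x : X) (v : Fin r → ℂ), v ≠ 0 → 0 < κ x ![v, Complex.I • v]

/-! ### The data -/

/-- The data on the regular locus `X`, except for the conditions on the derivatives of the central
charge: an exact sequence `0 → Γ_f → Γ̂ → Γ → 0` of local systems of lattices with `Γ_f` trivial and
`Γ` of rank `2 r`, a flat antisymmetric pairing on `Γ̂` with radical `Γ_f`, a central charge, and a
homomorphism from `Γ_f` to `ℝ / 2πℤ`. -/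
structure PreSemiflatData (r : ℕ) (X : Type u) [TopologicalSpace X]
    [ChartedSpace (Fin r → ℂ) X] where
  /-- the flavor charge lattice `Γ_f` -/
  flavor : Type v
  [flavorGrp : AddCommGroup flavor]
  flavor_free : Module.Free ℤ flavor
  flavor_finite : Module.Finite ℤ flavor
  /-- the charge lattices `Γ̂_x` -/
  charge : LocalSystem.{u, v} X
  charge_free : ∀ x, Module.Free ℤ (charge.fiber x)
  charge_finite : ∀ x, Module.Finite ℤ (charge.fiber x)
  /-- the gauge charge lattices `Γ_x` -/
  gauge : LocalSystem.{u, v} X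
  gauge_free : ∀ x, Module.Free ℤ (gauge.fiber x)
  gauge_finite : ∀ x, Module.Finite ℤ (gauge.fiber x)
  gauge_rank : ∀ x, Module.finrank ℤ (gauge.fiber x) = 2 * r
  incl : ∀ x, flavor →+ charge.fiber x
  incl_injective : ∀ x, Function.Injective (incl x)
  incl_flat : ∀ f, charge.IsFlatOn (fun x => incl x f) Set.univ
  proj : ∀ x, charge.fiber x →+ gauge.fiber x
  proj_surjective : ∀ x, Function.Surjective (proj x)
  proj_flat : Continuous
    (fun p : Σ x, charge.fiber x => (⟨p.1, proj p.1 p.2⟩ : Σ x, gauge.fiber x))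
  exact : ∀ x γ, proj x γ = 0 ↔ ∃ f, incl x f = γ
  pairing : ∀ x, LinearMap.BilinForm ℤ (charge.fiber x)
  pairing_antisymm : ∀ x γ γ', pairing x γ γ' = -pairing x γ' γ
  pairing_flat : ∀ (U : Set X) (s t : ∀ x, charge.fiber x), IsOpen U →
    charge.IsFlatOn s U → charge.IsFlatOn t U → ContinuousOn (fun x => pairing x (s x) (t x)) U
  radical : ∀ x γ, (∃ f, incl x f = γ) ↔ ∀ γ', pairing x γ γ' = 0
  /-- the central charge -/
  Z : ∀ x, charge.fiber x →+ ℂ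
  Z_flavor : ∀ f x y, Z x (incl x f) = Z y (incl y f)
  Z_holomorphic : ∀ (U : Set X) (s : ∀ x, charge.fiber x), IsOpen U → charge.IsFlatOn s U →
    MDifferentiableOn 𝓘(ℂ, Fin r → ℂ) 𝓘(ℂ) (fun x => Z x (s x)) U
  thetaf : flavor →+ Real.Angle

attribute [instance] PreSemiflatData.flavorGrp

/-- The 1-form `dZ` on the base, with values in the functionals on `Γ̂_x` (that vanish on `Γ_f`). -/
def PreSemiflatData.baseDZ {r : ℕ} {X : Type u} [TopologicalSpace X]
    [ChartedSpace (Fin r → ℂ) X] (D : PreSemiflatData.{u, v} r X) (x : X)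
    (v : TangentSpace 𝓘(ℝ, Fin r → ℂ) x) (γ : D.charge.fiber x) : ℂ :=
  cdiff 𝓘(ℝ, Fin r → ℂ) (fun y => D.Z y (D.charge.flatExt x γ y)) x v

/-- The value `⟨α ∧ β⟩(v, w) = ⟨α(v), β(w)⟩ - ⟨α(w), β(v)⟩` for two 1-forms `α`, `β` at a point with
values in functionals on `L`. -/
def wedgePairing {L : Type v} [AddCommGroup L] (b : LinearMap.BilinForm ℤ L) {T : Type w}
    (α β : T → L → ℂ) (v w : T) : ℂ :=
  dualPairing b (α v) (β w) - dualPairing b (α w) (β v)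

/-- The full data: in addition `⟨dZ ∧ dZ⟩ = 0`, and `⟨dZ ∧ dZ̄⟩` is a Kähler form. -/
structure SemiflatData (r : ℕ) (X : Type u) [TopologicalSpace X]
    [ChartedSpace (Fin r → ℂ) X] extends PreSemiflatData.{u, v} r X where
  dZ_dZ : ∀ (x : X) (v w : TangentSpace 𝓘(ℝ, Fin r → ℂ) x),
    wedgePairing (pairing x) (toPreSemiflatData.baseDZ x) (toPreSemiflatData.baseDZ x) v w = 0
  dZ_dZbar : ∃ κ : ∀ x : X, TangentSpace 𝓘(ℝ, Fin r → ℂ) x [⋀^Fin 2]→L[ℝ] ℝ,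
    IsKahlerForm κ ∧ ∀ (x : X) (v w : TangentSpace 𝓘(ℝ, Fin r → ℂ) x),
      wedgePairing (pairing x) (toPreSemiflatData.baseDZ x)
        (fun v γ => (starRingEnd ℂ) (toPreSemiflatData.baseDZ x v γ)) v w = (κ x ![v, w] : ℂ)

namespace SemiflatData

variable {r : ℕ} {X : Type u} [TopologicalSpace X] [ChartedSpace (Fin r → ℂ) X]

/-! ### The space of twisted unitary characters -/

/-- The set `M'` of pairs of a point `x` of the base and a twisted unitary character `θ` of `Γ̂_x`
that restricts to the given homomorphism on `Γ_f`. -/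
structure Space (D : SemiflatData.{u, v} r X) where
  base : X
  angle : D.charge.fiber base → Real.Angle
  twisted : ∀ γ γ', angle (γ + γ') =
    angle γ + angle γ' + ((Real.pi * (D.pairing base γ γ' : ℝ) : ℝ) : Real.Angle)
  flavor : ∀ f, angle (D.incl base f) = D.thetaf f

/-- A frame over the open set `U`: flat sections of `Γ̂` over `U` whose images in `Γ` form a basis of
every lattice `Γ_x`, `x ∈ U`. -/
structure IsFrame (D : SemiflatData.{u, v} r X) (U : Set X)
    (s : Fin (2 * r) → ∀ x, D.charge.fiber x) : Prop where
  isOpen : IsOpen U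
  flat : ∀ i, D.charge.IsFlatOn (s i) U
  linearIndependent : ∀ x ∈ U, LinearIndependent ℤ (fun i => D.proj x (s i x))
  span : ∀ x ∈ U, Submodule.span ℤ (Set.range fun i => D.proj x (s i x)) = ⊤

/-- The model space of `M'`, for the coordinates on the base and the `2 r` angles. -/
abbrev Model (r : ℕ) : Type := ModelProd (Fin r → ℂ) (Fin (2 * r) → ℝ)

/-- The real model with corners of `M'`. -/
abbrev modelI (r : ℕ) : ModelWithCorners ℝ ((Fin r → ℂ) × (Fin (2 * r) → ℝ)) (Model r) :=
  𝓘(ℝ, Fin r → ℂ).prod 𝓘(ℝ, Fin (2 * r) → ℝ)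

section Smooth

variable (D : SemiflatData.{u, v} r X) [TopologicalSpace D.Space] [ChartedSpace (Model r) D.Space]

/-- The topology and the smooth structure of `M'` are the ones given by the angle coordinates: for
every frame `s` over `U`, the map that sends `(x, t) ∈ U × ℝ^{2r}` to the unique twisted unitary
character `θ` over `x` with `θ_{s_i} = t_i` mod `2π` is a local diffeomorphism to `M'`.
Hence `(π, θ_{s_1}, …, θ_{s_{2r}})` identifies `π⁻¹(U)` with `U × (ℝ / 2πℤ)^{2r}`. -/
def HasAngleCoordinates : Prop :=
  ∀ (U : Set X) (s : Fin (2 * r) → ∀ x, D.charge.fiber x), D.IsFrame U s →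
    ∃ P : X × (Fin (2 * r) → ℝ) → D.Space,
      (∀ x ∈ U, ∀ t, (P (x, t)).base = x ∧
        ∀ i, (P (x, t)).angle (s i (P (x, t)).base) = ((t i : ℝ) : Real.Angle)) ∧
      (∀ m : D.Space, m.base ∈ U → ∃ t, P (m.base, t) = m) ∧
      IsLocalDiffeomorphOn (modelI r) (modelI r) ∞ P (U ×ˢ Set.univ)

/-! ### The 1-forms `dZ`, `dθ`, `d log 𝒳(ζ)` and the resulting 2-forms -/

/-- `e^{i θ_s}` for a section `s` of `Γ̂`. -/
def phase (s : ∀ x, D.charge.fiber x) (m : D.Space) : ℂ :=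
  ((m.angle (s m.base)).toCircle : ℂ)

/-- `𝒳_s(ζ) = exp(ζ⁻¹ Z_s + i θ_s + ζ Z̄_s)` for a section `s` of `Γ̂`. -/
def calX (ζ : ℂ) (s : ∀ x, D.charge.fiber x) (m : D.Space) : ℂ :=
  Complex.exp (ζ⁻¹ * D.Z m.base (s m.base) + ζ * (starRingEnd ℂ) (D.Z m.base (s m.base))) *
    D.phase s m

/-- `dZ`, pulled back to `M'`. -/
def dZ (m : D.Space) (v : TangentSpace (modelI r) m) (γ : D.charge.fiber m.base) : ℂ :=
  cdiff (modelI r)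
    (fun m' : D.Space => D.Z m'.base (D.charge.flatExt m.base γ m'.base)) m v

/-- The conjugate of `dZ`. -/
def dZbar (m : D.Space) (v : TangentSpace (modelI r) m) (γ : D.charge.fiber m.base) : ℂ :=
  (starRingEnd ℂ) (D.dZ m v γ)

/-- `dθ = (i e^{iθ})⁻¹ d(e^{iθ})`. -/
def dtheta (m : D.Space) (v : TangentSpace (modelI r) m) (γ : D.charge.fiber m.base) : ℂ :=
  (Complex.I * D.phase (D.charge.flatExt m.base γ) m)⁻¹ *
    cdiff (modelI r) (D.phase (D.charge.flatExt m.base γ)) m v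

/-- `d log 𝒳(ζ) = 𝒳(ζ)⁻¹ d𝒳(ζ)`. -/
def dlogX (ζ : ℂ) (m : D.Space) (v : TangentSpace (modelI r) m) (γ : D.charge.fiber m.base) : ℂ :=
  (D.calX ζ (D.charge.flatExt m.base γ) m)⁻¹ *
    cdiff (modelI r) (D.calX ζ (D.charge.flatExt m.base γ)) m v

/-- `ϖ(ζ) = (1 / 8π) ⟨d log 𝒳(ζ) ∧ d log 𝒳(ζ)⟩`. -/
def varpi (ζ : ℂ) (m : D.Space) (v w : TangentSpace (modelI r) m) : ℂ :=
  1 / (8 * Real.pi) * wedgePairing (D.pairing m.base) (D.dlogX ζ m) (D.dlogX ζ m) v w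

/-- `ω₊ = -(1 / 2π) ⟨dZ ∧ dθ⟩`. -/
def omegaPlus (m : D.Space) (v w : TangentSpace (modelI r) m) : ℂ :=
  -(1 / (2 * Real.pi)) * wedgePairing (D.pairing m.base) (D.dZ m) (D.dtheta m) v w

/-- `ω₃ = (1 / 8π) (2 ⟨dZ ∧ dZ̄⟩ - ⟨dθ ∧ dθ⟩)`. -/
def omegaThree (m : D.Space) (v w : TangentSpace (modelI r) m) : ℂ :=
  1 / (8 * Real.pi) * (2 * wedgePairing (D.pairing m.base) (D.dZ m) (D.dZbar m) v w -
    wedgePairing (D.pairing m.base) (D.dtheta m) (D.dtheta m) v w)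

end Smooth

end SemiflatData

end

/-!
The space `M'` is a torus bundle with coordinates `(x, θ_{s_1}, …, θ_{s_{2r}})` for frames `s` of
`Γ̂`. A twisted character over `x` is determined by its arbitrary values on a frame
(`IsFrame.angle_frameHom`, `IsFrame.character`): the twist is accounted for by the upper triangular
part of the Gram matrix, a quadratic refinement of the pairing modulo `2`. Flat sections have locally
constant coordinates in a frame, so two systems of coordinates differ by a holomorphic change of
coordinates on the base and integral affine maps of the angles. This gives the manifold structure.

In such coordinates everything is expressed by the periods `Z(s_i)`, functions on the base, by the
angles `θ_{s_i}`, and by the transposed inverse `K` of the locally constant Gram matrix of the frame.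
The forms `ϖ(ζ)`, `ω₊`, `ω₃` are pullbacks of constant 2-forms under `(Z(s_i), θ_{s_i})`, hence
smooth and closed (`isClosedForm_of_chart_pullback`).

At a point, let `A` be the differential of the periods, a complex linear map `ℂ^r → ℂ^{2r}`. The
hypotheses on `dZ` say that its image is isotropic for `K`, and that `-2i K(A v, conj (A v)) > 0` for
`v ≠ 0` (`IsPeriodMap`). Hence the image of `A` meets its conjugate only in `0`, and `y ↦ 2 Re A y`
identifies `ℂ^r` with `ℝ^{2r}`. With this identification a tangent vector of `M'` is a pair `(v, y)`
of vectors of `ℂ^r`, the metric is a multiple of `κ(v, i v) + κ(y, i y)` for the Kähler form `κ` of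
the base, and the complex structures are `(-i y, -i v)`, `(y, -v)` and `(i v, -i y)`
(`IsPeriodMap.isHyperkahlerPoint`). The three 2-forms determine the complex structures as
`J_i = -ω_{i+1}⁻¹ ω_{i+2}` and the metric as `g = ω₁ ω₂⁻¹ ω₃`. So both are independent of the
coordinates, and the metric is smooth (`contMDiff_metric`).

For `ζ ≠ 0` the map `(v, y) ↦ d log 𝒳(ζ)` is a bijection to `ℂ^{2r}`
(`IsPeriodMap.logVal_injective`), so `ϖ(ζ)` is complex linear and nondegenerate for the complex
structure pulled back from `ℂ^{2r}`; its kernel and that of its conjugate are then complementary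
(`isCompl_formKer`). The same holds for `ω₊` and `J₃`.

Integrability is shown by holomorphic coordinates: `log 𝒳_{s_i}(ζ)` with `ζ = i` for `J₁` and
`ζ = -1` for `J₂`, and, for `J₃`, the coordinates `z_k` of the base together with `⟨∂_k Z, θ⟩`. For
`J₃` the derivatives `∂_k Z` have to be holomorphic again, which is Cauchy's formula
(`differentiableOn_fderiv_apply`).
-/

noncomputable section

/-! ### Holomorphic functions of several variables -/

section Holomorphic

variable {E : Type*} [NormedAddCommGroup E] [NormedSpace ℂ E]

theorem hasDerivAt_along_line {f : E → ℂ} {y u : E} {w : ℂ}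
    (hf : DifferentiableAt ℂ f (y + w • u)) :
    HasDerivAt (fun w : ℂ => f (y + w • u)) (fderiv ℂ f (y + w • u) u) w := by
  have h1 : HasDerivAt (fun w : ℂ => y + w • u) u w := by
    simpa using ((hasDerivAt_id w).smul_const u).const_add y
  exact hf.hasFDerivAt.comp_hasDerivAt w h1

/-- Cauchy's estimate for the differential of a holomorphic function of several variables. -/
theorem norm_fderiv_le_of_forall_mem_ball {f : E → ℂ} {y : E} {R C : ℝ} (hR : 0 < R) (hC : 0 ≤ C)
    (hd : ∀ z ∈ Metric.closedBall y R, DifferentiableAt ℂ f z)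
    (hb : ∀ z ∈ Metric.closedBall y R, ‖f z‖ ≤ C) : ‖fderiv ℂ f y‖ ≤ C / R := by
  refine ContinuousLinearMap.opNorm_le_bound _ (by positivity) fun u => ?_
  rcases eq_or_ne u 0 with rfl | hu
  · simp
  have hu' : 0 < ‖u‖ := norm_pos_iff.2 hu
  have hmem : ∀ w : ℂ, w ∈ Metric.closedBall (0 : ℂ) (R / ‖u‖) →
      y + w • u ∈ Metric.closedBall y R := by
    intro w hw
    rw [mem_closedBall_zero_iff, le_div_iff₀ hu'] at hw
    simpa [Metric.mem_closedBall, dist_eq_norm, norm_smul] using hw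
  have hder := hasDerivAt_along_line (f := f) (y := y) (u := u) (w := 0)
    (by simpa using hd y (Metric.mem_closedBall_self hR.le))
  have key := Complex.norm_deriv_le_of_forall_mem_sphere_norm_le (c := (0 : ℂ)) (C := C)
    (f := fun w : ℂ => f (y + w • u)) (R := R / ‖u‖) (by positivity)
    (DifferentiableOn.diffContOnCl (s := Metric.ball 0 (R / ‖u‖)) fun w hw =>
      (hasDerivAt_along_line (hd _ (hmem w
        (Metric.closure_ball_subset_closedBall hw)))).differentiableAt.differentiableWithinAt)
    (fun w hw => hb _ (hmem w (Metric.sphere_subset_closedBall hw)))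
  rw [hder.deriv] at key
  simp only [zero_smul, add_zero] at key
  calc _ ≤ _ := key
    _ = _ := by field_simp

variable [FiniteDimensional ℂ E]

/-- The directional derivatives of a holomorphic function are holomorphic: differentiate Cauchy's
integral formula on a complex line under the integral sign. -/
theorem differentiableOn_fderiv_apply {f : E → ℂ} {O : Set E}
    (hf : DifferentiableOn ℂ f O) (hO : IsOpen O) (v : E) :
    DifferentiableOn ℂ (fun x => fderiv ℂ f x v) O := by
  intro x₀ hx₀
  have : ProperSpace E := FiniteDimensional.proper ℂ E
  obtain ⟨R', hR', hsub'⟩ := Metric.isOpen_iff.1 hO x₀ hx₀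
  set R : ℝ := R' / 4 with hRdef
  have hR : 0 < R := by positivity
  have hsub : Metric.closedBall x₀ (3 * R) ⊆ O := fun z hz => hsub' (by
    rw [Metric.mem_closedBall] at hz; rw [Metric.mem_ball]; linarith)
  have hdiff : ∀ z ∈ Metric.closedBall x₀ (3 * R), DifferentiableAt ℂ f z := fun z hz =>
    hf.differentiableAt (hO.mem_nhds (hsub hz))
  obtain ⟨C, hC⟩ := (isCompact_closedBall x₀ (3 * R)).exists_bound_of_continuousOn
    (fun z hz => (hdiff z hz).continuousAt.continuousWithinAt)
  have hC0 : 0 ≤ C := (norm_nonneg _).trans (hC x₀ (Metric.mem_closedBall_self (by positivity)))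
  set ρ : ℝ := R / (‖v‖ + 1) with hρdef
  have hv1 : 0 < ‖v‖ + 1 := by positivity
  have hρ : 0 < ρ := by positivity
  have hmem : ∀ x ∈ Metric.ball x₀ R, ∀ w : ℂ, ‖w‖ ≤ ρ →
      x + w • v ∈ Metric.closedBall x₀ (2 * R) := by
    intro x hx w hw
    rw [Metric.mem_ball, dist_eq_norm] at hx
    rw [Metric.mem_closedBall, dist_eq_norm]
    have h1 : ‖w • v‖ ≤ R := by
      rw [norm_smul]
      calc ‖w‖ * ‖v‖ ≤ ρ * (‖v‖ + 1) := by gcongr; linarith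
        _ = R := by rw [hρdef]; field_simp
    calc ‖x + w • v - x₀‖ = ‖(x - x₀) + w • v‖ := by congr 1; abel
      _ ≤ ‖x - x₀‖ + ‖w • v‖ := norm_add_le _ _
      _ ≤ 2 * R := by linarith
  have h23 : Metric.closedBall x₀ (2 * R) ⊆ Metric.closedBall x₀ (3 * R) :=
    Metric.closedBall_subset_closedBall (by linarith)
  have hbound : ∀ z ∈ Metric.closedBall x₀ (2 * R), ‖fderiv ℂ f z‖ ≤ C / R := by
    intro z hz
    have hz3 : Metric.closedBall z R ⊆ Metric.closedBall x₀ (3 * R) :=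
      Metric.closedBall_subset_closedBall' (by rw [Metric.mem_closedBall] at hz; linarith)
    exact norm_fderiv_le_of_forall_mem_ball hR hC0 (fun y hy => hdiff y (hz3 hy))
      (fun y hy => hC y (hz3 hy))
  -- Cauchy's formula for the derivative along `v`
  have hcauchy : ∀ x ∈ Metric.ball x₀ R, fderiv ℂ f x v =
      (2 * Real.pi * Complex.I : ℂ)⁻¹ • ∮ w in C(0, ρ), ((w - 0) ^ 2)⁻¹ • f (x + w • v) := by
    intro x hx
    have hder := hasDerivAt_along_line (f := f) (y := x) (u := v) (w := 0)
      (by simpa using hdiff x (h23 (by simpa using hmem x hx 0 (by simpa using hρ.le))))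
    have hU : IsOpen ((fun w : ℂ => x + w • v) ⁻¹' O) := hO.preimage (by fun_prop)
    rw [Complex.two_pi_I_inv_smul_circleIntegral_sub_sq_inv_smul_of_differentiable hU
      (f := fun w : ℂ => f (x + w • v)) (fun w hw => hsub (h23 (hmem x hx w (by simpa using hw))))
      (fun w hw => (hasDerivAt_along_line
        (hf.differentiableAt (hO.mem_nhds hw))).differentiableAt.differentiableWithinAt)
      (Metric.mem_ball_self hρ), hder.deriv]
    simp
  borelize E
  have hcm : Continuous (fun t : ℝ => circleMap (0 : ℂ) ρ t) := continuous_circleMap 0 ρ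
  have hne : ∀ t, circleMap (0 : ℂ) ρ t ≠ 0 := fun t => circleMap_ne_center hρ.ne'
  have hcoef : Continuous fun t : ℝ => deriv (circleMap (0 : ℂ) ρ) t *
      ((circleMap (0 : ℂ) ρ t - 0) ^ 2)⁻¹ := by
    simp only [deriv_circleMap, sub_zero]
    exact (hcm.mul continuous_const).mul ((hcm.pow 2).inv₀ fun t => pow_ne_zero 2 (hne t))
  have hcmem : ∀ x ∈ Metric.ball x₀ R, ∀ t : ℝ,
      x + circleMap (0 : ℂ) ρ t • v ∈ Metric.closedBall x₀ (2 * R) := fun x hx t =>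
    hmem x hx _ (by simp [abs_of_pos hρ])
  have hFcont : ∀ x ∈ Metric.ball x₀ R, Continuous fun t : ℝ =>
      deriv (circleMap (0 : ℂ) ρ) t • ((circleMap (0 : ℂ) ρ t - 0) ^ 2)⁻¹ •
        f (x + circleMap (0 : ℂ) ρ t • v) := by
    intro x hx
    simp only [← mul_smul]
    refine hcoef.smul (continuous_iff_continuousAt.2 fun t => ?_)
    refine ContinuousAt.comp (f := fun t : ℝ => x + circleMap (0 : ℂ) ρ t • v) (g := f)
      (hdiff _ (h23 (hcmem x hx t))).continuousAt ?_
    exact (continuous_const.add (hcm.smul continuous_const)).continuousAt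
  have hx₀' : x₀ ∈ Metric.ball x₀ R := Metric.mem_ball_self hR
  have hint : HasFDerivAt (fun x => ∫ t in (0 : ℝ)..2 * Real.pi,
      deriv (circleMap (0 : ℂ) ρ) t • ((circleMap (0 : ℂ) ρ t - 0) ^ 2)⁻¹ •
        f (x + circleMap (0 : ℂ) ρ t • v))
      (∫ t in (0 : ℝ)..2 * Real.pi, (deriv (circleMap (0 : ℂ) ρ) t *
        ((circleMap (0 : ℂ) ρ t - 0) ^ 2)⁻¹) • fderiv ℂ f (x₀ + circleMap (0 : ℂ) ρ t • v)) x₀ := by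
    refine intervalIntegral.hasFDerivAt_integral_of_dominated_of_fderiv_le
      (F' := fun x t => (deriv (circleMap (0 : ℂ) ρ) t *
        ((circleMap (0 : ℂ) ρ t - 0) ^ 2)⁻¹) • fderiv ℂ f (x + circleMap (0 : ℂ) ρ t • v))
      (bound := fun t => ‖deriv (circleMap (0 : ℂ) ρ) t *
        ((circleMap (0 : ℂ) ρ t - 0) ^ 2)⁻¹‖ * (C / R))
      (Metric.ball_mem_nhds x₀ hR) ?_ ?_ ?_ ?_ ?_ ?_
    · filter_upwards [Metric.ball_mem_nhds x₀ hR] with x hx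
      exact (hFcont x hx).aestronglyMeasurable
    · exact (hFcont x₀ hx₀').intervalIntegrable _ _
    · have hm : Measurable fun t : ℝ => fderiv ℂ f (x₀ + circleMap (0 : ℂ) ρ t • v) :=
        (measurable_fderiv ℂ f).comp
          (continuous_const.add (hcm.smul continuous_const)).measurable
      exact hcoef.aestronglyMeasurable.smul hm.aestronglyMeasurable
    · refine Filter.Eventually.of_forall fun t _ x hx => ?_
      rw [norm_smul]
      gcongr
      exact hbound _ (hcmem x hx t)
    · exact (hcoef.norm.mul continuous_const).intervalIntegrable _ _
    · refine Filter.Eventually.of_forall fun t _ x hx => ?_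
      simp only [← mul_smul]
      have h1 : HasFDerivAt (fun x : E => x + circleMap (0 : ℂ) ρ t • v)
          (ContinuousLinearMap.id ℂ E) x := (hasFDerivAt_id x).add_const _
      have h2 := (hdiff _ (h23 (hcmem x hx t))).hasFDerivAt.comp x h1
      rw [ContinuousLinearMap.comp_id] at h2
      exact h2.const_smul (R := ℂ) _
  refine DifferentiableAt.differentiableWithinAt ?_
  refine (hint.differentiableAt.const_smul (2 * Real.pi * Complex.I : ℂ)⁻¹).congr_of_eventuallyEq ?_
  filter_upwards [Metric.ball_mem_nhds x₀ hR] with x hx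
  exact hcauchy x hx

/-- A complex differentiable function on an open set in finitely many variables is smooth. -/
theorem contDiffOn_of_differentiableOn_complex {f : E → ℂ} {O : Set E}
    (hf : DifferentiableOn ℂ f O) (hO : IsOpen O) : ContDiffOn ℂ ∞ f O := by
  rw [contDiffOn_infty]
  intro n
  induction n generalizing f with
  | zero => exact contDiffOn_zero.2 hf.continuousOn
  | succ n ih =>
    rw [show ((n + 1 : ℕ) : WithTop ℕ∞) = (n : WithTop ℕ∞) + 1 from rfl,
      contDiffOn_succ_iff_fderiv_of_isOpen hO]
    refine ⟨hf, by simp, ?_⟩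
    rw [contDiffOn_clm_apply]
    exact fun v => ih (differentiableOn_fderiv_apply hf hO v)

end Holomorphic

/-! ### The dual pairing in a frame -/

section DualForm

variable {ι : Type*} [Fintype ι] [DecidableEq ι]

/-- The complex bilinear form on `ℂ^ι` with the real matrix `K`. -/
def dualForm (K : Matrix ι ι ℝ) : (ι → ℂ) →ₗ[ℂ] (ι → ℂ) →ₗ[ℂ] ℂ :=
  Matrix.toLinearMap₂' ℂ (K.map Complex.ofReal)

theorem dualForm_apply (K : Matrix ι ι ℝ) (a b : ι → ℂ) :
    dualForm K a b = ∑ i, ∑ j, a i * b j * (K i j : ℂ) := by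
  simp [dualForm, Matrix.toLinearMap₂'_apply, mul_assoc]

theorem dualForm_swap {K : Matrix ι ι ℝ} (hK : K.transpose = -K) (a b : ι → ℂ) :
    dualForm K a b = -dualForm K b a := by
  have h : ∀ i j, (K i j : ℂ) = -(K j i : ℂ) := fun i j => by
    have := congrFun (congrFun hK j) i
    simp only [Matrix.transpose_apply, Matrix.neg_apply] at this
    exact_mod_cast this
  rw [dualForm_apply, dualForm_apply, Finset.sum_comm, ← Finset.sum_neg_distrib]
  refine Finset.sum_congr rfl fun i _ => ?_
  rw [← Finset.sum_neg_distrib]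
  refine Finset.sum_congr rfl fun j _ => ?_
  rw [h j i]; ring

theorem star_dualForm (K : Matrix ι ι ℝ) (a b : ι → ℂ) :
    star (dualForm K a b) = dualForm K (star a) (star b) := by
  simp [dualForm_apply, star_sum]

theorem dualForm_eq_zero {K : Matrix ι ι ℝ} (hdet : K.det ≠ 0) {a : ι → ℂ}
    (h : ∀ b, dualForm K a b = 0) : a = 0 := by
  by_contra ha
  have hdet' : (K.map Complex.ofReal).det ≠ 0 := by
    have : (K.map Complex.ofReal).det = (K.det : ℂ) := (RingHom.map_det Complex.ofRealHom K).symm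
    rw [this]; exact_mod_cast hdet
  refine hdet' (Matrix.exists_vecMul_eq_zero_iff.1 ⟨a, ha, ?_⟩)
  ext j
  have := h (Pi.single j 1)
  rw [dualForm_apply] at this
  simpa [Matrix.vecMul, dotProduct, Pi.single_apply] using this

end DualForm

section DualPairing

variable {L : Type v} [AddCommGroup L] (b : LinearMap.BilinForm ℤ L)

/-- A homomorphism to `ℂ` that vanishes on the radical of the form `b`, as a bare function. -/
structure IsGaugeFunctional (a : L → ℂ) : Prop where
  map_add : ∀ γ γ', a (γ + γ') = a γ + a γ'
  map_radical : ∀ ρ, (∀ γ, b ρ γ = 0) → a ρ = 0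

/-- Elements whose classes form a basis of the quotient of `L` by the radical of `b`. -/
structure IsGaugeBasis {ι : Type*} [Fintype ι] (s : ι → L) : Prop where
  span : ∀ γ, ∃ (n : ι → ℤ) (ρ : L), (∀ γ', b ρ γ' = 0) ∧ γ = ∑ i, n i • s i + ρ
  indep : ∀ n : ι → ℤ, (∀ γ', b (∑ i, n i • s i) γ' = 0) → n = 0

/-- The matrix of the dual pairing in the coordinates `a ↦ (a (s i))_i`: the transposed inverse of
the Gram matrix of `s`. -/
def dualMatrix {ι : Type*} [Fintype ι] [DecidableEq ι] (s : ι → L) : Matrix ι ι ℝ :=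
  (Matrix.of fun i j => (b (s i) (s j) : ℝ))⁻¹.transpose

variable {b}

namespace IsGaugeFunctional

variable {a a' : L → ℂ}

theorem map_zsmul (h : IsGaugeFunctional b a) (n : ℤ) (γ : L) : a (n • γ) = n * a γ := by
  simpa using _root_.map_zsmul (AddMonoidHom.mk' a h.map_add) n γ

theorem map_sum (h : IsGaugeFunctional b a) {ι : Type*} [Fintype ι] (n : ι → ℤ) (s : ι → L) :
    a (∑ i, n i • s i) = ∑ i, n i * a (s i) := by
  have := _root_.map_sum (AddMonoidHom.mk' a h.map_add) (fun i => n i • s i) Finset.univ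
  simpa only [AddMonoidHom.mk'_apply, h.map_zsmul] using this

theorem expand (h : IsGaugeFunctional b a) {ι : Type*} [Fintype ι] {n : ι → ℤ} {s : ι → L} {ρ : L}
    (hρ : ∀ γ', b ρ γ' = 0) : a (∑ i, n i • s i + ρ) = ∑ i, n i * a (s i) := by
  rw [h.map_add, h.map_sum, h.map_radical ρ hρ, add_zero]

theorem ext (h : IsGaugeFunctional b a) (h' : IsGaugeFunctional b a') {ι : Type*} [Fintype ι]
    {s : ι → L} (hs : IsGaugeBasis b s) (he : ∀ i, a (s i) = a' (s i)) (γ : L) : a γ = a' γ := by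
  obtain ⟨n, ρ, hρ, rfl⟩ := hs.span γ
  rw [h.expand hρ, h'.expand hρ]
  simp [he]

theorem conj (h : IsGaugeFunctional b a) :
    IsGaugeFunctional b (fun γ => (starRingEnd ℂ) (a γ)) where
  map_add γ γ' := by simp only [h.map_add, _root_.map_add]
  map_radical ρ hρ := by simp [h.map_radical ρ hρ]

end IsGaugeFunctional

variable {ι : Type*} [Fintype ι] [DecidableEq ι] {s : ι → L}

theorem IsGaugeBasis.gram_det_ne_zero (hs : IsGaugeBasis b s) (hb : ∀ γ γ', b γ γ' = -b γ' γ) :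
    (Matrix.of fun i j => (b (s i) (s j) : ℝ)).det ≠ 0 := by
  have h1 : (Matrix.of fun i j => b (s i) (s j)).det ≠ 0 := by
    intro h0
    obtain ⟨n, hn, hn0⟩ := Matrix.exists_vecMul_eq_zero_iff.2 h0
    refine hn (hs.indep n fun γ' => ?_)
    obtain ⟨n', ρ, hρ, rfl⟩ := hs.span γ'
    have hj : ∀ j, b (∑ i, n i • s i) (s j) = 0 := fun j => by
      have := congrFun hn0 j
      simpa [Matrix.vecMul, dotProduct] using this
    generalize ∑ i, n i • s i = g at hj ⊢
    simp only [map_add, map_sum, map_zsmul, hj, smul_zero, Finset.sum_const_zero, zero_add]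
    rw [hb, hρ, neg_zero]
  have h2 : (Matrix.of fun i j => (b (s i) (s j) : ℝ)).det =
      ((Matrix.of fun i j => b (s i) (s j)).det : ℝ) := by
    have := RingHom.map_det (Int.castRingHom ℝ) (Matrix.of fun i j => b (s i) (s j))
    rw [eq_intCast] at this
    rw [this]; rfl
  rw [h2]; exact_mod_cast h1

theorem IsGaugeBasis.dualMatrix_det_ne_zero (hs : IsGaugeBasis b s)
    (hb : ∀ γ γ', b γ γ' = -b γ' γ) : (dualMatrix b s).det ≠ 0 := by
  rw [dualMatrix, Matrix.det_transpose, Matrix.det_nonsing_inv, Ring.inverse_eq_inv']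
  exact inv_ne_zero (hs.gram_det_ne_zero hb)

theorem IsGaugeBasis.dualMatrix_transpose (hs : IsGaugeBasis b s)
    (hb : ∀ γ γ', b γ γ' = -b γ' γ) : (dualMatrix b s).transpose = -dualMatrix b s := by
  have hu : IsUnit (Matrix.of fun i j => (b (s i) (s j) : ℝ)).det :=
    (hs.gram_det_ne_zero hb).isUnit
  set G : Matrix ι ι ℝ := Matrix.of fun i j => (b (s i) (s j) : ℝ) with hG
  have hGt : G.transpose = -G := by
    ext i j
    have := hb (s j) (s i)
    simp only [hG, Matrix.transpose_apply, Matrix.of_apply, Matrix.neg_apply, this, Int.cast_neg]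
  have hneg : (-G)⁻¹ = -G⁻¹ := Matrix.inv_eq_left_inv (by
    rw [neg_mul_neg, Matrix.nonsing_inv_mul _ hu])
  rw [dualMatrix, ← hG, Matrix.transpose_transpose, Matrix.transpose_nonsing_inv, hGt, hneg, neg_neg]

theorem isGaugeFunctional_baseChange (hb : ∀ γ γ', b γ γ' = -b γ' γ) (x : ℂ ⊗[ℤ] L) :
    IsGaugeFunctional b fun γ => b.baseChange ℂ x (1 ⊗ₜ[ℤ] γ) where
  map_add γ γ' := by rw [TensorProduct.tmul_add, map_add]
  map_radical ρ hρ := by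
    induction x using TensorProduct.induction_on with
    | zero => simp
    | tmul c γ => rw [LinearMap.BilinForm.baseChange_tmul, hb, hρ]; simp
    | add x y hx hy => rw [map_add, LinearMap.add_apply, hx, hy, add_zero]

theorem baseChange_swap (hb : ∀ γ γ', b γ γ' = -b γ' γ) (x y : ℂ ⊗[ℤ] L) :
    b.baseChange ℂ x y = -b.baseChange ℂ y x := by
  induction x using TensorProduct.induction_on with
  | zero => simp
  | tmul c γ =>
    induction y using TensorProduct.induction_on with
    | zero => simp
    | tmul c' γ' =>
      rw [LinearMap.BilinForm.baseChange_tmul, LinearMap.BilinForm.baseChange_tmul, hb, neg_smul,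
        mul_comm]
    | add x y hx hy => rw [map_add, map_add, hx, hy, LinearMap.add_apply]; ring
  | add x y hx hy => rw [map_add, map_add, LinearMap.add_apply, hx, hy]; ring

/-- Two elements of `ℂ ⊗ L` that represent the same functional pair equally with everything. -/
theorem baseChange_congr {x x' : ℂ ⊗[ℤ] L}
    (h : ∀ γ : L, b.baseChange ℂ x (1 ⊗ₜ[ℤ] γ) = b.baseChange ℂ x' (1 ⊗ₜ[ℤ] γ)) (y : ℂ ⊗[ℤ] L) :
    b.baseChange ℂ x y = b.baseChange ℂ x' y := by
  induction y using TensorProduct.induction_on with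
  | zero => simp
  | tmul c γ =>
    have : c ⊗ₜ[ℤ] γ = c • ((1 : ℂ) ⊗ₜ[ℤ] γ) := by rw [TensorProduct.smul_tmul', smul_eq_mul, mul_one]
    rw [this, map_smul, map_smul, h]
  | add x y hx hy => rw [map_add, map_add, hx, hy]

/-- The element of `ℂ ⊗ L` that represents a functional, in coordinates. -/
theorem IsGaugeBasis.baseChange_sharp (hs : IsGaugeBasis b s) (hb : ∀ γ γ', b γ γ' = -b γ' γ)
    {a : L → ℂ} (ha : IsGaugeFunctional b a) (γ : L) :
    b.baseChange ℂ (∑ i, (∑ j, a (s j) * (dualMatrix b s i j : ℂ)) ⊗ₜ[ℤ] s i) (1 ⊗ₜ[ℤ] γ) =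
      a γ := by
  refine (isGaugeFunctional_baseChange hb _).ext ha hs (fun k => ?_) γ
  have hu : IsUnit (Matrix.of fun i j => (b (s i) (s j) : ℝ)).det :=
    (hs.gram_det_ne_zero hb).isUnit
  have hinv := Matrix.nonsing_inv_mul _ hu
  have hjk : ∀ j, ∑ i, (dualMatrix b s i j : ℂ) * (b (s i) (s k) : ℂ) =
      if j = k then 1 else 0 := by
    intro j
    have := congrFun (congrFun hinv j) k
    rw [Matrix.mul_apply, Matrix.one_apply] at this
    have h2 := congrArg Complex.ofReal this
    simpa [dualMatrix, apply_ite Complex.ofReal] using h2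
  simp only [map_sum, LinearMap.sum_apply, LinearMap.BilinForm.baseChange_tmul, mul_one,
    zsmul_eq_mul, Finset.mul_sum]
  rw [Finset.sum_comm]
  calc _ = ∑ j, a (s j) * ∑ i, (dualMatrix b s i j : ℂ) * (b (s i) (s k) : ℂ) := by
        refine Finset.sum_congr rfl fun j _ => ?_
        rw [Finset.mul_sum]
        refine Finset.sum_congr rfl fun i _ => ?_
        ring
    _ = a (s k) := by simp [hjk]

/-- In a gauge basis, the dual pairing is given by the transposed inverse of the Gram matrix. -/
theorem IsGaugeBasis.dualPairing_eq (hs : IsGaugeBasis b s) (hb : ∀ γ γ', b γ γ' = -b γ' γ)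
    {a a' : L → ℂ} (ha : IsGaugeFunctional b a) (ha' : IsGaugeFunctional b a') :
    dualPairing b a a' = dualForm (dualMatrix b s) (fun i => a (s i)) (fun i => a' (s i)) := by
  have hsharp : ∀ c : L → ℂ, IsGaugeFunctional b c →
      ∀ γ : L, b.baseChange ℂ (sharp b c) (1 ⊗ₜ[ℤ] γ) = c γ := fun c hc =>
    Classical.epsilon_spec (p := fun x => ∀ γ : L, b.baseChange ℂ x (1 ⊗ₜ[ℤ] γ) = c γ)
      ⟨_, hs.baseChange_sharp hb hc⟩
  rw [dualPairing, baseChange_swap hb,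
    baseChange_congr (fun γ => (hsharp a' ha' γ).trans (hs.baseChange_sharp hb ha' γ).symm),
    ← baseChange_swap hb, map_sum, dualForm_apply]
  refine Finset.sum_congr rfl fun i _ => ?_
  have : (∑ j, a' (s j) * (dualMatrix b s i j : ℂ)) ⊗ₜ[ℤ] s i =
      (∑ j, a' (s j) * (dualMatrix b s i j : ℂ)) • ((1 : ℂ) ⊗ₜ[ℤ] s i) := by
    rw [TensorProduct.smul_tmul', smul_eq_mul, mul_one]
  rw [this, map_smul, hsharp a ha, smul_eq_mul, Finset.sum_mul]
  refine Finset.sum_congr rfl fun j _ => ?_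
  ring

theorem IsGaugeBasis.wedgePairing_eq (hs : IsGaugeBasis b s) (hb : ∀ γ γ', b γ γ' = -b γ' γ)
    {T : Type*} {α β : T → L → ℂ} (hα : ∀ v, IsGaugeFunctional b (α v))
    (hβ : ∀ v, IsGaugeFunctional b (β v)) (v w : T) :
    wedgePairing b α β v w =
      dualForm (dualMatrix b s) (fun i => α v (s i)) (fun i => β w (s i)) -
        dualForm (dualMatrix b s) (fun i => α w (s i)) (fun i => β v (s i)) := by
  rw [wedgePairing, hs.dualPairing_eq hb (hα v) (hβ w), hs.dualPairing_eq hb (hα w) (hβ v)]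

end DualPairing

/-! ### Quaternionic linear algebra -/

section HyperkahlerPoint

variable {T T' : Type*} [AddCommGroup T] [Module ℝ T] [TopologicalSpace T]
  [AddCommGroup T'] [Module ℝ T'] [TopologicalSpace T']

/-- An inner product `g` and three `g`-orthogonal complex structures `J` on a vector space, with
`J₁ J₂ = J₃`, whose associated 2-forms are the given functions `Ω`. -/
structure IsHyperkahlerPoint (Ω : Fin 3 → T → T → ℝ) (g : T →L[ℝ] T →L[ℝ] ℝ)
    (J : Fin 3 → T →L[ℝ] T) : Prop where
  symm : ∀ v w, g v w = g w v
  pos : ∀ v, v ≠ 0 → 0 < g v v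
  sq : ∀ i v, J i (J i v) = -v
  quaternion : ∀ v, J 0 (J 1 v) = J 2 v
  orthogonal : ∀ i v w, g (J i v) (J i w) = g v w
  form : ∀ i v w, Ω i v w = g (J i v) w

namespace IsHyperkahlerPoint

variable {Ω : Fin 3 → T → T → ℝ} {g g' : T →L[ℝ] T →L[ℝ] ℝ} {J J' : Fin 3 → T →L[ℝ] T}

theorem skew (h : IsHyperkahlerPoint Ω g J) (i : Fin 3) (v w : T) :
    g (J i v) w = -g v (J i w) := by
  have := h.orthogonal i v (J i w)
  rw [h.sq, map_neg] at this
  linarith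

theorem eq_zero_of_forall (h : IsHyperkahlerPoint Ω g J) {v : T} (hv : ∀ w, g v w = 0) : v = 0 := by
  by_contra hne
  exact (h.pos v hne).ne' (hv v)

theorem ext_left (h : IsHyperkahlerPoint Ω g J) {v v' : T} (hv : ∀ w, g v w = g v' w) : v = v' := by
  refine sub_eq_zero.1 (h.eq_zero_of_forall fun w => ?_)
  rw [map_sub, sub_apply, hv, sub_self]

/-- Anticommutation follows from orthogonality, since each `J i` is `g`-skew. -/
theorem mul_10 (h : IsHyperkahlerPoint Ω g J) (v : T) : J 1 (J 0 v) = -J 2 v := by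
  refine h.ext_left fun w => ?_
  rw [h.skew, h.skew, neg_neg, h.quaternion, map_neg, neg_apply, h.skew,
    neg_neg]

theorem mul_02 (h : IsHyperkahlerPoint Ω g J) (v : T) : J 0 (J 2 v) = -J 1 v := by
  rw [← h.quaternion, h.sq]

theorem mul_21 (h : IsHyperkahlerPoint Ω g J) (v : T) : J 2 (J 1 v) = -J 0 v := by
  rw [← h.quaternion, h.sq, map_neg]

theorem form_nondegenerate (h : IsHyperkahlerPoint Ω g J) (i : Fin 3) {v : T}
    (hv : ∀ w, Ω i v w = 0) : v = 0 := by
  have h1 : J i v = 0 := h.eq_zero_of_forall fun w => by rw [← h.form, hv]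
  have h2 := h.sq i v
  rw [h1, map_zero] at h2
  exact neg_eq_zero.1 h2.symm

/-- The complex structures are determined by the three 2-forms, as `J_i = -ω_{i+1}⁻¹ ω_{i+2}`. -/
theorem form_apply_J (h : IsHyperkahlerPoint Ω g J) (v w : T) :
    Ω 1 (J 0 v) w = -Ω 2 v w ∧ Ω 2 (J 1 v) w = -Ω 0 v w ∧ Ω 0 (J 2 v) w = -Ω 1 v w := by
  simp only [h.form, h.mul_10, h.mul_21, h.mul_02, map_neg, neg_apply,
    and_self]

theorem J_unique (h : IsHyperkahlerPoint Ω g J) (h' : IsHyperkahlerPoint Ω g' J') (i : Fin 3)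
    (v : T) : J i v = J' i v := by
  have key : ∀ k, (∀ w, Ω k (J i v) w = Ω k (J' i v) w) → J i v = J' i v := by
    intro k hk
    refine sub_eq_zero.1 (h.form_nondegenerate k fun w => ?_)
    rw [h.form, map_sub, map_sub, sub_apply, ← h.form, ← h.form, hk, sub_self]
  have e := h.form_apply_J v
  have e' := h'.form_apply_J v
  fin_cases i
  · exact key 1 fun w => (e w).1.trans (e' w).1.symm
  · exact key 2 fun w => (e w).2.1.trans (e' w).2.1.symm
  · exact key 0 fun w => (e w).2.2.trans (e' w).2.2.symm

/-- Transport along a linear isomorphism. -/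
theorem comap (h : IsHyperkahlerPoint Ω g J) (e : T' ≃L[ℝ] T) :
    IsHyperkahlerPoint (fun i v w => Ω i (e v) (e w))
      ((ContinuousLinearMap.precomp ℝ (e : T' →L[ℝ] T)).comp (g.comp (e : T' →L[ℝ] T)))
      (fun i => (e.symm : T →L[ℝ] T').comp ((J i).comp (e : T' →L[ℝ] T))) where
  symm v w := h.symm _ _
  pos v hv := h.pos _ (by simpa using hv)
  sq i v := by simp [h.sq]
  quaternion v := by simp [h.quaternion]
  orthogonal i v w := by simp [h.orthogonal]
  form i v w := by simp [h.form]

end IsHyperkahlerPoint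

end HyperkahlerPoint

/-! ### The semi-flat hyper-Kähler structure at a point -/

section Values

variable {ι : Type*} [Fintype ι] [DecidableEq ι]

/-- `ω₊` in terms of the values `a`, `a'` of `dZ` and `t`, `t'` of `dθ` on two vectors. -/
def plusVal (K : Matrix ι ι ℝ) (a t a' t' : ι → ℂ) : ℂ :=
  -(1 / (2 * Real.pi)) * (dualForm K a t' - dualForm K a' t)

/-- `ω₃` in terms of the values of `dZ` and `dθ` on two vectors. -/
def threeVal (K : Matrix ι ι ℝ) (a t a' t' : ι → ℂ) : ℂ :=
  1 / (8 * Real.pi) * (2 * (dualForm K a (star a') - dualForm K a' (star a)) -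
    (dualForm K t t' - dualForm K t' t))

/-- The value of `d log 𝒳(ζ)` in terms of the values of `dZ` and `dθ`. -/
def logVal (ζ : ℂ) (a t : ι → ℂ) : ι → ℂ :=
  ζ⁻¹ • a + Complex.I • t + ζ • star a

/-- `ϖ(ζ)` in terms of the values of `dZ` and `dθ` on two vectors. -/
def varpiVal (K : Matrix ι ι ℝ) (ζ : ℂ) (a t a' t' : ι → ℂ) : ℂ :=
  1 / (8 * Real.pi) * (dualForm K (logVal ζ a t) (logVal ζ a' t') -
    dualForm K (logVal ζ a' t') (logVal ζ a t))

theorem star_plusVal (K : Matrix ι ι ℝ) (a t a' t' : ι → ℂ) :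
    star (plusVal K a t a' t') = plusVal K (star a) (star t) (star a') (star t') := by
  simp only [plusVal, star_mul', star_sub, star_dualForm]
  simp

/-- The twistor family in terms of `ω₊` and `ω₃`; the terms in `ζ^{±2}` vanish because `dZ` is
isotropic. -/
theorem varpiVal_eq {K : Matrix ι ι ℝ} (hK : K.transpose = -K) {ζ : ℂ} (hζ : ζ ≠ 0)
    {a t a' t' : ι → ℂ} (ht : star t = t) (ht' : star t' = t') (haa : dualForm K a a' = 0) :
    varpiVal K ζ a t a' t' = -(Complex.I / (2 * ζ)) * plusVal K a t a' t' + threeVal K a t a' t' -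
      Complex.I / 2 * ζ * star (plusVal K a t a' t') := by
  have hss : dualForm K (star a) (star a') = 0 := by rw [← star_dualForm, haa, star_zero]
  have hpi : (Real.pi : ℂ) ≠ 0 := by exact_mod_cast Real.pi_ne_zero
  rw [star_plusVal, ht, ht', varpiVal, dualForm_swap hK (logVal ζ a' t'), plusVal, plusVal,
    threeVal, dualForm_swap hK a' t, dualForm_swap hK a' (star a), dualForm_swap hK t' t,
    dualForm_swap hK (star a') t]
  simp only [logVal, map_add, map_smul, LinearMap.add_apply, LinearMap.smul_apply, smul_eq_mul,
    haa, hss]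
  field_simp
  ring_nf
  simp only [Complex.I_sq]
  ring

end Values

section Model

variable {r : ℕ}

/-- Multiplication by `i` as a real-linear map. -/
def mulI (r : ℕ) : (Fin r → ℂ) →L[ℝ] (Fin r → ℂ) :=
  (Complex.I • ContinuousLinearMap.id ℂ (Fin r → ℂ)).restrictScalars ℝ

/-- The inclusion `ℝ^{2r} → ℂ^{2r}`. -/
def realToComplex (r : ℕ) : (Fin (2 * r) → ℝ) →L[ℝ] (Fin (2 * r) → ℂ) :=
  ContinuousLinearMap.pi fun i => Complex.ofRealCLM.comp (ContinuousLinearMap.proj i)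

@[simp] theorem realToComplex_apply (t : Fin (2 * r) → ℝ) (i) : realToComplex r t i = (t i : ℂ) :=
  rfl

theorem star_realToComplex (t : Fin (2 * r) → ℝ) : star (realToComplex r t) = realToComplex r t := by
  ext i; simp

/-- The linear conditions satisfied by the differential `A` of the periods, in a frame in which the
dual pairing has the matrix `K`: the image of `A` is isotropic, and positive for the hermitian form
`-2i K(a, ā)`. -/
structure IsPeriodMap (K : Matrix (Fin (2 * r)) (Fin (2 * r)) ℝ)
    (A : (Fin r → ℂ) →L[ℂ] (Fin (2 * r) → ℂ)) : Prop where
  antisymm : K.transpose = -K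
  det_ne_zero : K.det ≠ 0
  isotropic : ∀ v w, dualForm K (A v) (A w) = 0
  pos : ∀ v, v ≠ 0 → 0 < (-2 * Complex.I * dualForm K (A v) (star (A v))).re

/-- The real periods `2 Re A`. -/
def realPeriod (A : (Fin r → ℂ) →L[ℂ] (Fin (2 * r) → ℂ)) : (Fin r → ℂ) →L[ℝ] (Fin (2 * r) → ℝ) :=
  ContinuousLinearMap.pi fun i => (2 : ℝ) • Complex.reCLM.comp
    ((ContinuousLinearMap.proj i : (Fin (2 * r) → ℂ) →L[ℝ] ℂ).comp (A.restrictScalars ℝ))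

theorem realToComplex_realPeriod (A : (Fin r → ℂ) →L[ℂ] (Fin (2 * r) → ℂ)) (v : Fin r → ℂ) :
    realToComplex r (realPeriod A v) = A v + star (A v) := by
  ext i
  simp [realPeriod, Complex.add_conj]

/-- The Kähler form `⟨dZ ∧ dZ̄⟩` at a point of the base. -/
def periodKahler (K : Matrix (Fin (2 * r)) (Fin (2 * r)) ℝ)
    (A : (Fin r → ℂ) →L[ℂ] (Fin (2 * r) → ℂ)) : (Fin r → ℂ) →ₗ[ℝ] (Fin r → ℂ) →ₗ[ℝ] ℝ :=
  LinearMap.mk₂ ℝ (fun v w => 2 * (dualForm K (A v) (star (A w))).re)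
    (fun v v' w => by simp [mul_add])
    (fun c v w => by
      have : A (c • v) = (c : ℂ) • A v := by rw [← map_smul]; rfl
      simp [this]; ring)
    (fun v w w' => by simp [mul_add])
    (fun c v w => by
      have : A (c • w) = (c : ℂ) • A w := by rw [← map_smul]; rfl
      have h2 : star ((c : ℂ) • A w) = (c : ℂ) • star (A w) := by simp [star_smul]
      simp only [this, h2, map_smul]
      simp; ring)

theorem periodKahler_apply (K : Matrix (Fin (2 * r)) (Fin (2 * r)) ℝ)
    (A : (Fin r → ℂ) →L[ℂ] (Fin (2 * r) → ℂ)) (v w : Fin r → ℂ) :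
    periodKahler K A v w = 2 * (dualForm K (A v) (star (A w))).re := rfl

theorem dualForm_star_eq (K : Matrix (Fin (2 * r)) (Fin (2 * r)) ℝ)
    (A : (Fin r → ℂ) →L[ℂ] (Fin (2 * r) → ℂ)) (x y : Fin r → ℂ) :
    dualForm K (A x) (star (A y)) =
      (1 / 2 : ℂ) * ((periodKahler K A x y : ℂ) -
        Complex.I * (periodKahler K A (Complex.I • x) y : ℂ)) := by
  apply Complex.ext <;> simp [periodKahler_apply]

theorem periodKahler_I_smul (K : Matrix (Fin (2 * r)) (Fin (2 * r)) ℝ)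
    (A : (Fin r → ℂ) →L[ℂ] (Fin (2 * r) → ℂ)) (x y : Fin r → ℂ) :
    periodKahler K A (Complex.I • x) y = -periodKahler K A x (Complex.I • y) := by
  simp [periodKahler_apply, star_smul]

theorem periodKahler_I_smul_I_smul (K : Matrix (Fin (2 * r)) (Fin (2 * r)) ℝ)
    (A : (Fin r → ℂ) →L[ℂ] (Fin (2 * r) → ℂ)) (x y : Fin r → ℂ) :
    periodKahler K A (Complex.I • x) (Complex.I • y) = periodKahler K A x y := by
  rw [periodKahler_I_smul, smul_smul, Complex.I_mul_I, neg_one_smul, map_neg, neg_neg]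

namespace IsPeriodMap

variable {K : Matrix (Fin (2 * r)) (Fin (2 * r)) ℝ} {A : (Fin r → ℂ) →L[ℂ] (Fin (2 * r) → ℂ)}

theorem star_hermitian (h : IsPeriodMap K A) (x y : Fin r → ℂ) :
    star (dualForm K (A x) (star (A y))) = -dualForm K (A y) (star (A x)) := by
  rw [star_dualForm, star_star, dualForm_swap h.antisymm]

theorem kahler_antisymm (h : IsPeriodMap K A) (x y : Fin r → ℂ) :
    periodKahler K A x y = -periodKahler K A y x := by
  have := congrArg Complex.re (h.star_hermitian x y)
  simp only [Complex.star_def, Complex.conj_re, Complex.neg_re] at this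
  rw [periodKahler_apply, periodKahler_apply, this]; ring

theorem kahler_pos (h : IsPeriodMap K A) {v : Fin r → ℂ} (hv : v ≠ 0) :
    0 < periodKahler K A v (Complex.I • v) := by
  have := h.pos v hv
  have e : periodKahler K A v (Complex.I • v) =
      (-2 * Complex.I * dualForm K (A v) (star (A v))).re := by
    simp [periodKahler_apply, star_smul]
  rwa [e]

theorem eq_zero_of_self (h : IsPeriodMap K A) {v : Fin r → ℂ}
    (hv : dualForm K (A v) (star (A v)) = 0) : v = 0 := by
  by_contra hne
  have := h.pos v hne
  simp [hv] at this

theorem injective (h : IsPeriodMap K A) {v : Fin r → ℂ} (hv : A v = 0) : v = 0 :=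
  h.eq_zero_of_self (by simp [hv])

/-- The image of `A` meets its complex conjugate only in `0`. -/
theorem eq_zero_of_eq_star (h : IsPeriodMap K A) {x y : Fin r → ℂ} (hxy : A x + star (A y) = 0) :
    x = 0 ∧ y = 0 := by
  have h1 : star (A y) = -A x := eq_neg_of_add_eq_zero_right hxy
  have hx : x = 0 := by
    refine h.eq_zero_of_self ?_
    have h2 : A x = -star (A y) := by rw [h1, neg_neg]
    have : dualForm K (star (A y)) (star (A x)) = 0 := by
      rw [← star_dualForm, h.isotropic, star_zero]
    calc dualForm K (A x) (star (A x)) = dualForm K (-star (A y)) (star (A x)) := by rw [← h2]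
      _ = 0 := by rw [map_neg, LinearMap.neg_apply, this, neg_zero]
  refine ⟨hx, h.injective ?_⟩
  rw [hx, map_zero, neg_zero, star_eq_zero] at h1
  exact h1

theorem realPeriod_injective (h : IsPeriodMap K A) : Function.Injective (realPeriod A) := by
  refine (injective_iff_map_eq_zero (realPeriod A)).2 fun v hv => ?_
  have := realToComplex_realPeriod A v
  rw [hv, map_zero] at this
  exact (h.eq_zero_of_eq_star this.symm).1

/-- The real periods identify `ℂ^r` with `ℝ^{2r}`. -/
def periodEquiv (h : IsPeriodMap K A) : (Fin r → ℂ) ≃L[ℝ] (Fin (2 * r) → ℝ) :=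
  (LinearMap.linearEquivOfInjective (realPeriod A : (Fin r → ℂ) →ₗ[ℝ] (Fin (2 * r) → ℝ))
    h.realPeriod_injective (by
      rw [Module.finrank_pi_fintype]
      simp [Complex.finrank_real_complex, mul_comm])).toContinuousLinearEquiv

@[simp] theorem periodEquiv_apply (h : IsPeriodMap K A) (v : Fin r → ℂ) :
    h.periodEquiv v = realPeriod A v := rfl

@[simp] theorem periodEquiv_symm_realPeriod (h : IsPeriodMap K A) (v : Fin r → ℂ) :
    h.periodEquiv.symm (realPeriod A v) = v := by
  rw [← h.periodEquiv_apply, ContinuousLinearEquiv.symm_apply_apply]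

theorem realToComplex_eq (h : IsPeriodMap K A) (t : Fin (2 * r) → ℝ) :
    realToComplex r t = A (h.periodEquiv.symm t) + star (A (h.periodEquiv.symm t)) := by
  rw [← realToComplex_realPeriod, ← h.periodEquiv_apply, ContinuousLinearEquiv.apply_symm_apply]

theorem dualForm_realToComplex (h : IsPeriodMap K A) (x : Fin r → ℂ) (t : Fin (2 * r) → ℝ) :
    dualForm K (A x) (realToComplex r t) = dualForm K (A x) (star (A (h.periodEquiv.symm t))) := by
  rw [h.realToComplex_eq, map_add, h.isotropic, zero_add]

theorem kahler_eq (h : IsPeriodMap K A) (x y : Fin r → ℂ) :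
    dualForm K (A x) (star (A y)) - dualForm K (A y) (star (A x)) = (periodKahler K A x y : ℂ) := by
  rw [sub_eq_add_neg, ← h.star_hermitian, Complex.star_def, Complex.add_conj, periodKahler_apply]

theorem dualForm_real_real (h : IsPeriodMap K A) (t t' : Fin (2 * r) → ℝ) :
    dualForm K (realToComplex r t) (realToComplex r t') =
      (periodKahler K A (h.periodEquiv.symm t) (h.periodEquiv.symm t') : ℂ) := by
  have hss : ∀ x y, dualForm K (star (A x)) (star (A y)) = 0 := fun x y => by
    rw [← star_dualForm, h.isotropic, star_zero]
  rw [h.realToComplex_eq t, h.realToComplex_eq t', ← h.kahler_eq]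
  simp only [map_add, LinearMap.add_apply, h.isotropic, hss]
  rw [dualForm_swap h.antisymm (star _) (A _)]
  ring

theorem logVal_eq (h : IsPeriodMap K A) (ζ : ℂ) (v : Fin r → ℂ) (t : Fin (2 * r) → ℝ) :
    logVal ζ (A v) (realToComplex r t) =
      A (ζ⁻¹ • v + Complex.I • h.periodEquiv.symm t) +
        star (A (star ζ • v - Complex.I • h.periodEquiv.symm t)) := by
  rw [logVal, h.realToComplex_eq t]
  simp only [map_add, map_sub, map_smul, star_sub, star_smul, smul_add, star_star]
  simp only [Complex.star_def, Complex.conj_I, neg_smul]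
  abel

/-- If `d log 𝒳(ζ)` vanishes on `(v, y)`, then `ζ⁻¹ v + i y = 0` and `conj ζ v - i y = 0`, and the sum
of these equations is a nonzero multiple of `v`, as `1 + |ζ|² ≠ 0`. -/
theorem logVal_injective (h : IsPeriodMap K A) {ζ : ℂ} (hζ : ζ ≠ 0) {v : Fin r → ℂ}
    {t : Fin (2 * r) → ℝ} (h0 : logVal ζ (A v) (realToComplex r t) = 0) : v = 0 ∧ t = 0 := by
  rw [h.logVal_eq] at h0
  obtain ⟨h1, h2⟩ := h.eq_zero_of_eq_star h0
  have hv : v = 0 := by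
    have h3 : (ζ⁻¹ + star ζ) • v = 0 := by
      rw [add_smul]
      calc ζ⁻¹ • v + star ζ • v = (ζ⁻¹ • v + Complex.I • h.periodEquiv.symm t) +
          (star ζ • v - Complex.I • h.periodEquiv.symm t) := by abel
        _ = 0 := by rw [h1, h2, add_zero]
    refine (smul_eq_zero.1 h3).resolve_left fun h4 => ?_
    have h5 : ((1 + Complex.normSq ζ : ℝ) : ℂ) = 0 := by
      rw [Complex.ofReal_add, Complex.normSq_eq_conj_mul_self, Complex.ofReal_one]
      have : ζ * (ζ⁻¹ + star ζ) = 0 := by rw [h4, mul_zero]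
      rw [mul_add, mul_inv_cancel₀ hζ] at this
      rw [← this, Complex.star_def, mul_comm ζ]
    have h6 : (0 : ℝ) < 1 + Complex.normSq ζ := by
      have := Complex.normSq_nonneg ζ; linarith
    exact h6.ne' (by exact_mod_cast h5)
  refine ⟨hv, ?_⟩
  rw [hv, smul_zero, zero_add, smul_eq_zero] at h1
  have := h1.resolve_left Complex.I_ne_zero
  simpa using this

/-- The three real 2-forms `ω₁`, `ω₂`, `ω₃` at a point, in the coordinates of the base and the
angles. -/
def _root_.modelForm (K : Matrix (Fin (2 * r)) (Fin (2 * r)) ℝ)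
    (A : (Fin r → ℂ) →L[ℂ] (Fin (2 * r) → ℂ)) (i : Fin 3)
    (v w : (Fin r → ℂ) × (Fin (2 * r) → ℝ)) : ℝ :=
  ![(plusVal K (A v.1) (realToComplex r v.2) (A w.1) (realToComplex r w.2)).re,
    (plusVal K (A v.1) (realToComplex r v.2) (A w.1) (realToComplex r w.2)).im,
    (threeVal K (A v.1) (realToComplex r v.2) (A w.1) (realToComplex r w.2)).re] i

theorem plusVal_eq (h : IsPeriodMap K A) (v w : (Fin r → ℂ) × (Fin (2 * r) → ℝ)) :
    plusVal K (A v.1) (realToComplex r v.2) (A w.1) (realToComplex r w.2) =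
      ((-(4 * Real.pi)⁻¹ * (periodKahler K A v.1 (h.periodEquiv.symm w.2) -
        periodKahler K A w.1 (h.periodEquiv.symm v.2)) : ℝ) : ℂ) +
      (((4 * Real.pi)⁻¹ * (periodKahler K A (Complex.I • v.1) (h.periodEquiv.symm w.2) -
        periodKahler K A (Complex.I • w.1) (h.periodEquiv.symm v.2)) : ℝ) : ℂ) * Complex.I := by
  have hpi : (Real.pi : ℂ) ≠ 0 := by exact_mod_cast Real.pi_ne_zero
  rw [plusVal, h.dualForm_realToComplex, h.dualForm_realToComplex, dualForm_star_eq, dualForm_star_eq]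
  push_cast
  field_simp
  ring

theorem threeVal_eq (h : IsPeriodMap K A) (v w : (Fin r → ℂ) × (Fin (2 * r) → ℝ)) :
    threeVal K (A v.1) (realToComplex r v.2) (A w.1) (realToComplex r w.2) =
      (((4 * Real.pi)⁻¹ * (periodKahler K A v.1 w.1 -
        periodKahler K A (h.periodEquiv.symm v.2) (h.periodEquiv.symm w.2)) : ℝ) : ℂ) := by
  have hpi : (Real.pi : ℂ) ≠ 0 := by exact_mod_cast Real.pi_ne_zero
  rw [threeVal, h.kahler_eq, h.dualForm_real_real, h.dualForm_real_real,
    h.kahler_antisymm (h.periodEquiv.symm w.2)]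
  push_cast
  field_simp
  ring

/-- The complex structures, for the coordinates `(v, y)` with `y ∈ ℂ^r` such that `t = 2 Re A y`:
they are `(-i y, -i v)`, `(y, -v)` and `(i v, -i y)`. -/
def complexStructure (h : IsPeriodMap K A) (i : Fin 3) :
    (Fin r → ℂ) × (Fin (2 * r) → ℝ) →L[ℝ] (Fin r → ℂ) × (Fin (2 * r) → ℝ) :=
  let p := ContinuousLinearMap.fst ℝ (Fin r → ℂ) (Fin (2 * r) → ℝ)
  let q := (h.periodEquiv.symm : (Fin (2 * r) → ℝ) →L[ℝ] (Fin r → ℂ)).comp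
    (ContinuousLinearMap.snd ℝ (Fin r → ℂ) (Fin (2 * r) → ℝ))
  let R := (h.periodEquiv : (Fin r → ℂ) →L[ℝ] (Fin (2 * r) → ℝ))
  ![(-(mulI r).comp q).prod (-R.comp ((mulI r).comp p)),
    q.prod (-R.comp p),
    ((mulI r).comp p).prod (-R.comp ((mulI r).comp q))] i

theorem complexStructure_zero (h : IsPeriodMap K A) (v : (Fin r → ℂ) × (Fin (2 * r) → ℝ)) :
    h.complexStructure 0 v =
      (-(Complex.I • h.periodEquiv.symm v.2), -h.periodEquiv (Complex.I • v.1)) := rfl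

theorem complexStructure_one (h : IsPeriodMap K A) (v : (Fin r → ℂ) × (Fin (2 * r) → ℝ)) :
    h.complexStructure 1 v = (h.periodEquiv.symm v.2, -h.periodEquiv v.1) := rfl

theorem complexStructure_two (h : IsPeriodMap K A) (v : (Fin r → ℂ) × (Fin (2 * r) → ℝ)) :
    h.complexStructure 2 v =
      (Complex.I • v.1, -h.periodEquiv (Complex.I • h.periodEquiv.symm v.2)) := rfl

/-- The metric, for the same coordinates: a multiple of `κ(v, i v') + κ(y, i y')`. -/
def metric (h : IsPeriodMap K A) : (Fin r → ℂ) × (Fin (2 * r) → ℝ) →L[ℝ]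
    (Fin r → ℂ) × (Fin (2 * r) → ℝ) →L[ℝ] ℝ :=
  LinearMap.toContinuousBilinearMap (LinearMap.mk₂ ℝ
    (fun v w => (4 * Real.pi)⁻¹ * (periodKahler K A v.1 (Complex.I • w.1) +
      periodKahler K A (h.periodEquiv.symm v.2) (Complex.I • h.periodEquiv.symm w.2)))
    (fun v v' w => by simp; ring)
    (fun c v w => by simp; ring)
    (fun v w w' => by simp; ring)
    (fun c v w => by simp [smul_comm Complex.I c]; ring))

theorem metric_apply (h : IsPeriodMap K A) (v w : (Fin r → ℂ) × (Fin (2 * r) → ℝ)) :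
    h.metric v w = (4 * Real.pi)⁻¹ * (periodKahler K A v.1 (Complex.I • w.1) +
      periodKahler K A (h.periodEquiv.symm v.2) (Complex.I • h.periodEquiv.symm w.2)) := rfl

/-- The linear algebra of the semi-flat structure: `Re ω₊`, `Im ω₊` and `Re ω₃` are the Kähler forms
of the metric and the complex structures. -/
theorem isHyperkahlerPoint (h : IsPeriodMap K A) :
    IsHyperkahlerPoint (modelForm K A) h.metric h.complexStructure where
  symm v w := by
    rw [h.metric_apply, h.metric_apply, h.kahler_antisymm, periodKahler_I_smul, h.kahler_antisymm
      (h.periodEquiv.symm v.2), periodKahler_I_smul, neg_neg, neg_neg]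
  pos v hv := by
    rw [h.metric_apply]
    have hnn : ∀ x, 0 ≤ periodKahler K A x (Complex.I • x) := fun x => by
      rcases eq_or_ne x 0 with rfl | hx
      · simp
      · exact (h.kahler_pos hx).le
    have hpi : 0 < (4 * Real.pi)⁻¹ := by positivity
    refine mul_pos hpi ?_
    by_cases hv1 : v.1 = 0
    · have hv2 : v.2 ≠ 0 := fun h2 => hv (Prod.ext hv1 h2)
      have := h.kahler_pos (v := h.periodEquiv.symm v.2) (by simpa using hv2)
      have := hnn v.1
      linarith
    · have := h.kahler_pos hv1
      have := hnn (h.periodEquiv.symm v.2)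
      linarith
  sq i v := by
    fin_cases i
    · change h.complexStructure 0 (h.complexStructure 0 v) = -v
      simp only [h.complexStructure_zero]
      ext1 <;> simp [smul_smul]
    · change h.complexStructure 1 (h.complexStructure 1 v) = -v
      simp only [h.complexStructure_one]
      ext1 <;> simp
    · change h.complexStructure 2 (h.complexStructure 2 v) = -v
      simp only [h.complexStructure_two]
      ext1 <;> simp [smul_smul]
  quaternion v := by
    simp only [h.complexStructure_zero, h.complexStructure_one, h.complexStructure_two]
    ext1 <;> simp
  orthogonal i v w := by
    fin_cases i
    · change h.metric (h.complexStructure 0 v) (h.complexStructure 0 w) = _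
      simp only [h.complexStructure_zero, h.metric_apply, map_neg, smul_neg, LinearMap.neg_apply,
        neg_neg, ContinuousLinearEquiv.symm_apply_apply, periodKahler_I_smul_I_smul]
      ring
    · change h.metric (h.complexStructure 1 v) (h.complexStructure 1 w) = _
      simp only [h.complexStructure_one, h.metric_apply, map_neg, smul_neg, LinearMap.neg_apply,
        neg_neg, ContinuousLinearEquiv.symm_apply_apply]
      ring
    · change h.metric (h.complexStructure 2 v) (h.complexStructure 2 w) = _
      simp only [h.complexStructure_two, h.metric_apply, map_neg, smul_neg, LinearMap.neg_apply,
        neg_neg, ContinuousLinearEquiv.symm_apply_apply, periodKahler_I_smul_I_smul]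
  form i v w := by
    fin_cases i
    · change (plusVal _ _ _ _ _).re = h.metric (h.complexStructure 0 v) w
      rw [h.plusVal_eq, h.metric_apply, h.complexStructure_zero]
      simp only [Complex.add_re, Complex.ofReal_re, Complex.re_ofReal_mul, Complex.I_re, mul_zero,
        add_zero, map_neg, LinearMap.neg_apply, periodKahler_I_smul_I_smul,
        ContinuousLinearEquiv.symm_apply_apply]
      rw [h.kahler_antisymm w.1]
      ring
    · change (plusVal _ _ _ _ _).im = h.metric (h.complexStructure 1 v) w
      rw [h.plusVal_eq, h.metric_apply, h.complexStructure_one]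
      simp only [Complex.add_im, Complex.ofReal_im, Complex.im_ofReal_mul, Complex.I_im, mul_one,
        zero_add, map_neg, LinearMap.neg_apply, ContinuousLinearEquiv.symm_apply_apply]
      rw [h.kahler_antisymm (Complex.I • w.1), periodKahler_I_smul K A v.1]
      ring
    · change (threeVal _ _ _ _ _).re = h.metric (h.complexStructure 2 v) w
      rw [h.threeVal_eq, h.metric_apply, h.complexStructure_two]
      simp only [Complex.ofReal_re, map_neg, LinearMap.neg_apply, periodKahler_I_smul_I_smul,
        ContinuousLinearEquiv.symm_apply_apply]
      ring

/-- `d log 𝒳(i)` is of type `(1, 0)` for `J₁`. -/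
theorem logVal_complexStructure_zero (h : IsPeriodMap K A)
    (v : (Fin r → ℂ) × (Fin (2 * r) → ℝ)) :
    logVal Complex.I (A (h.complexStructure 0 v).1) (realToComplex r (h.complexStructure 0 v).2) =
      Complex.I • logVal Complex.I (A v.1) (realToComplex r v.2) := by
  have e : ∀ x y : Fin (2 * r) → ℂ, Complex.I • (x + star y) =
      Complex.I • x + star ((-Complex.I) • y) := fun x y => by
    rw [smul_add, star_smul]; simp
  rw [h.logVal_eq, h.logVal_eq, e, ← map_smul A, ← map_smul A, h.complexStructure_zero]
  congr 3
  · simp only [smul_add, smul_neg, smul_smul, Complex.inv_I, neg_smul, Complex.I_mul_I,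
      map_neg, periodEquiv_apply, periodEquiv_symm_realPeriod]
    simp [add_comm]
  · simp [smul_smul, sub_eq_add_neg, add_comm]

/-- `d log 𝒳(-1)` is of type `(1, 0)` for `J₂`. -/
theorem logVal_complexStructure_one (h : IsPeriodMap K A)
    (v : (Fin r → ℂ) × (Fin (2 * r) → ℝ)) :
    logVal (-1) (A (h.complexStructure 1 v).1) (realToComplex r (h.complexStructure 1 v).2) =
      Complex.I • logVal (-1) (A v.1) (realToComplex r v.2) := by
  have e : ∀ x y : Fin (2 * r) → ℂ, Complex.I • (x + star y) =
      Complex.I • x + star ((-Complex.I) • y) := fun x y => by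
    rw [smul_add, star_smul]; simp
  rw [h.logVal_eq, h.logVal_eq, e, ← map_smul A, ← map_smul A, h.complexStructure_one]
  congr 3
  · simp [smul_smul]; abel
  · simp [smul_smul, smul_sub]; abel

theorem dualForm_complexStructure_two (h : IsPeriodMap K A) (x : Fin r → ℂ)
    (v : (Fin r → ℂ) × (Fin (2 * r) → ℝ)) :
    dualForm K (A x) (realToComplex r (h.complexStructure 2 v).2) =
      Complex.I * dualForm K (A x) (realToComplex r v.2) := by
  rw [h.dualForm_realToComplex, h.dualForm_realToComplex, h.complexStructure_two]
  simp [star_smul]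

theorem eq_zero_of_dualForm (h : IsPeriodMap K A) {t : Fin (2 * r) → ℝ}
    (ht : ∀ x, dualForm K (A x) (realToComplex r t) = 0) : t = 0 := by
  have := ht (h.periodEquiv.symm t)
  rw [h.dualForm_realToComplex] at this
  simpa using h.eq_zero_of_self this

end IsPeriodMap

end Model

/-! ### Two-forms, complex structures and metrics in charts -/

section WedgeForm

variable {W F : Type*} [NormedAddCommGroup W] [NormedSpace ℝ W] [NormedAddCommGroup F]
  [NormedSpace ℝ F]

/-- The alternating form `(v, w) ↦ B(v, w) - B(w, v)`. -/
def altForm (B : W →L[ℝ] W →L[ℝ] F) : W [⋀^Fin 2]→L[ℝ] F where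
  toFun v := B (v 0) (v 1) - B (v 1) (v 0)
  map_update_add' := by
    intro _ m i x y
    fin_cases i <;> simp [Function.update] <;> abel
  map_update_smul' := by
    intro _ m i c x
    fin_cases i <;> simp [Function.update, smul_sub]
  cont := by fun_prop
  map_eq_zero_of_eq' := by
    intro v i j hv hij
    fin_cases i <;> fin_cases j <;> simp_all

/-- `altForm` as a linear map. -/
def altFormLM (W F : Type*) [NormedAddCommGroup W] [NormedSpace ℝ W] [NormedAddCommGroup F]
    [NormedSpace ℝ F] : (W →L[ℝ] W →L[ℝ] F) →ₗ[ℝ] W [⋀^Fin 2]→L[ℝ] F where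
  toFun := altForm
  map_add' B B' := by
    ext v
    change (B + B') (v 0) (v 1) - (B + B') (v 1) (v 0) =
      (B (v 0) (v 1) - B (v 1) (v 0)) + (B' (v 0) (v 1) - B' (v 1) (v 0))
    simp only [add_apply]; abel
  map_smul' c B := by
    ext v
    change (c • B) (v 0) (v 1) - (c • B) (v 1) (v 0) = c • (B (v 0) (v 1) - B (v 1) (v 0))
    simp only [smul_apply, smul_sub]

theorem norm_altFormLM_le (W F : Type*) [NormedAddCommGroup W] [NormedSpace ℝ W]
    [NormedAddCommGroup F] [NormedSpace ℝ F] (B : W →L[ℝ] W →L[ℝ] F) :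
    ‖altFormLM W F B‖ ≤ 2 * ‖B‖ := by
  refine ContinuousAlternatingMap.opNorm_le_bound _ (by positivity) fun v => ?_
  rw [Fin.prod_univ_two]
  change ‖B (v 0) (v 1) - B (v 1) (v 0)‖ ≤ _
  calc _ ≤ ‖B (v 0) (v 1)‖ + ‖B (v 1) (v 0)‖ := norm_sub_le _ _
    _ ≤ ‖B‖ * ‖v 0‖ * ‖v 1‖ + ‖B‖ * ‖v 1‖ * ‖v 0‖ :=
      add_le_add (B.le_opNorm₂ _ _) (B.le_opNorm₂ _ _)
    _ = 2 * ‖B‖ * (‖v 0‖ * ‖v 1‖) := by ring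

/-- `altForm` as a continuous linear map. -/
def altFormCLM (W F : Type*) [NormedAddCommGroup W] [NormedSpace ℝ W] [NormedAddCommGroup F]
    [NormedSpace ℝ F] : (W →L[ℝ] W →L[ℝ] F) →L[ℝ] W [⋀^Fin 2]→L[ℝ] F :=
  { toLinearMap := altFormLM W F
    cont := AddMonoidHomClass.continuous_of_bound (altFormLM W F) 2 (norm_altFormLM_le W F) }

end WedgeForm

section Kernel

variable {T : Type*} [AddCommGroup T] [Module ℝ T] [TopologicalSpace T]

omit [TopologicalSpace T] in
theorem exists_re_im (x : ℂ ⊗[ℝ] T) :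
    ∃ a b : T, x = (1 : ℂ) ⊗ₜ[ℝ] a + Complex.I ⊗ₜ[ℝ] b := by
  induction x using TensorProduct.induction_on with
  | zero => exact ⟨0, 0, by simp⟩
  | tmul c v =>
    refine ⟨c.re • v, c.im • v, ?_⟩
    rw [← TensorProduct.smul_tmul, ← TensorProduct.smul_tmul, ← TensorProduct.add_tmul]
    congr 1
    apply Complex.ext <;> simp
  | add x y hx hy =>
    obtain ⟨a, b, rfl⟩ := hx
    obtain ⟨a', b', rfl⟩ := hy
    exact ⟨a + a', b + b', by rw [TensorProduct.tmul_add, TensorProduct.tmul_add]; abel⟩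

theorem mem_formKer_iff (Ω : T [⋀^Fin 2]→L[ℝ] ℂ) (a b : T) :
    (1 : ℂ) ⊗ₜ[ℝ] a + Complex.I ⊗ₜ[ℝ] b ∈ formKer Ω ↔
      ∀ w, Ω ![a, w] + Complex.I * Ω ![b, w] = 0 := by
  have key : ∀ (c : T) (w : Fin 1 → T), Ω.toAlternatingMap.curryLeft c w = Ω ![c, w 0] := by
    intro c w
    have : w = ![w 0] := by ext i; fin_cases i; rfl
    change Ω (Matrix.vecCons c w) = _
    rw [this]; rfl
  rw [formKer, LinearMap.mem_ker, map_add, LinearMap.liftBaseChange_tmul,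
    LinearMap.liftBaseChange_tmul, one_smul]
  constructor
  · intro h w
    have := congrArg (fun f => f ![w]) h
    simpa [key] using this
  · intro h
    ext w
    simpa [key] using h (w 0)

/-- If a nondegenerate complex 2-form is complex linear for a complex structure `J`, its kernel and
the kernel of its conjugate are the spaces of vectors of type `(0, 1)` and `(1, 0)`. -/
theorem isCompl_formKer {Ω : T [⋀^Fin 2]→L[ℝ] ℂ} {J : T → T} (hJ : ∀ v, J (J v) = -v)
    (hJadd : ∀ v w, J (v + w) = J v + J w)
    (hΩ : ∀ v w, Ω ![J v, w] = Complex.I * Ω ![v, w])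
    (hnd : ∀ v, (∀ w, Ω ![v, w] = 0) → v = 0) : IsCompl (formKer Ω) (formKer (conjForm Ω)) := by
  have hadd : ∀ a b w, Ω ![a + b, w] = Ω ![a, w] + Ω ![b, w] := fun a b w => by
    have h := Ω.map_update_add ![a, w] 0 a b
    have e : ∀ x : T, Function.update ![a, w] 0 x = ![x, w] := fun x => by
      ext i; fin_cases i <;> rfl
    simpa only [e] using h
  have hneg : ∀ a w, Ω ![-a, w] = -Ω ![a, w] := fun a w => by
    have h := Ω.map_update_smul ![a, w] 0 (-1 : ℝ) a
    have e : ∀ x : T, Function.update ![a, w] 0 x = ![x, w] := fun x => by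
      ext i; fin_cases i <;> rfl
    simpa only [e, neg_one_smul] using h
  have hJneg : ∀ v, J (-v) = -J v := fun v => by rw [← hJ v, hJ, ← hJ (J v)]
  have h1 : ∀ a b, (1 : ℂ) ⊗ₜ[ℝ] a + Complex.I ⊗ₜ[ℝ] b ∈ formKer Ω ↔ a = -J b := by
    intro a b
    rw [mem_formKer_iff]
    have e : ∀ w, Ω ![a, w] + Complex.I * Ω ![b, w] = Ω ![a + J b, w] := fun w => by
      rw [hadd, hΩ]
    simp only [e]
    constructor
    · exact fun h => eq_neg_of_add_eq_zero_left (hnd _ h)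
    · rintro rfl w
      rw [← e, hneg, hΩ]; ring
  have h2 : ∀ a b, (1 : ℂ) ⊗ₜ[ℝ] a + Complex.I ⊗ₜ[ℝ] b ∈ formKer (conjForm Ω) ↔ a = J b := by
    intro a b
    rw [mem_formKer_iff]
    have e : ∀ w, conjForm Ω ![a, w] + Complex.I * conjForm Ω ![b, w] =
        (starRingEnd ℂ) (Ω ![a + J (-b), w]) := fun w => by
      rw [hadd, hΩ, hneg]
      change (starRingEnd ℂ) (Ω ![a, w]) + Complex.I * (starRingEnd ℂ) (Ω ![b, w]) = _
      simp
    simp only [e, map_eq_zero]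
    constructor
    · intro h
      have := hnd _ h
      rw [hJneg, ← sub_eq_add_neg] at this
      exact sub_eq_zero.1 this
    · rintro rfl w
      rw [hJneg, add_neg_cancel]
      have := hadd 0 0 w
      rw [add_zero] at this
      exact left_eq_add.1 this
  refine ⟨Submodule.disjoint_def.2 fun x hx hx' => ?_, codisjoint_iff.2 (eq_top_iff.2 ?_)⟩
  · obtain ⟨a, b, rfl⟩ := exists_re_im x
    rw [h1] at hx
    rw [h2] at hx'
    have hJb : J b = 0 := by
      rw [hx] at hx'
      have h4 : (2 : ℝ) • J b = 0 := by
        rw [two_smul]; nth_rewrite 1 [← hx']; exact neg_add_cancel _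
      exact (smul_eq_zero.1 h4).resolve_left two_ne_zero
    have hb : b = 0 := by
      have := hJ b
      rw [hJb] at this
      have h0 : J 0 = 0 := by simpa using hJadd 0 0
      rw [h0] at this
      exact neg_eq_zero.1 this.symm
    rw [hx, hJb, hb]; simp
  · intro x _
    obtain ⟨a, b, rfl⟩ := exists_re_im x
    -- `x` splits as the sum of the parts with `2 b₁ = b + J a` and `2 b₂ = b - J a`
    have hx : (1 : ℂ) ⊗ₜ[ℝ] a + Complex.I ⊗ₜ[ℝ] b =
        (1 / 2 : ℂ) • ((1 : ℂ) ⊗ₜ[ℝ] (-J (b + J a)) + Complex.I ⊗ₜ[ℝ] (b + J a)) +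
        (1 / 2 : ℂ) • ((1 : ℂ) ⊗ₜ[ℝ] (J (b + -J a)) + Complex.I ⊗ₜ[ℝ] (b + -J a)) := by
      rw [← smul_add]
      have h3 : (1 : ℂ) ⊗ₜ[ℝ] (-J (b + J a)) + Complex.I ⊗ₜ[ℝ] (b + J a) +
          ((1 : ℂ) ⊗ₜ[ℝ] (J (b + -J a)) + Complex.I ⊗ₜ[ℝ] (b + -J a)) =
          (2 : ℂ) • ((1 : ℂ) ⊗ₜ[ℝ] a + Complex.I ⊗ₜ[ℝ] b) := by
        rw [hJadd, hJadd, hJneg, hJ, two_smul]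
        simp only [TensorProduct.tmul_add, TensorProduct.tmul_neg]
        abel
      rw [h3, smul_smul]; norm_num
    rw [hx]
    exact Submodule.add_mem_sup (Submodule.smul_mem _ _ ((h1 _ _).2 rfl))
      (Submodule.smul_mem _ _ ((h2 _ _).2 rfl))

end Kernel

section Charts

variable {E : Type u} [NormedAddCommGroup E] [NormedSpace ℝ E] {H : Type v} [TopologicalSpace H]
  {I : ModelWithCorners ℝ E H} [I.Boundaryless] {M : Type w} [TopologicalSpace M]
  [ChartedSpace H M] [IsManifold I ∞ M]

omit [I.Boundaryless] in
theorem isManifold_one_of_infty : IsManifold I 1 M :=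
  IsManifold.of_le (n := ∞) (by exact_mod_cast le_top)

/-- The differentials of a chart and of its inverse are inverse to each other. -/
theorem mfderiv_extChartAt_comp_symm (m₀ : M) {y : E} (hy : y ∈ (extChartAt I m₀).target) (v : E) :
    mfderiv I 𝓘(ℝ, E) (extChartAt I m₀) ((extChartAt I m₀).symm y)
      (mfderiv 𝓘(ℝ, E) I (extChartAt I m₀).symm y v) = v := by
  have := isManifold_one_of_infty (I := I) (M := M)
  have h := mfderiv_extChartAt_comp_mfderivWithin_extChartAt_symm (I := I) hy
  rw [I.range_eq_univ, mfderivWithin_univ] at h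
  exact congrArg (fun f => f v) h

theorem mfderiv_symm_comp_extChartAt (m₀ : M) {m : M} (hm : m ∈ (extChartAt I m₀).source)
    (v : TangentSpace I m) :
    mfderiv 𝓘(ℝ, E) I (extChartAt I m₀).symm (extChartAt I m₀ m)
      (mfderiv I 𝓘(ℝ, E) (extChartAt I m₀) m v) = v := by
  have := isManifold_one_of_infty (I := I) (M := M)
  have h := mfderivWithin_extChartAt_symm_comp_mfderiv_extChartAt' (I := I) hm
  rw [I.range_eq_univ, mfderivWithin_univ] at h
  exact congrArg (fun f => f v) h

omit [I.Boundaryless] in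
/-- A function whose chart expression is differentiable is differentiable, with the differential
computed in the chart. -/
theorem hasMFDerivAt_of_chart {F : Type*} [NormedAddCommGroup F] [NormedSpace ℝ F] {f : M → F}
    (m₀ : M) {m : M} (hm : m ∈ (extChartAt I m₀).source) {G : E → F} {G' : E →L[ℝ] F}
    (hG : HasFDerivAt G G' (extChartAt I m₀ m))
    (hf : ∀ᶠ y in 𝓝 (extChartAt I m₀ m), f ((extChartAt I m₀).symm y) = G y) :
    HasMFDerivAt I 𝓘(ℝ, F) f m (G'.comp (mfderiv I 𝓘(ℝ, E) (extChartAt I m₀) m)) := by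
  have := isManifold_one_of_infty (I := I) (M := M)
  have hm' : m ∈ (chartAt H m₀).source := by rwa [extChartAt_source] at hm
  have hchart := (mdifferentiableAt_extChartAt (I := I) hm').hasMFDerivAt
  have h1 := hG.hasMFDerivAt.comp m hchart
  refine h1.congr_of_eventuallyEq ?_
  have hcont : ContinuousAt (extChartAt I m₀) m := continuousAt_extChartAt' hm
  filter_upwards [hcont.eventually hf, (isOpen_extChartAt_source (I := I) m₀).mem_nhds hm]
    with m' h2 h3
  rw [(extChartAt I m₀).left_inv h3] at h2
  exact h2

variable {W F : Type*} [NormedAddCommGroup W] [NormedSpace ℝ W] [NormedAddCommGroup F]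
  [NormedSpace ℝ F]

/-- A 2-form that in charts is locally the pullback of a constant form under a smooth map to a vector
space is smooth and closed. -/
theorem isClosedForm_of_chart_pullback {Ω : ∀ m : M, TangentSpace I m [⋀^Fin 2]→L[ℝ] F}
    (h : ∀ m₀ : M, ∃ (G : E → W) (B : E → W →L[ℝ] W →L[ℝ] F), ∀ y ∈ (extChartAt I m₀).target,
      ContDiffAt ℝ ∞ G y ∧ (∀ᶠ y' in 𝓝 y, B y' = B y) ∧
      ∀ v w : TangentSpace I ((extChartAt I m₀).symm y), Ω ((extChartAt I m₀).symm y) ![v, w] =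
        altForm (B y)
          ![fderiv ℝ G y (mfderiv I 𝓘(ℝ, E) (extChartAt I m₀) ((extChartAt I m₀).symm y) v),
          fderiv ℝ G y (mfderiv I 𝓘(ℝ, E) (extChartAt I m₀) ((extChartAt I m₀).symm y) w)]) :
    IsClosedForm I Ω := by
  intro m₀
  obtain ⟨G, B, hG⟩ := h m₀
  have hopen : IsOpen (extChartAt I m₀).target := isOpen_extChartAt_target m₀
  have hform : ∀ y ∈ (extChartAt I m₀).target, chartForm I Ω m₀ y =
      (altForm (B y)).compContinuousLinearMap (fderiv ℝ G y) := by
    intro y hy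
    ext v
    have e := (hG y hy).2.2 (mfderiv 𝓘(ℝ, E) I (extChartAt I m₀).symm y (v 0))
      (mfderiv 𝓘(ℝ, E) I (extChartAt I m₀).symm y (v 1))
    rw [mfderiv_extChartAt_comp_symm m₀ hy, mfderiv_extChartAt_comp_symm m₀ hy] at e
    refine Eq.trans ?_ e
    exact congrArg (Ω ((extChartAt I m₀).symm y)) (by ext i; fin_cases i <;> rfl)
  have hloc : ∀ y ∈ (extChartAt I m₀).target, chartForm I Ω m₀ =ᶠ[𝓝 y]
      fun y' => (altForm (B y)).compContinuousLinearMap (fderiv ℝ G y') := by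
    intro y hy
    filter_upwards [hopen.mem_nhds hy, (hG y hy).2.1] with y' hy' hκ
    rw [hform y' hy', hκ]
  refine ⟨fun y hy => ContDiffAt.contDiffWithinAt ?_, fun y hy => ?_⟩
  · refine ContDiffAt.congr_of_eventuallyEq ?_ (hloc y hy)
    have hG' : ContDiffAt ℝ ∞ (fderiv ℝ G) y :=
      (hG y hy).1.fderiv_right (m := ∞) (by exact_mod_cast le_top)
    have e : (fun y' => (altForm (B y)).compContinuousLinearMap (fderiv ℝ G y')) =
        fun y' => altFormCLM E F ((ContinuousLinearMap.compL ℝ E W F).flip (fderiv ℝ G y') ∘L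
          (B y ∘L fderiv ℝ G y')) := by
      ext y' v
      rfl
    rw [e]
    exact (altFormCLM E F).contDiff.contDiffAt.comp y
      ((((ContinuousLinearMap.compL ℝ E W F).flip.contDiff.contDiffAt.comp y hG')).clm_comp
        (contDiffAt_const.clm_comp hG'))
  · rw [(hloc y hy).extDeriv_eq]
    have := extDeriv_pullback (f := G) (x := y) (r := ∞)
      (differentiableAt_const (altForm (B y)) :
        DifferentiableAt ℝ (fun _ : W => altForm (B y)) (G y)) (hG y hy).1
        (by
          simp only [minSmoothness_of_isRCLikeNormedField]
          exact WithTop.coe_le_coe.2 (le_top : (2 : ℕ∞) ≤ ⊤))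
    rw [this]
    have h0 : extDeriv (fun _ : W => altForm (B y)) (G y) = 0 := by
      ext v
      rw [extDeriv_apply (differentiableAt_const _)]
      simp
    rw [h0]; rfl

/-- An almost complex structure is integrable if near every point there is a map from the chart
domain to a complex vector space, with bijective differentials that are complex linear. -/
theorem isComplexStructure_of_chart {J : ∀ m : M, TangentSpace I m →L[ℝ] TangentSpace I m}
    (hsq : ∀ m v, J m (J m v) = -v) (W : Type*) [NormedAddCommGroup W] [NormedSpace ℂ W]
    [FiniteDimensional ℂ W]
    (h : ∀ m₀ : M, ∃ G : E → W, ∀ᶠ m in 𝓝 m₀, ContDiffAt ℝ ∞ G (extChartAt I m₀ m) ∧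
      Function.Injective (fderiv ℝ G (extChartAt I m₀ m)) ∧
      Function.Surjective (fderiv ℝ G (extChartAt I m₀ m)) ∧
      ∀ v : TangentSpace I m,
        fderiv ℝ G (extChartAt I m₀ m) (mfderiv I 𝓘(ℝ, E) (extChartAt I m₀) m (J m v)) =
          Complex.I •
            fderiv ℝ G (extChartAt I m₀ m) (mfderiv I 𝓘(ℝ, E) (extChartAt I m₀) m v)) :
    IsComplexStructure I J where
  sq := hsq
  integrable m₀ := by
    obtain ⟨G, hG⟩ := h m₀
    let e : W ≃L[ℂ] (Fin (Module.finrank ℂ W) → ℂ) :=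
      (Module.finBasis ℂ W).equivFun.toContinuousLinearEquiv
    let eR : W →L[ℝ] (Fin (Module.finrank ℂ W) → ℂ) :=
      (e : W →L[ℂ] (Fin (Module.finrank ℂ W) → ℂ)).restrictScalars ℝ
    refine ⟨_, fun m => eR (G (extChartAt I m₀ m)), ?_⟩
    filter_upwards [hG, (isOpen_extChartAt_source (I := I) m₀).mem_nhds (mem_extChartAt_source m₀)]
      with m ⟨hs, hinj, hsurj, hJ⟩ hm
    have hm' : m ∈ (chartAt H m₀).source := by rwa [extChartAt_source] at hm
    have hder : HasMFDerivAt I 𝓘(ℝ, Fin (Module.finrank ℂ W) → ℂ)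
        (fun m => eR (G (extChartAt I m₀ m))) m
        ((eR.comp (fderiv ℝ G (extChartAt I m₀ m))).comp
          (mfderiv I 𝓘(ℝ, E) (extChartAt I m₀) m)) := by
      refine hasMFDerivAt_of_chart m₀ hm (G := fun y => eR (G y)) ?_ ?_
      · exact eR.hasFDerivAt.comp _ (hs.differentiableAt (by simp)).hasFDerivAt
      · filter_upwards [(isOpen_extChartAt_target (I := I) m₀).mem_nhds
          ((extChartAt I m₀).map_source hm)] with y hy
        rw [(extChartAt I m₀).right_inv hy]
    refine ⟨?_, ?_, ?_⟩
    · have h1 : ContDiffAt ℝ ∞ (fun y => eR (G y)) (extChartAt I m₀ m) :=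
        eR.contDiff.contDiffAt.comp _ hs
      exact h1.contMDiffAt.comp m (contMDiffAt_extChartAt' hm')
    · rw [hder.mfderiv]
      have hbij : Function.Bijective (mfderiv I 𝓘(ℝ, E) (extChartAt I m₀) m) := by
        refine ⟨fun a b hab => ?_, fun y => ⟨mfderiv 𝓘(ℝ, E) I (extChartAt I m₀).symm
          (extChartAt I m₀ m) y, ?_⟩⟩
        · rw [← mfderiv_symm_comp_extChartAt m₀ hm a, hab, mfderiv_symm_comp_extChartAt m₀ hm b]
        · have h2 := mfderiv_extChartAt_comp_symm m₀ ((extChartAt I m₀).map_source hm) y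
          rw [(extChartAt I m₀).left_inv hm] at h2
          exact h2
      exact (e.bijective.comp ⟨hinj, hsurj⟩).comp hbij
    · intro v i
      rw [hder.mfderiv]
      change e (fderiv ℝ G (extChartAt I m₀ m)
        (mfderiv I 𝓘(ℝ, E) (extChartAt I m₀) m (J m v))) i = _
      rw [hJ, map_smul]
      rfl

end Charts

section Metric

variable {E : Type u} [NormedAddCommGroup E] [NormedSpace ℝ E] [FiniteDimensional ℝ E]

/-- The unit balls of an inner product are bounded, by compactness of the unit sphere. -/
theorem isVonNBounded_of_pos {g : E →L[ℝ] E →L[ℝ] ℝ} (hpos : ∀ v, v ≠ 0 → 0 < g v v) :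
    Bornology.IsVonNBounded ℝ {v : E | g v v < 1} := by
  have : ProperSpace E := FiniteDimensional.proper ℝ E
  rw [NormedSpace.isVonNBounded_iff]
  rcases (Metric.sphere (0 : E) 1).eq_empty_or_nonempty with hS | hS
  · have hsub : ∀ v : E, v = 0 := fun v => by
      by_contra hv
      have : ‖v‖⁻¹ • v ∈ Metric.sphere (0 : E) 1 := by
        simp [norm_smul, inv_mul_cancel₀ (norm_ne_zero_iff.2 hv)]
      rw [hS] at this
      exact this
    exact (Bornology.isBounded_singleton (x := (0 : E))).subset fun v _ => hsub v
  · have hc : Continuous fun v : E => g v v := by fun_prop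
    obtain ⟨u, hu, hmin⟩ := (isCompact_sphere (0 : E) 1).exists_isMinOn hS hc.continuousOn
    have hu0 : u ≠ 0 := by
      rintro rfl
      simp at hu
    have hcpos := hpos u hu0
    refine (Metric.isBounded_closedBall (x := (0 : E)) (r := (g u u)⁻¹ + 1)).subset fun v hv => ?_
    rw [mem_closedBall_zero_iff]
    rcases eq_or_ne v 0 with rfl | hv0
    · simp; positivity
    have hn : 0 < ‖v‖ := norm_pos_iff.2 hv0
    have h1 : g u u ≤ g (‖v‖⁻¹ • v) (‖v‖⁻¹ • v) := hmin (by
      simp [norm_smul, inv_mul_cancel₀ hn.ne'])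
    simp only [map_smul, smul_apply, smul_eq_mul] at h1
    have h2 : g u u * ‖v‖ ^ 2 ≤ g v v := by
      calc g u u * ‖v‖ ^ 2 ≤ (‖v‖⁻¹ * (‖v‖⁻¹ * g v v)) * ‖v‖ ^ 2 := by gcongr
        _ = g v v := by field_simp
    have h3 : g u u * ‖v‖ ^ 2 < 1 := lt_of_le_of_lt h2 hv
    have h4 : ‖v‖ ^ 2 < (g u u)⁻¹ := by
      rw [lt_inv_comm₀ (by positivity) hcpos, lt_inv_comm₀ hcpos (by positivity)]
      rw [← one_div, lt_div_iff₀ hcpos]; linarith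
    nlinarith [sq_nonneg (‖v‖ - 1)]

end Metric

section MetricSmooth

variable {E : Type u} [NormedAddCommGroup E] [NormedSpace ℝ E] [FiniteDimensional ℝ E]
  {H : Type v} [TopologicalSpace H]
  {I : ModelWithCorners ℝ E H} [I.Boundaryless] {M : Type w} [TopologicalSpace M]
  [ChartedSpace H M] [IsManifold I ∞ M]

/-- The metric is recovered from the three forms as `G = ω₁ ω₂⁻¹ ω₃`, so it is smooth if they
are. -/
theorem contDiffAt_metric {b : Fin 3 → E → E →L[ℝ] E →L[ℝ] ℝ} {G : E → E →L[ℝ] E →L[ℝ] ℝ}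
    {J : E → Fin 3 → E →L[ℝ] E} {y : E} (hb : ∀ i, ContDiffAt ℝ ∞ (b i) y)
    (h : ∀ᶠ y' in 𝓝 y, IsHyperkahlerPoint (fun i v w => b i y' v w) (G y') (J y')) :
    ContDiffAt ℝ ∞ G y := by
  have hinj : ∀ y', IsHyperkahlerPoint (fun i v w => b i y' v w) (G y') (J y') →
      ∀ i, Function.Injective (b i y') := fun y' hy' i =>
    (injective_iff_map_eq_zero (b i y')).2 fun v hv =>
      hy'.form_nondegenerate i fun w => by rw [hv]; rfl
  have hrank : Module.finrank ℝ E = Module.finrank ℝ (E →L[ℝ] ℝ) := by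
    rw [← Subspace.dual_finrank_eq (K := ℝ) (V := E)]
    exact (LinearMap.toContinuousLinearMap (𝕜 := ℝ) (E := E) (F' := ℝ)).finrank_eq
  have hequiv : ∀ y', IsHyperkahlerPoint (fun i v w => b i y' v w) (G y') (J y') →
      ∃ e : E ≃L[ℝ] (E →L[ℝ] ℝ), (e : E →L[ℝ] (E →L[ℝ] ℝ)) = b 1 y' := fun y' hy' =>
    ⟨(LinearMap.linearEquivOfInjective (b 1 y' : E →ₗ[ℝ] (E →L[ℝ] ℝ)) (hinj y' hy' 1)
      hrank).toContinuousLinearEquiv, by ext; rfl⟩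
  have hG : ∀ᶠ y' in 𝓝 y, G y' = (b 0 y').comp ((b 1 y').inverse.comp (b 2 y')) := by
    filter_upwards [h] with y' hy'
    obtain ⟨e, he⟩ := hequiv y' hy'
    rw [← he, ContinuousLinearMap.inverse_equiv]
    ext v w
    have h1 : e.symm (b 2 y' v) = -J y' 0 v := by
      rw [ContinuousLinearEquiv.symm_apply_eq]
      have h2 : e (-J y' 0 v) = b 1 y' (-J y' 0 v) := by rw [← he]; rfl
      rw [h2]
      ext u
      have h3 := (hy'.form_apply_J v u).1
      rw [map_neg, neg_apply, h3, neg_neg]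
    change G y' v w = b 0 y' (e.symm (b 2 y' v)) w
    have h4 := hy'.form 0 (-J y' 0 v) w
    rw [h1, h4, map_neg, hy'.sq, neg_neg]
  refine ContDiffAt.congr_of_eventuallyEq ?_ hG
  obtain ⟨e, he⟩ := hequiv y h.self_of_nhds
  have : CompleteSpace E := FiniteDimensional.complete ℝ E
  have hinv : ContDiffAt ℝ ∞ (fun y' => (b 1 y').inverse) y := by
    refine ContDiffAt.comp y (g := ContinuousLinearMap.inverse) ?_ (hb 1)
    rw [← he]
    exact contDiffAt_map_inverse e
  exact (hb 0).clm_comp (hinv.clm_comp (hb 2))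

omit [NormedAddCommGroup E] [NormedSpace ℝ E] [FiniteDimensional ℝ E] in
theorem update_pair_zero (a b x : E) : Function.update ![a, b] 0 x = ![x, b] := by
  ext i; fin_cases i <;> rfl

omit [NormedAddCommGroup E] [NormedSpace ℝ E] [FiniteDimensional ℝ E] in
theorem update_pair_one (a b x : E) : Function.update ![a, b] 1 x = ![a, x] := by
  ext i; fin_cases i <;> rfl

/-- A 2-form at a point as a bilinear map. -/
def bilinOfAlt (Ω : E [⋀^Fin 2]→L[ℝ] ℝ) : E →L[ℝ] E →L[ℝ] ℝ :=
  LinearMap.toContinuousBilinearMap <| LinearMap.mk₂ ℝ (fun v w => Ω ![v, w])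
    (fun a b w => by simpa only [update_pair_zero] using Ω.map_update_add ![a, w] 0 a b)
    (fun c a w => by simpa only [update_pair_zero] using Ω.map_update_smul ![a, w] 0 c a)
    (fun a b w => by simpa only [update_pair_one] using Ω.map_update_add ![a, w] 1 b w)
    (fun c a w => by simpa only [update_pair_one] using Ω.map_update_smul ![a, w] 1 c w)

/-- The smoothness of a metric, from that of the three 2-forms. -/
theorem contMDiff_metric {form : Fin 3 → ∀ m : M, TangentSpace I m [⋀^Fin 2]→L[ℝ] ℝ}
    {g : ∀ m : M, TangentSpace I m →L[ℝ] TangentSpace I m →L[ℝ] ℝ}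
    {J : ∀ m : M, Fin 3 → TangentSpace I m →L[ℝ] TangentSpace I m}
    (hclosed : ∀ i, IsClosedForm I (form i))
    (h : ∀ m, IsHyperkahlerPoint (fun i v w => form i m ![v, w]) (g m) (J m)) :
    ContMDiff I (I.prod 𝓘(ℝ, E →L[ℝ] E →L[ℝ] ℝ)) ∞
      (fun m => Bundle.TotalSpace.mk' (E →L[ℝ] E →L[ℝ] ℝ)
        (E := fun m : M => TangentSpace I m →L[ℝ] TangentSpace I m →L[ℝ] ℝ) m (g m)) := by
  have := isManifold_one_of_infty (I := I) (M := M)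
  intro m₀
  rw [Bundle.contMDiffAt_section]
  -- the metric in the chart at `m₀`
  let T : ∀ y : E, E →L[ℝ] TangentSpace I ((extChartAt I m₀).symm y) := fun y =>
    mfderiv 𝓘(ℝ, E) I (extChartAt I m₀).symm y
  let G : E → E →L[ℝ] E →L[ℝ] ℝ := fun y =>
    (ContinuousLinearMap.precomp ℝ (T y)).comp ((g ((extChartAt I m₀).symm y)).comp (T y))
  have hcoord : ∀ᶠ m in 𝓝 m₀, (trivializationAt (E →L[ℝ] E →L[ℝ] ℝ)
      (fun m : M => TangentSpace I m →L[ℝ] TangentSpace I m →L[ℝ] ℝ) m₀ ⟨m, g m⟩).2 =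
      G (extChartAt I m₀ m) := by
    filter_upwards [(isOpen_extChartAt_source (I := I) m₀).mem_nhds (mem_extChartAt_source m₀)]
      with m hm
    ext v w
    have hm' : m ∈ (chartAt H m₀).source := by rwa [extChartAt_source] at hm
    have hs := TangentBundle.symmL_trivializationAt (I := I) hm'
    rw [I.range_eq_univ, mfderivWithin_univ] at hs
    have hG : G (extChartAt I m₀ m) v w =
        g m (mfderiv 𝓘(ℝ, E) I (extChartAt I m₀).symm (extChartAt I m₀ m) v)
        (mfderiv 𝓘(ℝ, E) I (extChartAt I m₀).symm (extChartAt I m₀ m) w) := by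
      have e := (extChartAt I m₀).left_inv hm
      change g ((extChartAt I m₀).symm (extChartAt I m₀ m))
        (mfderiv 𝓘(ℝ, E) I (extChartAt I m₀).symm (extChartAt I m₀ m) v)
        (mfderiv 𝓘(ℝ, E) I (extChartAt I m₀).symm (extChartAt I m₀ m) w) = _
      exact congrArg (fun m' => (show E →L[ℝ] E →L[ℝ] ℝ from g m')
        (mfderiv 𝓘(ℝ, E) I (extChartAt I m₀).symm (extChartAt I m₀ m) v)
        (mfderiv 𝓘(ℝ, E) I (extChartAt I m₀).symm (extChartAt I m₀ m) w)) e
    have hb : m ∈ (trivializationAt E (TangentSpace I) m₀).baseSet := hm'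
    have hs' : ∀ v : E, (trivializationAt E (TangentSpace I) m₀).symm m v =
        mfderiv 𝓘(ℝ, E) I (extChartAt I m₀).symm (extChartAt I m₀ m) v := fun v => by
      rw [← Bundle.Trivialization.symmL_apply (R := ℝ) _ hb]
      exact congrArg (fun f => f v) hs
    refine Eq.trans ?_ ((congrArg₂ (fun a b => g m a b) (hs' v) (hs' w)).trans hG.symm)
    rw [hom_trivializationAt_apply,
      inCoordinates_apply_eq₂ (F₁ := E) (F₂ := E) (F₃ := ℝ) (E₁ := fun m : M => TangentSpace I m)
        (E₂ := fun m : M => TangentSpace I m) (E₃ := fun _ : M => ℝ) hm' hm' (Set.mem_univ _)]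
    simp
  refine ContMDiffAt.congr_of_eventuallyEq ?_ hcoord
  suffices hGs : ContDiffAt ℝ ∞ G (extChartAt I m₀ m₀) from
    hGs.contMDiffAt.comp m₀ (contMDiffAt_extChartAt (I := I))
  have hopen : IsOpen (extChartAt I m₀).target := isOpen_extChartAt_target m₀
  have hT : ∀ y ∈ (extChartAt I m₀).target, ∃ e : E ≃L[ℝ] TangentSpace I ((extChartAt I m₀).symm y),
      ∀ v, e v = T y v := by
    intro y hy
    let S : TangentSpace I ((extChartAt I m₀).symm y) →L[ℝ] E :=
      mfderiv I 𝓘(ℝ, E) (extChartAt I m₀) ((extChartAt I m₀).symm y)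
    refine ⟨ContinuousLinearEquiv.equivOfInverse (T y) S
      (fun v => mfderiv_extChartAt_comp_symm m₀ hy v) (fun v => ?_), fun v => rfl⟩
    have h2 := mfderiv_symm_comp_extChartAt m₀ ((extChartAt I m₀).map_target hy) v
    rw [(extChartAt I m₀).right_inv hy] at h2
    exact h2
  classical
  refine contDiffAt_metric (G := G) (b := fun i y => bilinOfAlt (chartForm I (form i) m₀ y))
    (J := fun y i => if hy : y ∈ (extChartAt I m₀).target then
      ((hT y hy).choose.symm : _ →L[ℝ] E).comp
        ((J ((extChartAt I m₀).symm y) i).comp ((hT y hy).choose : E →L[ℝ] _)) else 0)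
    (fun i => ?_) ?_
  · refine ContDiffOn.contDiffAt ?_ (extChartAt_target_mem_nhds (I := I) m₀)
    rw [contDiffOn_clm_apply]
    intro v
    rw [contDiffOn_clm_apply]
    intro w
    have := (hclosed i m₀).1
    exact (ContinuousAlternatingMap.apply ℝ E ℝ ![v, w]).contDiff.comp_contDiffOn this
  · filter_upwards [extChartAt_target_mem_nhds (I := I) m₀] with y hy
    have h1 := (h ((extChartAt I m₀).symm y)).comap (hT y hy).choose
    have he := (hT y hy).choose_spec
    have e1 : (((hT y hy).choose : E ≃L[ℝ] _) : E →L[ℝ] _) = T y := by ext v; exact he v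
    rw [e1] at h1
    convert h1 using 1
    · ext i v w
      rw [he, he]
      refine congrArg (form i ((extChartAt I m₀).symm y)) ?_
      ext j; fin_cases j <;> rfl
    · ext i v
      rw [dif_pos hy, e1]

end MetricSmooth

/-! ### Flat sections of local systems -/

namespace LocalSystem

variable {X : Type u} [TopologicalSpace X] (L : LocalSystem.{u, v} X)

/-- `s` is flat near `x`. -/
def IsFlatAt (s : ∀ x, L.fiber x) (x : X) : Prop :=
  ∀ᶠ y in 𝓝 x, ContinuousAt (fun x => (⟨x, s x⟩ : Σ x, L.fiber x)) y

variable {L} {s t : ∀ x, L.fiber x} {x : X} {U : Set X}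

theorem IsFlatOn.isFlatAt (h : L.IsFlatOn s U) (hU : IsOpen U) (hx : x ∈ U) : L.IsFlatAt s x := by
  filter_upwards [hU.mem_nhds hx] with y hy using h.continuousAt (hU.mem_nhds hy)

theorem IsFlatAt.exists_isFlatOn (h : L.IsFlatAt s x) :
    ∃ U : Set X, IsOpen U ∧ x ∈ U ∧ L.IsFlatOn s U := by
  obtain ⟨U, h, hU, hx⟩ := eventually_nhds_iff.1 h
  exact ⟨U, hU, hx, fun y hy => (h y hy).continuousWithinAt⟩

theorem IsFlatAt.congr (h : L.IsFlatAt s x) (hst : ∀ᶠ y in 𝓝 x, s y = t y) :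
    L.IsFlatAt t x := by
  filter_upwards [h, eventually_eventually_nhds.2 hst] with y hy hy'
  exact hy.congr (hy'.mono fun z hz => by simp only [hz])

/-- Flat sections near `x` are the transports of their values at `x`. -/
theorem exists_transport (L : LocalSystem.{u, v} X) (x : X) :
    ∃ e : ∀ y, L.fiber x →+ L.fiber y, (∀ γ, e x γ = γ) ∧
      (∀ᶠ y in 𝓝 x, Function.Bijective (e y)) ∧ (∀ γ, L.IsFlatAt (fun y => e y γ) x) ∧
      ∀ s, L.IsFlatAt s x → ∀ᶠ y in 𝓝 x, s y = e y (s x) := by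
  obtain ⟨U, hU, hx, e, he, hbij, h⟩ := L.locally_trivial x
  refine ⟨e, he, ?_, fun γ => ?_, fun s hs => ?_⟩
  · filter_upwards [hU.mem_nhds hx] with y hy using hbij y hy
  · exact IsFlatOn.isFlatAt (continuousOn_iff_continuous_domRestrict.2 (h γ).continuous) hU hx
  · have hmem : Set.range (fun y : U => (⟨y, e y (s x)⟩ : Σ x, L.fiber x)) ∈
        𝓝 (⟨x, s x⟩ : Σ x, L.fiber x) :=
      (h (s x)).isOpen_range.mem_nhds ⟨⟨x, hx⟩, by simp only [he]⟩
    filter_upwards [hs.self_of_nhds.eventually hmem] with y hy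
    obtain ⟨⟨z, hz⟩, hzy⟩ := hy
    simp only [Sigma.mk.injEq] at hzy
    obtain ⟨rfl, h⟩ := hzy
    exact (eq_of_heq h).symm

/-- The germ of a flat section is determined by its value. -/
theorem IsFlatAt.eventually_eq (hs : L.IsFlatAt s x) (ht : L.IsFlatAt t x) (h : s x = t x) :
    ∀ᶠ y in 𝓝 x, s y = t y := by
  obtain ⟨e, -, -, -, he⟩ := L.exists_transport x
  filter_upwards [he s hs, he t ht] with y h1 h2
  rw [h1, h2, h]

theorem IsFlatAt.add (hs : L.IsFlatAt s x) (ht : L.IsFlatAt t x) :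
    L.IsFlatAt (fun y => s y + t y) x := by
  obtain ⟨e, -, -, he, he'⟩ := L.exists_transport x
  refine (he (s x + t x)).congr ?_
  filter_upwards [he' s hs, he' t ht] with y h1 h2
  rw [h1, h2, map_add]

theorem IsFlatAt.zsmul (hs : L.IsFlatAt s x) (n : ℤ) : L.IsFlatAt (fun y => n • s y) x := by
  obtain ⟨e, -, -, he, he'⟩ := L.exists_transport x
  refine (he (n • s x)).congr ?_
  filter_upwards [he' s hs] with y h1
  rw [h1, map_zsmul]

theorem isFlatAt_zero (L : LocalSystem.{u, v} X) (x : X) : L.IsFlatAt (fun _ => 0) x := by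
  obtain ⟨e, -, -, he, -⟩ := L.exists_transport x
  exact (he 0).congr (Filter.Eventually.of_forall fun y => map_zero _)

theorem isFlatAt_sum {ι : Type*} (S : Finset ι) {s : ι → ∀ x, L.fiber x}
    (hs : ∀ i, L.IsFlatAt (s i) x) : L.IsFlatAt (fun y => ∑ i ∈ S, s i y) x := by
  classical
  induction S using Finset.induction_on with
  | empty => simpa using L.isFlatAt_zero x
  | insert a S ha ih => simpa only [Finset.sum_insert ha] using (hs a).add ih

theorem flatExt_self (L : LocalSystem.{u, v} X) (x : X) (γ : L.fiber x) : L.flatExt x γ x = γ :=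
  (L.exists_flat x γ).choose_spec.1

theorem isFlatAt_flatExt (L : LocalSystem.{u, v} X) (x : X) (γ : L.fiber x) :
    L.IsFlatAt (L.flatExt x γ) x := by
  obtain ⟨U, hU, hx, h⟩ := (L.exists_flat x γ).choose_spec.2
  exact h.isFlatAt hU hx

end LocalSystem

/-! ### Frames -/

namespace SemiflatData

variable {r : ℕ} {X : Type u} [TopologicalSpace X] [ChartedSpace (Fin r → ℂ) X]
  (D : SemiflatData.{u, v} r X)

theorem isFlatAt_incl (f : D.flavor) (x : X) : D.charge.IsFlatAt (fun y => D.incl y f) x :=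
  (D.incl_flat f).isFlatAt isOpen_univ (Set.mem_univ x)

variable {D}

theorem isFlatAt_proj {s : ∀ x, D.charge.fiber x} {x : X} (hs : D.charge.IsFlatAt s x) :
    D.gauge.IsFlatAt (fun y => D.proj y (s y)) x := by
  filter_upwards [hs] with y hy
  exact (D.proj_flat.continuousAt (x := ⟨y, s y⟩)).comp
    (f := fun y => (⟨y, s y⟩ : Σ x, D.charge.fiber x)) hy

theorem eventually_pairing_eq {s t : ∀ x, D.charge.fiber x} {x : X} (hs : D.charge.IsFlatAt s x)
    (ht : D.charge.IsFlatAt t x) :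
    ∀ᶠ y in 𝓝 x, D.pairing y (s y) (t y) = D.pairing x (s x) (t x) := by
  obtain ⟨U, hU, hxU, hsU⟩ := hs.exists_isFlatOn
  obtain ⟨V, hV, hxV, htV⟩ := ht.exists_isFlatOn
  have hc := D.pairing_flat (U ∩ V) s t (hU.inter hV) (hsU.mono Set.inter_subset_left)
    (htV.mono Set.inter_subset_right)
  have hc' := hc.continuousAt ((hU.inter hV).mem_nhds ⟨hxU, hxV⟩)
  exact hc'.eventually (p := fun n => n = D.pairing x (s x) (t x))
    ((isOpen_discrete {D.pairing x (s x) (t x)}).mem_nhds rfl)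

theorem eventually_mdifferentiableAt_Z {s : ∀ x, D.charge.fiber x} {x : X}
    (hs : D.charge.IsFlatAt s x) : ∀ᶠ y in 𝓝 x,
      MDifferentiableAt 𝓘(ℂ, Fin r → ℂ) 𝓘(ℂ) (fun x => D.Z x (s x)) y := by
  obtain ⟨U, hU, hxU, hsU⟩ := hs.exists_isFlatOn
  filter_upwards [hU.mem_nhds hxU] with y hy
  exact (D.Z_holomorphic U s hU hsU).mdifferentiableAt (hU.mem_nhds hy)

variable (D) in
/-- Bases of the lattices `Γ_x` extend to frames: lift them to `Γ̂_x` and transport. -/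
theorem exists_isFrame (x : X) : ∃ U s, x ∈ U ∧ D.IsFrame U s := by
  have := D.gauge_free x
  have := D.gauge_finite x
  let β := Module.finBasisOfFinrankEq ℤ (D.gauge.fiber x) (D.gauge_rank x)
  choose c hc using fun i => D.proj_surjective x (β i)
  obtain ⟨e, he, -, heflat, -⟩ := D.charge.exists_transport x
  obtain ⟨e', -, hbij, -, he'⟩ := D.gauge.exists_transport x
  have hev : ∀ᶠ y in 𝓝 x, Function.Bijective (e' y) ∧ ∀ i,
      ContinuousAt (fun y => (⟨y, e y (c i)⟩ : Σ x, D.charge.fiber x)) y ∧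
      D.proj y (e y (c i)) = e' y (β i) := by
    refine hbij.and (Filter.eventually_all.2 fun i => (heflat (c i)).and ?_)
    filter_upwards [he' _ (isFlatAt_proj (heflat (c i)))] with y hy
    rw [hy, he, hc]
  obtain ⟨U, hUev, hU, hxU⟩ := eventually_nhds_iff.1 hev
  refine ⟨U, fun i y => e y (c i), hxU, hU, fun i y hy => ?_, fun y hy => ?_, fun y hy => ?_⟩
  · exact ((hUev y hy).2 i).1.continuousWithinAt
  · have h1 : (fun i => D.proj y (e y (c i))) = (e' y).toIntLinearMap ∘ β :=
      funext fun i => ((hUev y hy).2 i).2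
    rw [h1]
    exact β.linearIndependent.map' _ (LinearMap.ker_eq_bot.2 (hUev y hy).1.1)
  · have h1 : (fun i => D.proj y (e y (c i))) = (e' y).toIntLinearMap ∘ β :=
      funext fun i => ((hUev y hy).2 i).2
    rw [h1, Set.range_comp, ← Submodule.map_span, β.span_eq, Submodule.map_top]
    exact LinearMap.range_eq_top.2 (hUev y hy).1.2

variable (D) in
/-- The map `(n, f) ↦ ∑ n_i s_i + f` from `ℤ^{2r} × Γ_f` to `Γ̂_x`. -/
def frameHom (s : Fin (2 * r) → ∀ x, D.charge.fiber x) (x : X) :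
    (Fin (2 * r) → ℤ) × D.flavor →+ D.charge.fiber x where
  toFun p := ∑ i, p.1 i • s i x + D.incl x p.2
  map_zero' := by simp
  map_add' p q := by
    simp only [Prod.fst_add, Prod.snd_add, Pi.add_apply, add_smul, Finset.sum_add_distrib, map_add]
    abel

theorem frameHom_apply (s : Fin (2 * r) → ∀ x, D.charge.fiber x) (x : X)
    (p : (Fin (2 * r) → ℤ) × D.flavor) :
    D.frameHom s x p = ∑ i, p.1 i • s i x + D.incl x p.2 := rfl

theorem proj_frameHom (s : Fin (2 * r) → ∀ x, D.charge.fiber x) (x : X)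
    (p : (Fin (2 * r) → ℤ) × D.flavor) :
    D.proj x (D.frameHom s x p) = ∑ i, p.1 i • D.proj x (s i x) := by
  rw [frameHom_apply, map_add, map_sum, (D.exact x _).2 ⟨_, rfl⟩, add_zero]
  simp only [map_zsmul]

theorem frameHom_single (s : Fin (2 * r) → ∀ x, D.charge.fiber x) (x : X) (i : Fin (2 * r)) :
    D.frameHom s x (Pi.single i 1, 0) = s i x := by
  simp [frameHom_apply, Pi.single_apply]

theorem frameHom_flavor (s : Fin (2 * r) → ∀ x, D.charge.fiber x) (x : X) (f : D.flavor) :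
    D.frameHom s x (0, f) = D.incl x f := by
  simp [frameHom_apply]

namespace IsFrame

variable {U : Set X} {s : Fin (2 * r) → ∀ x, D.charge.fiber x}

theorem isFlatAt (h : D.IsFrame U s) {x : X} (hx : x ∈ U) (i : Fin (2 * r)) :
    D.charge.IsFlatAt (s i) x :=
  (h.flat i).isFlatAt h.isOpen hx

theorem frameHom_injective (h : D.IsFrame U s) {x : X} (hx : x ∈ U) :
    Function.Injective (D.frameHom s x) := by
  rw [injective_iff_map_eq_zero]
  intro p hp
  have h1 := proj_frameHom s x p
  rw [hp, map_zero] at h1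
  have h2 : p.1 = 0 :=
    funext (Fintype.linearIndependent_iff.1 (h.linearIndependent x hx) p.1 h1.symm)
  rw [frameHom_apply, h2] at hp
  simp only [Pi.zero_apply, zero_smul, Finset.sum_const_zero, zero_add] at hp
  exact Prod.ext h2 ((injective_iff_map_eq_zero _).1 (D.incl_injective x) _ hp)

theorem frameHom_surjective (h : D.IsFrame U s) {x : X} (hx : x ∈ U) :
    Function.Surjective (D.frameHom s x) := by
  intro γ
  have h1 : D.proj x γ ∈ Submodule.span ℤ (Set.range fun i => D.proj x (s i x)) := by
    rw [h.span x hx]; trivial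
  obtain ⟨n, hn⟩ := (Submodule.mem_span_range_iff_exists_fun ℤ).1 h1
  obtain ⟨f, hf⟩ := (D.exact x (γ - ∑ i, n i • s i x)).1 (by
    rw [map_sub, map_sum, ← hn]
    simp only [map_zsmul, sub_self])
  exact ⟨(n, f), by rw [frameHom_apply, hf]; abel⟩

/-- A frame identifies the lattice `Γ̂_x` with `ℤ^{2r} × Γ_f`. -/
def equiv (h : D.IsFrame U s) {x : X} (hx : x ∈ U) :
    (Fin (2 * r) → ℤ) × D.flavor ≃+ D.charge.fiber x :=
  AddEquiv.ofBijective (D.frameHom s x) ⟨h.frameHom_injective hx, h.frameHom_surjective hx⟩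

theorem isGaugeBasis (h : D.IsFrame U s) {x : X} (hx : x ∈ U) :
    IsGaugeBasis (D.pairing x) (fun i => s i x) where
  span γ := by
    obtain ⟨p, rfl⟩ := h.frameHom_surjective hx γ
    exact ⟨p.1, _, (D.radical x _).1 ⟨p.2, rfl⟩, rfl⟩
  indep n hn := by
    obtain ⟨f, hf⟩ := (D.radical x _).2 hn
    have : D.frameHom s x (n, -f) = 0 := by
      rw [frameHom_apply, ← hf, map_neg]; exact add_neg_cancel _
    exact congrArg Prod.fst ((injective_iff_map_eq_zero _).1 (h.frameHom_injective hx) _ this)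

theorem isFlatAt_frameHom (h : D.IsFrame U s) {x : X} (hx : x ∈ U)
    (p : (Fin (2 * r) → ℤ) × D.flavor) : D.charge.IsFlatAt (fun y => D.frameHom s y p) x :=
  (LocalSystem.isFlatAt_sum _ fun i => (h.isFlatAt hx i).zsmul (p.1 i)).add (D.isFlatAt_incl p.2 x)

/-- The coordinates of a flat section in a frame are locally constant. -/
theorem exists_eventually_eq (h : D.IsFrame U s) {x : X} (hx : x ∈ U) {t : ∀ x, D.charge.fiber x}
    (ht : D.charge.IsFlatAt t x) : ∃ p, ∀ᶠ y in 𝓝 x, t y = D.frameHom s y p := by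
  obtain ⟨p, hp⟩ := h.frameHom_surjective hx (t x)
  exact ⟨p, ht.eventually_eq (h.isFlatAt_frameHom hx p) hp.symm⟩

end IsFrame

/-! ### Twisted characters -/

theorem coe_pi_mul (n : ℤ) : ((Real.pi * (n : ℝ) : ℝ) : Real.Angle) = n • (Real.pi : Real.Angle) := by
  rw [mul_comm, Real.Angle.intCast_mul_eq_zsmul]

variable (D) in
/-- The upper triangular part of the Gram matrix of a frame, as a bilinear form. On the
diagonal it is a quadratic refinement of the pairing modulo `2`. -/
def upperForm (s : Fin (2 * r) → ∀ x, D.charge.fiber x) (x : X) (n n' : Fin (2 * r) → ℤ) : ℤ :=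
  ∑ i, ∑ j, n i * n' j * (if i < j then D.pairing x (s i x) (s j x) else 0)

theorem upperForm_add_left (s : Fin (2 * r) → ∀ x, D.charge.fiber x) (x : X)
    (n m n' : Fin (2 * r) → ℤ) :
    D.upperForm s x (n + m) n' = D.upperForm s x n n' + D.upperForm s x m n' := by
  simp only [upperForm, Pi.add_apply, add_mul, Finset.sum_add_distrib]

theorem upperForm_add_right (s : Fin (2 * r) → ∀ x, D.charge.fiber x) (x : X)
    (n m n' : Fin (2 * r) → ℤ) :
    D.upperForm s x n' (n + m) = D.upperForm s x n' n + D.upperForm s x n' m := by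
  simp only [upperForm, Pi.add_apply, add_mul, mul_add, Finset.sum_add_distrib]

theorem pairing_self (x : X) (γ : D.charge.fiber x) : D.pairing x γ γ = 0 := by
  have := D.pairing_antisymm x γ γ
  lia

theorem pairing_frameHom (s : Fin (2 * r) → ∀ x, D.charge.fiber x) (x : X)
    (p q : (Fin (2 * r) → ℤ) × D.flavor) :
    D.pairing x (D.frameHom s x p) (D.frameHom s x q) =
      D.upperForm s x p.1 q.1 - D.upperForm s x q.1 p.1 := by
  have h1 : ∀ f γ, D.pairing x (D.incl x f) γ = 0 := fun f => (D.radical x _).1 ⟨f, rfl⟩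
  have h2 : ∀ f γ, D.pairing x γ (D.incl x f) = 0 := fun f γ => by
    rw [D.pairing_antisymm, h1, neg_zero]
  rw [frameHom_apply, frameHom_apply]
  simp only [map_add, LinearMap.add_apply, h1, h2, add_zero, map_sum, LinearMap.sum_apply, map_zsmul,
    LinearMap.smul_apply, smul_zero, Finset.sum_const_zero, Finset.smul_sum]
  rw [Finset.sum_comm, upperForm, upperForm,
    Finset.sum_comm (f := fun i j => q.1 i * p.1 j * _), ← Finset.sum_sub_distrib]
  refine Finset.sum_congr rfl fun i _ => ?_
  rw [← Finset.sum_sub_distrib]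
  refine Finset.sum_congr rfl fun j _ => ?_
  rcases lt_trichotomy i j with h | h | h
  · simp [h, h.not_gt]; ring
  · subst h; simp [pairing_self]
  · rw [if_neg h.not_gt, if_pos h, D.pairing_antisymm x (s i x)]; simp; ring

variable (D) in
/-- The values of a twisted character in the coordinates of a frame on which it takes the
values `t`. -/
def frameAngle (s : Fin (2 * r) → ∀ x, D.charge.fiber x) (x : X) (t : Fin (2 * r) → Real.Angle)
    (p : (Fin (2 * r) → ℤ) × D.flavor) : Real.Angle :=
  ∑ i, p.1 i • t i + D.thetaf p.2 + D.upperForm s x p.1 p.1 • (Real.pi : Real.Angle)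

theorem frameAngle_add (s : Fin (2 * r) → ∀ x, D.charge.fiber x) (x : X)
    (t : Fin (2 * r) → Real.Angle) (p q : (Fin (2 * r) → ℤ) × D.flavor) :
    D.frameAngle s x t (p + q) = D.frameAngle s x t p + D.frameAngle s x t q +
      ((Real.pi * (D.pairing x (D.frameHom s x p) (D.frameHom s x q) : ℝ) : ℝ) : Real.Angle) := by
  have h2 : (2 : ℤ) • (Real.pi : Real.Angle) = 0 := Real.Angle.two_zsmul_coe_pi
  rw [coe_pi_mul, pairing_frameHom]
  simp only [frameAngle, Prod.fst_add, Prod.snd_add, upperForm_add_left, upperForm_add_right,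
    Pi.add_apply, add_smul, Finset.sum_add_distrib, map_add, sub_smul]
  have h3 : D.upperForm s x q.1 p.1 • (Real.pi : Real.Angle) =
      - (D.upperForm s x q.1 p.1 • (Real.pi : Real.Angle)) := by
    rw [eq_neg_iff_add_eq_zero, ← smul_add, ← two_zsmul, h2, smul_zero]
  rw [sub_eq_add_neg (_ • _) (_ • _), ← h3]
  abel

namespace Space

theorem ext_of_base {m m' : D.Space} (h : m.base = m'.base)
    (h' : ∀ (γ : ∀ x, D.charge.fiber x), m.angle (γ m.base) = m'.angle (γ m'.base)) : m = m' := by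
  obtain ⟨x, θ, h1, h2⟩ := m
  obtain ⟨x', θ', h1', h2'⟩ := m'
  obtain rfl : x = x' := h
  obtain rfl : θ = θ' := funext fun γ => by
    classical
    simpa using h' (Function.update (fun _ => 0) x γ)
  rfl

end Space

namespace IsFrame

variable {U : Set X} {s : Fin (2 * r) → ∀ x, D.charge.fiber x}

/-- The twisted character over `x` with the given values on a frame. -/
def character (h : D.IsFrame U s) {x : X} (hx : x ∈ U) (t : Fin (2 * r) → Real.Angle) :
    D.Space where
  base := x
  angle γ := D.frameAngle s x t ((h.equiv hx).symm γ)
  twisted γ γ' := by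
    rw [map_add, frameAngle_add]
    congr 6
    · exact (h.equiv hx).apply_symm_apply γ
    · exact (h.equiv hx).apply_symm_apply γ'
  flavor f := by
    have : (h.equiv hx).symm (D.incl x f) = (0, f) := by
      rw [AddEquiv.symm_apply_eq]
      exact (frameHom_flavor s x f).symm
    rw [this]
    simp [frameAngle, upperForm]

theorem character_angle (h : D.IsFrame U s) {x : X} (hx : x ∈ U) (t : Fin (2 * r) → Real.Angle)
    (p : (Fin (2 * r) → ℤ) × D.flavor) :
    (h.character hx t).angle (D.frameHom s x p) = D.frameAngle s x t p := by
  change D.frameAngle s x t ((h.equiv hx).symm (h.equiv hx p)) = _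
  rw [AddEquiv.symm_apply_apply]

theorem character_angle_frame (h : D.IsFrame U s) {x : X} (hx : x ∈ U)
    (t : Fin (2 * r) → Real.Angle) (i : Fin (2 * r)) :
    (h.character hx t).angle (s i x) = t i := by
  have := h.character_angle hx t (Pi.single i 1, 0)
  rw [frameHom_single] at this
  refine this.trans ?_
  have h0 : D.upperForm s x (Pi.single i 1) (Pi.single i 1) = 0 := by
    refine Finset.sum_eq_zero fun j _ => Finset.sum_eq_zero fun k _ => ?_
    by_cases hj : j = i
    · by_cases hk : k = i
      · simp [hj, hk]
      · simp [hk]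
    · simp [hj]
  simp [frameAngle, h0, Pi.single_apply]

/-- A twisted character is determined by its values on a frame. -/
theorem angle_frameHom (h : D.IsFrame U s) (m : D.Space) (hm : m.base ∈ U)
    (p : (Fin (2 * r) → ℤ) × D.flavor) :
    m.angle (D.frameHom s m.base p) = D.frameAngle s m.base (fun i => m.angle (s i m.base)) p := by
  -- the difference of two twisted characters is a homomorphism
  let m' := h.character hm (fun i => m.angle (s i m.base))
  let δ : D.charge.fiber m.base →+ Real.Angle := AddMonoidHom.mk' (fun γ => m.angle γ - m'.angle γ)
    fun γ γ' => by
      have h1 := m.twisted γ γ'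
      have h2 : m'.angle (γ + γ') = m'.angle γ + m'.angle γ' +
        ((Real.pi * (D.pairing m.base γ γ' : ℝ) : ℝ) : Real.Angle) := m'.twisted γ γ'
      change m.angle (γ + γ') - m'.angle (γ + γ') = _
      rw [h1, h2]
      abel
  have hδ : δ (D.frameHom s m.base p) = 0 := by
    have hs : ∀ i, δ (s i m.base) = 0 := fun i =>
      sub_eq_zero.2
      (h.character_angle_frame hm (fun i => m.angle (s i m.base)) i).symm
    have hf : δ (D.incl m.base p.2) = 0 := sub_eq_zero.2 ((m.flavor _).trans (m'.flavor _).symm)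
    rw [frameHom_apply, map_add, hf, map_sum, add_zero]
    exact Finset.sum_eq_zero fun i _ => by rw [map_zsmul, hs, smul_zero]
  have h3 := h.character_angle hm (fun i => m.angle (s i m.base)) p
  exact (sub_eq_zero.1 hδ).trans h3

theorem ext (h : D.IsFrame U s) {m m' : D.Space} (hm : m.base ∈ U) (hb : m.base = m'.base)
    (ha : ∀ i, m.angle (s i m.base) = m'.angle (s i m'.base)) : m = m' := by
  refine Space.ext_of_base hb fun γ => ?_
  obtain ⟨x, θ, h1, h2⟩ := m
  obtain ⟨x', θ', h1', h2'⟩ := m'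
  obtain rfl : x = x' := hb
  obtain ⟨p, hp⟩ := h.frameHom_surjective hm (γ x)
  have e1 := h.angle_frameHom ⟨x, θ, h1, h2⟩ hm p
  have e2 := h.angle_frameHom ⟨x, θ', h1', h2'⟩ hm p
  rw [← hp]
  refine e1.trans (Eq.trans ?_ e2.symm)
  exact congrArg (fun t => D.frameAngle s x t p) (funext ha)

theorem eventually_upperForm (h : D.IsFrame U s) {x : X} (hx : x ∈ U) :
    ∀ᶠ y in 𝓝 x, D.upperForm s y = D.upperForm s x := by
  have : ∀ᶠ y in 𝓝 x, ∀ i j, D.pairing y (s i y) (s j y) = D.pairing x (s i x) (s j x) :=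
    Filter.eventually_all.2 fun i => Filter.eventually_all.2 fun j =>
      eventually_pairing_eq (h.isFlatAt hx i) (h.isFlatAt hx j)
  filter_upwards [this] with y hy
  ext n n'
  simp only [upperForm, hy]

/-- The angle of a flat section is locally an affine integral function of the angles of a frame. -/
theorem exists_eventually_angle_eq (h : D.IsFrame U s) {x : X} (hx : x ∈ U)
    {t : ∀ x, D.charge.fiber x} {p : (Fin (2 * r) → ℤ) × D.flavor}
    (hp : ∀ᶠ y in 𝓝 x, t y = D.frameHom s y p) :
    ∃ c : Real.Angle, ∀ᶠ y in 𝓝 x, ∀ m : D.Space, m.base = y →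
      m.angle (t m.base) = ∑ i, p.1 i • m.angle (s i m.base) + c := by
  refine ⟨D.thetaf p.2 + D.upperForm s x p.1 p.1 • (Real.pi : Real.Angle), ?_⟩
  filter_upwards [hp, h.eventually_upperForm hx, h.isOpen.mem_nhds hx] with y h1 h2 h3
  rintro m rfl
  rw [h1, h.angle_frameHom m h3, frameAngle, h2, add_assoc]

end IsFrame

end SemiflatData

/-! ### The manifold of twisted characters -/

/-- Near a point where an angle is not `π`, its representative in `(-π, π]` depends continuously on
it. -/
theorem exists_eventually_toReal_eq {α : Type*} {l : Filter α} {f : α → ℝ} {x : ℝ}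
    (hf : Filter.Tendsto f l (𝓝 x)) (hx : (x : Real.Angle) ≠ (Real.pi : Real.Angle)) :
    ∃ c : ℝ, ∀ᶠ p in l, (f p : Real.Angle).toReal = f p + c := by
  refine ⟨(x : Real.Angle).toReal - x, ?_⟩
  have h1 : (x : Real.Angle).toReal < Real.pi :=
    lt_of_le_of_ne (Real.Angle.toReal_le_pi _) fun h => hx (Real.Angle.toReal_eq_pi_iff.1 h)
  have h2 : -Real.pi < (x : Real.Angle).toReal := Real.Angle.neg_pi_lt_toReal _
  have hc : Filter.Tendsto (fun p => f p + ((x : Real.Angle).toReal - x)) l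
      (𝓝 ((x : Real.Angle).toReal)) := by
    have := hf.add_const ((x : Real.Angle).toReal - x)
    rwa [add_sub_cancel] at this
  filter_upwards [hc.eventually (isOpen_Ioo.mem_nhds ⟨h2, h1⟩)] with p hp
  have h3 : (f p : Real.Angle) = ((f p + ((x : Real.Angle).toReal - x) : ℝ) : Real.Angle) := by
    rw [Real.Angle.coe_add, Real.Angle.coe_sub, Real.Angle.coe_toReal, sub_self, add_zero]
  rw [h3]
  exact Real.Angle.toReal_coe_eq_self_iff.2 ⟨hp.1, hp.2.le⟩

namespace SemiflatData

variable {r : ℕ} {X : Type u} [TopologicalSpace X] [ChartedSpace (Fin r → ℂ) X]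
  {D : SemiflatData.{u, v} r X}

variable {U U' : Set X} {s s' : Fin (2 * r) → ∀ x, D.charge.fiber x}

namespace IsFrame

/-- The twisted character over `x` whose angles in the frame `s` are `t`, and some twisted character
over `x` when the frame is not defined at `x`. -/
def point (h : D.IsFrame U s) (x : X) (t : Fin (2 * r) → ℝ) : D.Space :=
  open Classical in
  if hx : x ∈ U then h.character hx (fun i => (t i : Real.Angle)) else
    (D.exists_isFrame x).choose_spec.choose_spec.2.character
      (D.exists_isFrame x).choose_spec.choose_spec.1 0

theorem point_base (h : D.IsFrame U s) (x : X) (t : Fin (2 * r) → ℝ) : (h.point x t).base = x := by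
  unfold point
  split <;> rfl

theorem point_angle (h : D.IsFrame U s) {x : X} (hx : x ∈ U) (t : Fin (2 * r) → ℝ)
    (i : Fin (2 * r)) : (h.point x t).angle (s i (h.point x t).base) = (t i : Real.Angle) := by
  unfold point
  rw [dif_pos hx]
  exact h.character_angle_frame hx _ i

theorem point_eq (h : D.IsFrame U s) {m : D.Space} (hm : m.base ∈ U) {t : Fin (2 * r) → ℝ}
    (ht : ∀ i, (t i : Real.Angle) = m.angle (s i m.base)) : h.point m.base t = m := by
  have hb := h.point_base m.base t
  refine h.ext (by rw [hb]; exact hm) hb fun i => ?_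
  rw [h.point_angle hm, ht]

/-- In the coordinates given by a frame, the angle of a flat section is locally an affine integral
function. -/
theorem exists_eventually_angle_point (h : D.IsFrame U s) {x : X} (hx : x ∈ U)
    {t : ∀ x, D.charge.fiber x} {p : (Fin (2 * r) → ℤ) × D.flavor}
    (hp : ∀ᶠ y in 𝓝 x, t y = D.frameHom s y p) :
    ∃ c : ℝ, ∀ᶠ y in 𝓝 x, ∀ τ : Fin (2 * r) → ℝ, (h.point y τ).angle (t (h.point y τ).base) =
      ((∑ i, (p.1 i : ℝ) * τ i + c : ℝ) : Real.Angle) := by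
  obtain ⟨c, hn⟩ := h.exists_eventually_angle_eq hx hp
  refine ⟨c.toReal, ?_⟩
  filter_upwards [hn, h.isOpen.mem_nhds hx] with y hy hyU τ
  rw [hy _ (h.point_base y τ), Real.Angle.coe_add, Real.Angle.coe_toReal]
  congr 1
  have e : ((∑ i, (p.1 i : ℝ) * τ i : ℝ) : Real.Angle) =
      ∑ i, (((p.1 i : ℝ) * τ i : ℝ) : Real.Angle) :=
    map_sum Real.Angle.coeHom _ _
  rw [e]
  refine Finset.sum_congr rfl fun i _ => ?_
  rw [h.point_angle hyU, Real.Angle.intCast_mul_eq_zsmul]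

/-- The coordinates on `M'` given by a frame, a chart of the base, and the intervals of length `2π`
around the numbers `a i` for the angles. -/
def angleChart (h : D.IsFrame U s) (φ : OpenPartialHomeomorph X (Fin r → ℂ))
    (a : Fin (2 * r) → ℝ) : PartialEquiv D.Space (Model r) where
  toFun m := (φ m.base, fun i => a i + (m.angle (s i m.base) - (a i : Real.Angle)).toReal)
  invFun p := h.point (φ.symm p.1) p.2
  source := {m | m.base ∈ U ∧ m.base ∈ φ.source ∧
    ∀ i, m.angle (s i m.base) - (a i : Real.Angle) ≠ (Real.pi : Real.Angle)}
  target := {p | p.1 ∈ φ.target ∧ φ.symm p.1 ∈ U ∧ ∀ i, p.2 i - a i ∈ Set.Ioo (-Real.pi) Real.pi}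
  map_source' m hm := by
    refine ⟨φ.map_source hm.2.1, ?_, fun i => ?_⟩
    · dsimp only
      rw [φ.left_inv hm.2.1]; exact hm.1
    · simp only [add_sub_cancel_left]
      exact ⟨Real.Angle.neg_pi_lt_toReal _, lt_of_le_of_ne (Real.Angle.toReal_le_pi _)
        fun h => hm.2.2 i (Real.Angle.toReal_eq_pi_iff.1 h)⟩
  map_target' p hp := by
    refine ⟨?_, ?_, fun i => ?_⟩
    · rw [h.point_base]; exact hp.2.1
    · rw [h.point_base]; exact φ.map_target hp.1
    · rw [h.point_angle hp.2.1, ← Real.Angle.coe_sub, ne_eq, ← Real.Angle.toReal_eq_pi_iff,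
        Real.Angle.toReal_coe_eq_self_iff.2 ⟨(hp.2.2 i).1, (hp.2.2 i).2.le⟩]
      exact (hp.2.2 i).2.ne
  left_inv' m hm := by
    dsimp only
    rw [φ.left_inv hm.2.1]
    refine h.point_eq hm.1 fun i => ?_
    rw [Real.Angle.coe_add, Real.Angle.coe_toReal, add_sub_cancel]
  right_inv' p hp := by
    refine Prod.ext ?_ (funext fun i => ?_)
    · dsimp only
      rw [h.point_base, φ.right_inv hp.1]
    · dsimp only
      rw [h.point_angle hp.2.1, ← Real.Angle.coe_sub,
        Real.Angle.toReal_coe_eq_self_iff.2 ⟨(hp.2.2 i).1, (hp.2.2 i).2.le⟩, add_sub_cancel]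

theorem isOpen_angleChart_target (h : D.IsFrame U s) (φ : OpenPartialHomeomorph X (Fin r → ℂ))
    (a : Fin (2 * r) → ℝ) : IsOpen (h.angleChart φ a).target := by
  have h1 : IsOpen {p : Model r | p.1 ∈ φ.target ∧ φ.symm p.1 ∈ U} :=
    (φ.symm.isOpen_inter_preimage h.isOpen).preimage continuous_fst
  have h2 : IsOpen {p : Model r | ∀ i, p.2 i - a i ∈ Set.Ioo (-Real.pi) Real.pi} := by
    simp only [Set.ofPred_forall]
    refine isOpen_iInter_of_finite fun i => isOpen_Ioo.preimage ?_
    exact ((continuous_apply i).comp continuous_snd).sub continuous_const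
  convert! h1.inter h2 using 1
  ext p
  exact and_assoc.symm

/-- The angle of a flat section in an angle chart. -/
theorem exists_eventually_angle_chart (h : D.IsFrame U s) {φ : OpenPartialHomeomorph X (Fin r → ℂ)}
    {a : Fin (2 * r) → ℝ} {p : Model r} (hp : p ∈ (h.angleChart φ a).target)
    {t : ∀ x, D.charge.fiber x} {k : (Fin (2 * r) → ℤ) × D.flavor}
    (hk : ∀ᶠ y in 𝓝 (φ.symm p.1), t y = D.frameHom s y k) :
    ∃ c : ℝ, ∀ᶠ q in 𝓝 p,
      ((h.angleChart φ a).symm q).angle (t ((h.angleChart φ a).symm q).base) =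
        ((∑ i, (k.1 i : ℝ) * q.2 i + c : ℝ) : Real.Angle) := by
  obtain ⟨c, hn⟩ := h.exists_eventually_angle_point hp.2.1 hk
  refine ⟨c, ?_⟩
  have hc : Filter.Tendsto (fun q : Model r => φ.symm q.1) (𝓝 p) (𝓝 (φ.symm p.1)) :=
    (φ.symm.continuousAt hp.1).tendsto.comp continuous_fst.continuousAt
  filter_upwards [hc.eventually hn] with q hq
  exact hq q.2

theorem angleChart_symm_base (h : D.IsFrame U s) (φ : OpenPartialHomeomorph X (Fin r → ℂ))
    (a : Fin (2 * r) → ℝ) (p : Model r) : ((h.angleChart φ a).symm p).base = φ.symm p.1 :=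
  h.point_base _ _

/-- The transition between angle charts: an integral affine map of the angles over each point. -/
theorem exists_eventually_transition (h : D.IsFrame U s) (h' : D.IsFrame U' s')
    {φ φ' : OpenPartialHomeomorph X (Fin r → ℂ)} {a a' : Fin (2 * r) → ℝ} {p : Model r}
    (hp : p ∈ ((h.angleChart φ a).symm.trans (h'.angleChart φ' a')).source) :
    ∃ (n : Fin (2 * r) → Fin (2 * r) → ℤ) (c : Fin (2 * r) → ℝ), ∀ᶠ q in 𝓝 p,
      q ∈ ((h.angleChart φ a).symm.trans (h'.angleChart φ' a')).source ∧
      ((h.angleChart φ a).symm.trans (h'.angleChart φ' a')) q =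
        (φ' (φ.symm q.1), fun i => ∑ j, (n i j : ℝ) * q.2 j + c i) := by
  obtain ⟨hp1, hp2⟩ := hp
  have hpx : ((h.angleChart φ a).symm p).base = φ.symm p.1 := h.angleChart_symm_base φ a p
  have hpU' : φ.symm p.1 ∈ U' := hpx ▸ hp2.1
  have hpφ' : φ.symm p.1 ∈ φ'.source := hpx ▸ hp2.2.1
  choose k hk using fun i => h.exists_eventually_eq hp1.2.1 (h'.isFlatAt hpU' i)
  choose c hn using fun i => h.exists_eventually_angle_chart hp1 (hk i)
  let n := fun i => (k i).1
  have hlin : ∀ i, Filter.Tendsto (fun q : Model r => ∑ j, (n i j : ℝ) * q.2 j + c i - a' i) (𝓝 p)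
      (𝓝 (∑ j, (n i j : ℝ) * p.2 j + c i - a' i)) := fun i => by
    have : Continuous (fun q : Model r => ∑ j, (n i j : ℝ) * q.2 j + c i - a' i) := by
      refine Continuous.sub (Continuous.add (continuous_finsetSum _ fun j _ => ?_)
        continuous_const) continuous_const
      exact continuous_const.mul ((continuous_apply j).comp continuous_snd)
    exact this.tendsto p
  have hne : ∀ i, ((∑ j, (n i j : ℝ) * p.2 j + c i - a' i : ℝ) : Real.Angle) ≠
      (Real.pi : Real.Angle) := fun i => by
    have h1 := hp2.2.2 i
    have h2 := (hn i).self_of_nhds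
    rw [Real.Angle.coe_sub]
    exact fun h3 => h1 ((congrArg (· - (a' i : Real.Angle)) h2).trans h3)
  choose c' hc' using fun i => exists_eventually_toReal_eq (hlin i) (hne i)
  have hbase : Filter.Tendsto (fun q : Model r => φ.symm q.1) (𝓝 p) (𝓝 (φ.symm p.1)) :=
    (φ.symm.continuousAt hp1.1).tendsto.comp continuous_fst.continuousAt
  have hne' : ∀ i, ∀ᶠ q in 𝓝 p, ((∑ j, (n i j : ℝ) * q.2 j + c i - a' i : ℝ) : Real.Angle) ≠
      (Real.pi : Real.Angle) := fun i =>
    ((Real.Angle.continuous_coe.tendsto _).comp (hlin i)).eventually_ne (hne i)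
  refine ⟨n, fun i => c i + c' i, ?_⟩
  filter_upwards [(h.isOpen_angleChart_target φ a).mem_nhds hp1,
    hbase.eventually (h'.isOpen.mem_nhds hpU'), hbase.eventually (φ'.open_source.mem_nhds hpφ'),
    Filter.eventually_all.2 hn, Filter.eventually_all.2 hc', Filter.eventually_all.2 hne']
    with q h1 h2 h3 h4 h5 h6
  have hqx : ((h.angleChart φ a).symm q).base = φ.symm q.1 := h.angleChart_symm_base φ a q
  have hq : (h.angleChart φ a).symm q ∈ (h'.angleChart φ' a').source := by
    refine ⟨?_, ?_, fun i => ?_⟩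
    · rw [hqx]; exact h2
    · rw [hqx]; exact h3
    · rw [h4 i, ← Real.Angle.coe_sub]; exact h6 i
  refine ⟨⟨h1, hq⟩, Prod.ext ?_ (funext fun i => ?_)⟩
  · exact congrArg φ' hqx
  · change a' i + (((h.angleChart φ a).symm q).angle (s' i ((h.angleChart φ a).symm q).base) -
      (a' i : Real.Angle)).toReal = _
    rw [h4 i, ← Real.Angle.coe_sub, h5 i]
    ring

end IsFrame

variable (D) in
/-- The partial equivalences that serve as charts of `M'`. -/
def spaceAtlas : Set (PartialEquiv D.Space (Model r)) :=
  {e | ∃ (U : Set X) (s : Fin (2 * r) → ∀ x, D.charge.fiber x) (h : D.IsFrame U s)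
    (φ : OpenPartialHomeomorph X (Fin r → ℂ)) (a : Fin (2 * r) → ℝ),
    φ ∈ atlas (Fin r → ℂ) X ∧ e = h.angleChart φ a}

/-- Centers, `0` or `π`, of open intervals of length `2π` in which the angles of a given twisted
character lie. -/
def center (s : Fin (2 * r) → ∀ x, D.charge.fiber x) (m : D.Space) (i : Fin (2 * r)) : ℝ :=
  open Classical in if m.angle (s i m.base) = (Real.pi : Real.Angle) then Real.pi else 0

theorem angle_sub_center_ne (s : Fin (2 * r) → ∀ x, D.charge.fiber x) (m : D.Space)
    (i : Fin (2 * r)) :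
    m.angle (s i m.base) - (center s m i : Real.Angle) ≠ (Real.pi : Real.Angle) := by
  unfold center
  split
  · next h => rw [h, sub_self]; exact Real.Angle.pi_ne_zero.symm
  · next h => simpa using h

theorem IsFrame.mem_angleChart_source (h : D.IsFrame U s)
    {φ : OpenPartialHomeomorph X (Fin r → ℂ)} {m : D.Space} (hU : m.base ∈ U)
    (hφ : m.base ∈ φ.source) : m ∈ (h.angleChart φ (center s m)).source :=
  ⟨hU, hφ, angle_sub_center_ne s m⟩

variable (D) in
/-- The chosen frame near a point. -/
theorem chosenFrame (x : X) : D.IsFrame (D.exists_isFrame x).choose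
    (D.exists_isFrame x).choose_spec.choose :=
  (D.exists_isFrame x).choose_spec.choose_spec.2

theorem mem_chosenFrame (x : X) : x ∈ (D.exists_isFrame x).choose :=
  (D.exists_isFrame x).choose_spec.choose_spec.1

section Manifold

variable [IsManifold 𝓘(ℂ, Fin r → ℂ) ω X]

theorem contDiffAt_transition_base {φ φ' : OpenPartialHomeomorph X (Fin r → ℂ)}
    (hφ : φ ∈ atlas (Fin r → ℂ) X) (hφ' : φ' ∈ atlas (Fin r → ℂ) X) {z : Fin r → ℂ}
    (hz : z ∈ φ.target) (hz' : φ.symm z ∈ φ'.source) :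
    ContDiffAt ℂ ω (fun z => φ' (φ.symm z)) z := by
  have h := HasGroupoid.compatible (G := contDiffGroupoid ω 𝓘(ℂ, Fin r → ℂ)) hφ hφ'
  rw [contDiffGroupoid, mem_groupoid_of_pregroupoid] at h
  have h1 : ContDiffOn ℂ ω (φ.symm.trans φ') (φ.symm.trans φ').source :=
    h.1.mono fun z hz => ⟨hz, z, rfl⟩
  exact h1.contDiffAt ((φ.symm.trans φ').open_source.mem_nhds
    (by simp [hz, hz']))

/-- A complex manifold is a smooth real manifold. -/
theorem isManifold_real : IsManifold 𝓘(ℝ, Fin r → ℂ) ∞ X := by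
  refine isManifold_of_contDiffOn _ _ _ fun e e' he he' z hz => ?_
  have hz' : z ∈ (e.symm.trans e').source := hz.1
  rw [OpenPartialHomeomorph.trans_source] at hz'
  exact (((contDiffAt_transition_base he he' hz'.1 hz'.2).restrict_scalars ℝ).of_le
    le_top).contDiffWithinAt

theorem IsFrame.contDiffAt_transition (h : D.IsFrame U s) (h' : D.IsFrame U' s')
    {φ φ' : OpenPartialHomeomorph X (Fin r → ℂ)} (hφ : φ ∈ atlas (Fin r → ℂ) X)
    (hφ' : φ' ∈ atlas (Fin r → ℂ) X) {a a' : Fin (2 * r) → ℝ} {p : Model r}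
    (hp : p ∈ ((h.angleChart φ a).symm.trans (h'.angleChart φ' a')).source) :
    ContDiffAt ℝ ∞ (E := (Fin r → ℂ) × (Fin (2 * r) → ℝ)) (F := (Fin r → ℂ) × (Fin (2 * r) → ℝ))
      ((h.angleChart φ a).symm.trans (h'.angleChart φ' a')) p := by
  obtain ⟨n, c, hn⟩ := h.exists_eventually_transition h' hp
  refine ContDiffAt.congr_of_eventuallyEq ?_ (hn.mono fun q hq => hq.2)
  have hpx : φ.symm p.1 ∈ φ'.source := (h.angleChart_symm_base φ a p) ▸ hp.2.2.1
  refine ContDiffAt.prodMk ?_ ?_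
  · exact (((contDiffAt_transition_base hφ hφ' hp.1.1 hpx).restrict_scalars ℝ).of_le le_top).comp
      (E := (Fin r → ℂ) × (Fin (2 * r) → ℝ)) p contDiffAt_fst
  · refine ContDiff.contDiffAt ?_
    fun_prop

variable (D) in
/-- The manifold structure of `M'`, as an atlas of angle charts. -/
def spaceCore : ChartedSpaceCore (Model r) D.Space where
  atlas := D.spaceAtlas
  chartAt m := (D.chosenFrame m.base).angleChart (chartAt _ m.base) (center _ m)
  mem_chart_source m := (D.chosenFrame m.base).mem_angleChart_source (mem_chosenFrame m.base)
    (mem_chart_source _ m.base)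
  chart_mem_atlas m := ⟨_, _, D.chosenFrame m.base, _, _, chart_mem_atlas _ m.base, rfl⟩
  open_source := by
    rintro _ _ ⟨U, s, h, φ, a, hφ, rfl⟩ ⟨U', s', h', φ', a', hφ', rfl⟩
    refine isOpen_iff_mem_nhds.2 fun p hp => ?_
    obtain ⟨n, c, hn⟩ := h.exists_eventually_transition h' hp
    exact hn.mono fun q hq => hq.1
  continuousOn_toFun := by
    rintro _ _ ⟨U, s, h, φ, a, hφ, rfl⟩ ⟨U', s', h', φ', a', hφ', rfl⟩ p hp
    exact (h.contDiffAt_transition h' hφ hφ' hp).continuousAt.continuousWithinAt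

instance : TopologicalSpace D.Space := D.spaceCore.toTopologicalSpace

instance : ChartedSpace (Model r) D.Space := D.spaceCore.toChartedSpace

/-- An angle chart, as a chart of `M'`. -/
def IsFrame.chart (h : D.IsFrame U s) {φ : OpenPartialHomeomorph X (Fin r → ℂ)}
    (hφ : φ ∈ atlas (Fin r → ℂ) X) (a : Fin (2 * r) → ℝ) :
    OpenPartialHomeomorph D.Space (Model r) :=
  D.spaceCore.openPartialHomeomorph (h.angleChart φ a) ⟨U, s, h, φ, a, hφ, rfl⟩

theorem IsFrame.chart_mem (h : D.IsFrame U s) {φ : OpenPartialHomeomorph X (Fin r → ℂ)}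
    (hφ : φ ∈ atlas (Fin r → ℂ) X) (a : Fin (2 * r) → ℝ) :
    h.chart hφ a ∈ atlas (Model r) D.Space :=
  Set.mem_iUnion₂.2 ⟨h.angleChart φ a, ⟨U, s, h, φ, a, hφ, rfl⟩, rfl⟩

theorem exists_eq_chart {e : OpenPartialHomeomorph D.Space (Model r)}
    (he : e ∈ atlas (Model r) D.Space) : ∃ (U : Set X)
      (s : Fin (2 * r) → ∀ x, D.charge.fiber x) (h : D.IsFrame U s)
      (φ : OpenPartialHomeomorph X (Fin r → ℂ)) (hφ : φ ∈ atlas (Fin r → ℂ) X)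
      (a : Fin (2 * r) → ℝ), e = h.chart hφ a := by
  obtain ⟨_, ⟨U, s, h, φ, a, hφ, rfl⟩, rfl⟩ := Set.mem_iUnion₂.1 he
  exact ⟨U, s, h, φ, hφ, a, rfl⟩

instance : IsManifold (modelI r) ∞ D.Space := by
  refine isManifold_of_contDiffOn _ _ _ fun e e' he he' p hp => ?_
  obtain ⟨U, s, h, φ, hφ, a, rfl⟩ := exists_eq_chart he
  obtain ⟨U', s', h', φ', hφ', a', rfl⟩ := exists_eq_chart he'
  exact (h.contDiffAt_transition h' hφ hφ' hp.1).contDiffWithinAt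

theorem IsFrame.continuousAt_chart (h : D.IsFrame U s) {φ : OpenPartialHomeomorph X (Fin r → ℂ)}
    (hφ : φ ∈ atlas (Fin r → ℂ) X) {a : Fin (2 * r) → ℝ} {m : D.Space}
    (hm : m ∈ (h.angleChart φ a).source) : ContinuousAt (h.angleChart φ a) m :=
  (h.chart hφ a).continuousAt hm

/-- The base point and the angles of a frame are continuous. -/
theorem IsFrame.continuousAt_base_angle (h : D.IsFrame U s) {m : D.Space} (hm : m.base ∈ U) :
    ContinuousAt (fun m' : D.Space => (m'.base, fun i => m'.angle (s i m'.base))) m := by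
  have hφ := chart_mem_atlas (Fin r → ℂ) m.base
  have hm' := h.mem_angleChart_source hm (mem_chart_source (Fin r → ℂ) m.base)
  have hc := h.continuousAt_chart hφ hm'
  have h1 : ContinuousAt (fun p : Model r => ((chartAt (Fin r → ℂ) m.base).symm p.1,
      fun i => (p.2 i : Real.Angle))) (h.angleChart (chartAt (Fin r → ℂ) m.base) (center s m) m) := by
    refine ContinuousAt.prodMk ?_ (Continuous.continuousAt ?_)
    · refine ContinuousAt.comp (g := (chartAt (Fin r → ℂ) m.base).symm) ?_
        continuous_fst.continuousAt
      exact (chartAt (Fin r → ℂ) m.base).symm.continuousAt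
        ((chartAt (Fin r → ℂ) m.base).map_source hm'.2.1)
    · exact continuous_pi fun i =>
        Real.Angle.continuous_coe.comp ((continuous_apply i).comp continuous_snd)
  refine (h1.comp (f := h.angleChart (chartAt (Fin r → ℂ) m.base) (center s m)) hc).congr ?_
  filter_upwards [(h.chart hφ (center s m)).open_source.mem_nhds hm'] with m' hm''
  refine Prod.ext ((chartAt (Fin r → ℂ) m.base).left_inv hm''.2.1) (funext fun i => ?_)
  change ((_ + _ : ℝ) : Real.Angle) = _
  rw [Real.Angle.coe_add, Real.Angle.coe_toReal, add_sub_cancel]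

/-- Twisted characters over the same point are separated by their angles in a frame. -/
theorem t2Space_space [T2Space X] : T2Space D.Space := by
  rw [t2Space_iff_disjoint_nhds]
  intro m m' hne
  have h := D.chosenFrame m.base
  by_cases hb : m.base = m'.base
  · have hm := mem_chosenFrame (D := D) m.base
    have h1 := h.continuousAt_base_angle hm
    have h2 := h.continuousAt_base_angle (hb ▸ hm : m'.base ∈ _)
    refine h1.tendsto.disjoint (disjoint_nhds_nhds.2 fun he => hne ?_) h2.tendsto
    exact h.ext hm hb fun i => congrFun (congrArg Prod.snd he) i
  · have h1 := (h.continuousAt_base_angle (mem_chosenFrame m.base)).fst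
    have h2 := ((D.chosenFrame m'.base).continuousAt_base_angle (mem_chosenFrame m'.base)).fst
    exact h1.tendsto.disjoint (disjoint_nhds_nhds.2 hb) h2.tendsto

theorem secondCountable_space [SecondCountableTopology X] : SecondCountableTopology D.Space := by
  obtain ⟨A, hA, hcover⟩ := TopologicalSpace.countable_cover_nhds
    (f := fun x : X => (D.exists_isFrame x).choose ∩ (chartAt (Fin r → ℂ) x).source)
    fun x => Filter.inter_mem ((D.chosenFrame x).isOpen.mem_nhds (mem_chosenFrame x))
      ((chartAt (Fin r → ℂ) x).open_source.mem_nhds (mem_chart_source _ x))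
  -- the twisted characters with angles in `{0, π}` over the points of `A`
  let P : X × (Fin (2 * r) → Bool) → D.Space := fun q =>
    (D.chosenFrame q.1).point q.1 fun i => if q.2 i then Real.pi else 0
  have : SecondCountableTopology (Model r) :=
    inferInstanceAs (SecondCountableTopology ((Fin r → ℂ) × (Fin (2 * r) → ℝ)))
  refine ChartedSpace.secondCountable_of_countable_cover (Model r) (s := P '' (A ×ˢ Set.univ))
    (Set.eq_univ_of_forall fun m => ?_) ((hA.prod (Set.to_countable _)).image _)
  obtain ⟨x, hxA, hxU, hxφ⟩ := Set.mem_iUnion₂.1 (hcover.symm ▸ Set.mem_univ m.base)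
  classical
  have hmem : (x, fun i => decide (m.angle ((D.exists_isFrame x).choose_spec.choose i m.base) =
    (Real.pi : Real.Angle))) ∈ A ×ˢ (Set.univ : Set (Fin (2 * r) → Bool)) := ⟨hxA, trivial⟩
  refine Set.mem_iUnion₂.2 ⟨_, ⟨_, hmem, rfl⟩, ?_⟩
  set q : D.Space := P (x, fun i => decide (m.angle
    ((D.exists_isFrame x).choose_spec.choose i m.base) = (Real.pi : Real.Angle))) with hq
  have hqb : q.base = x := (D.chosenFrame x).point_base _ _
  have hcen : center (D.exists_isFrame x).choose_spec.choose q =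
      center (D.exists_isFrame x).choose_spec.choose m := by
    funext i
    have h1 : q.angle ((D.exists_isFrame x).choose_spec.choose i q.base) =
        _ := (D.chosenFrame x).point_angle (mem_chosenFrame x) _ i
    unfold center
    rw [h1]
    by_cases h2 : m.angle ((D.exists_isFrame x).choose_spec.choose i m.base) =
      (Real.pi : Real.Angle)
    · simp [h2]
    · simp [h2, Real.Angle.pi_ne_zero.symm]
  have key : ∀ y, y = x → m ∈ ((D.chosenFrame y).angleChart (chartAt _ y)
      (center (D.exists_isFrame y).choose_spec.choose q)).source := fun y hy => by
    subst hy
    rw [hcen]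
    exact (D.chosenFrame y).mem_angleChart_source hxU hxφ
  exact key q.base hqb

theorem hasAngleCoordinates : D.HasAngleCoordinates := by
  intro U s h
  refine ⟨fun q => h.point q.1 q.2, fun x hx t => ⟨h.point_base x t, h.point_angle hx t⟩,
    fun m hm => ⟨fun i => (m.angle (s i m.base)).toReal,
      h.point_eq hm fun i => Real.Angle.coe_toReal _⟩, ?_⟩
  rintro ⟨⟨x, t⟩, hx, -⟩
  have := isManifold_real (r := r) (X := X)
  have hφ := chart_mem_atlas (Fin r → ℂ) x
  -- the angles are taken in the intervals of length `2π` centered at the coordinates `t`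
  let e₁ : OpenPartialHomeomorph (X × (Fin (2 * r) → ℝ)) (Model r) :=
    (chartAt (Fin r → ℂ) x).prod (OpenPartialHomeomorph.refl _)
  let e₂ : OpenPartialHomeomorph D.Space (Model r) := h.chart hφ t
  have he₁ : e₁ ∈ IsManifold.maximalAtlas (modelI r) ∞ (X × (Fin (2 * r) → ℝ)) :=
    IsManifold.subset_maximalAtlas (Set.mem_image2_of_mem hφ rfl)
  have he₂ : e₂ ∈ IsManifold.maximalAtlas (modelI r) ∞ D.Space :=
    IsManifold.subset_maximalAtlas (h.chart_mem hφ t)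
  let Φ := e₁.trans e₂.symm
  refine ⟨⟨Φ.toPartialEquiv, Φ.open_source, Φ.open_target, ?_, ?_⟩, ?_, ?_⟩
  · exact (contMDiffOn_symm_of_mem_maximalAtlas he₂).comp
      ((contMDiffOn_of_mem_maximalAtlas he₁).mono Set.inter_subset_left)
      fun q hq => hq.2
  · exact (contMDiffOn_symm_of_mem_maximalAtlas he₁).comp
      ((contMDiffOn_of_mem_maximalAtlas he₂).mono Set.inter_subset_left)
      fun q hq => hq.2
  · refine ⟨⟨mem_chart_source _ x, trivial⟩, (chartAt (Fin r → ℂ) x).map_source (mem_chart_source _ x),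
      ?_, fun i => ?_⟩
    · change (chartAt (Fin r → ℂ) x).symm (chartAt (Fin r → ℂ) x x) ∈ U
      rw [(chartAt (Fin r → ℂ) x).left_inv (mem_chart_source _ x)]
      exact hx
    · change t i - t i ∈ _
      rw [sub_self]
      exact ⟨neg_lt_zero.2 Real.pi_pos, Real.pi_pos⟩
  · intro q hq
    change h.point q.1 q.2 =
      h.point ((chartAt (Fin r → ℂ) x).symm (chartAt (Fin r → ℂ) x q.1)) q.2
    rw [(chartAt (Fin r → ℂ) x).left_inv hq.1.1]

end Manifold

end SemiflatData

/-! ### Periods on the base -/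

/-- The functional `c ↦ ∑ n_i c_i` on `ℂ^ι`. -/
def intDot {ι : Type*} [Fintype ι] (n : ι → ℤ) : (ι → ℂ) →L[ℂ] ℂ :=
  ∑ i, (n i : ℂ) • ContinuousLinearMap.proj i

theorem intDot_apply {ι : Type*} [Fintype ι] (n : ι → ℤ) (c : ι → ℂ) :
    intDot n c = ∑ i, (n i : ℂ) * c i := by
  simp [intDot]

namespace SemiflatData

variable {r : ℕ} {X : Type u} [TopologicalSpace X] [ChartedSpace (Fin r → ℂ) X]
  {D : SemiflatData.{u, v} r X} {U : Set X} {s : Fin (2 * r) → ∀ x, D.charge.fiber x}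

theorem Z_frameHom (s : Fin (2 * r) → ∀ x, D.charge.fiber x) (x y : X)
    (p : (Fin (2 * r) → ℤ) × D.flavor) :
    D.Z y (D.frameHom s y p) = intDot p.1 (fun i => D.Z y (s i y)) + D.Z x (D.incl x p.2) := by
  rw [frameHom_apply, map_add, map_sum, D.Z_flavor p.2 y x, intDot_apply]
  simp

/-- A function on the lattice that has the form `∑ n_i s_i + f ↦ ∑ n_i c_i` descends to a functional
on the gauge lattice. -/
theorem IsFrame.isGaugeFunctional (h : D.IsFrame U s) {x : X} (hx : x ∈ U)
    {a : D.charge.fiber x → ℂ} {c : Fin (2 * r) → ℂ}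
    (ha : ∀ p, a (D.frameHom s x p) = intDot p.1 c) :
    IsGaugeFunctional (D.pairing x) a ∧ (fun i => a (s i x)) = c := by
  refine ⟨⟨fun γ γ' => ?_, fun ρ hρ => ?_⟩, funext fun i => ?_⟩
  · obtain ⟨p, rfl⟩ := h.frameHom_surjective hx γ
    obtain ⟨p', rfl⟩ := h.frameHom_surjective hx γ'
    rw [← map_add, ha, ha, ha]
    simp [intDot_apply, add_mul, Finset.sum_add_distrib]
  · obtain ⟨f, rfl⟩ := (D.radical x ρ).2 hρ
    rw [← frameHom_flavor s, ha]
    simp [intDot_apply]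
  · rw [← frameHom_single s, ha]
    simp [intDot_apply, Pi.single_apply]

/-- The periods `Z(s_i)` in a chart of the base. -/
def localZ (s : Fin (2 * r) → ∀ x, D.charge.fiber x) (φ : OpenPartialHomeomorph X (Fin r → ℂ))
    (z : Fin r → ℂ) (i : Fin (2 * r)) : ℂ :=
  D.Z (φ.symm z) (s i (φ.symm z))

/-- The differential of the periods in a chart of the base. -/
def periodMap (s : Fin (2 * r) → ∀ x, D.charge.fiber x)
    (φ : OpenPartialHomeomorph X (Fin r → ℂ)) (z : Fin r → ℂ) :
    (Fin r → ℂ) →L[ℂ] (Fin (2 * r) → ℂ) :=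
  fderiv ℂ (localZ s φ) z

/-- The matrix of the dual pairing in a frame. -/
def frameMatrix (s : Fin (2 * r) → ∀ x, D.charge.fiber x) (x : X) :
    Matrix (Fin (2 * r)) (Fin (2 * r)) ℝ :=
  dualMatrix (D.pairing x) (fun i => s i x)

theorem IsFrame.eventually_frameMatrix (h : D.IsFrame U s) {x : X} (hx : x ∈ U) :
    ∀ᶠ y in 𝓝 x, frameMatrix s y = frameMatrix s x := by
  have : ∀ᶠ y in 𝓝 x, ∀ i j, D.pairing y (s i y) (s j y) = D.pairing x (s i x) (s j x) :=
    Filter.eventually_all.2 fun i => Filter.eventually_all.2 fun j =>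
      eventually_pairing_eq (h.isFlatAt hx i) (h.isFlatAt hx j)
  filter_upwards [this] with y hy
  simp only [frameMatrix, dualMatrix, hy]

theorem IsFrame.eventually_Z (h : D.IsFrame U s) {x : X} (hx : x ∈ U)
    (p : (Fin (2 * r) → ℤ) × D.flavor) : ∀ᶠ y in 𝓝 x,
      D.charge.flatExt x (D.frameHom s x p) y = D.frameHom s y p :=
  (D.charge.isFlatAt_flatExt x _).eventually_eq (h.isFlatAt_frameHom hx p)
    (D.charge.flatExt_self x _)

section Manifold

variable [IsManifold 𝓘(ℂ, Fin r → ℂ) ω X] {φ : OpenPartialHomeomorph X (Fin r → ℂ)}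

theorem IsFrame.differentiableOn_localZ (h : D.IsFrame U s) (hφ : φ ∈ atlas (Fin r → ℂ) X) :
    DifferentiableOn ℂ (localZ s φ) (φ.target ∩ φ.symm ⁻¹' U) := by
  intro z hz
  refine DifferentiableAt.differentiableWithinAt (differentiableAt_pi.2 fun i => ?_)
  have : IsManifold 𝓘(ℂ, Fin r → ℂ) 1 X := IsManifold.of_le (n := ω) le_top
  have h1 := (eventually_mdifferentiableAt_Z (h.isFlatAt hz.2 i)).self_of_nhds
  have h2 : MDifferentiableAt 𝓘(ℂ, Fin r → ℂ) 𝓘(ℂ, Fin r → ℂ) φ.symm z :=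
    mdifferentiableAt_atlas_symm hφ hz.1
  exact (h1.comp z h2).differentiableAt

theorem IsFrame.contDiffAt_localZ (h : D.IsFrame U s) (hφ : φ ∈ atlas (Fin r → ℂ) X)
    {z : Fin r → ℂ} (hz : z ∈ φ.target ∩ φ.symm ⁻¹' U) : ContDiffAt ℂ ∞ (localZ s φ) z := by
  have hO := φ.symm.isOpen_inter_preimage h.isOpen
  refine contDiffAt_pi.2 fun i => ?_
  exact (contDiffOn_of_differentiableOn_complex (f := fun z => localZ s φ z i)
    (differentiableOn_pi.1 (h.differentiableOn_localZ hφ) i) hO).contDiffAt (hO.mem_nhds hz)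

theorem IsFrame.hasFDerivAt_localZ (h : D.IsFrame U s) (hφ : φ ∈ atlas (Fin r → ℂ) X)
    {z : Fin r → ℂ} (hz : z ∈ φ.target ∩ φ.symm ⁻¹' U) :
    HasFDerivAt (localZ s φ) ((periodMap s φ z).restrictScalars ℝ) z :=
  ((h.contDiffAt_localZ hφ hz).differentiableAt (by simp)).hasFDerivAt.restrictScalars ℝ

/-- The differential at `x` of the chart at `x₀`, for the identification of the tangent space at `x`
with `ℂ^r` given by the chart at `x`. -/
def chartDeriv (x₀ x : X) : (Fin r → ℂ) →L[ℝ] (Fin r → ℂ) :=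
  mfderiv 𝓘(ℝ, Fin r → ℂ) 𝓘(ℝ, Fin r → ℂ) (extChartAt 𝓘(ℝ, Fin r → ℂ) x₀) x

/-- The differential of a chart of the base is complex linear. -/
theorem chartDeriv_I_smul {x₀ x : X} (hx : x ∈ (chartAt (Fin r → ℂ) x₀).source) (v : Fin r → ℂ) :
    chartDeriv x₀ x (Complex.I • v) = Complex.I • chartDeriv x₀ x v := by
  have := isManifold_real (r := r) (X := X)
  have := isManifold_one_of_infty (I := 𝓘(ℝ, Fin r → ℂ)) (M := X)
  have hd : MDifferentiableAt 𝓘(ℝ, Fin r → ℂ) 𝓘(ℝ, Fin r → ℂ) (extChartAt 𝓘(ℝ, Fin r → ℂ) x₀) x :=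
    mdifferentiableAt_extChartAt hx
  have hx' : (chartAt (Fin r → ℂ) x).symm (chartAt (Fin r → ℂ) x x) = x :=
    (chartAt (Fin r → ℂ) x).left_inv (mem_chart_source _ x)
  have hc := contDiffAt_transition_base (chart_mem_atlas (Fin r → ℂ) x)
    (chart_mem_atlas (Fin r → ℂ) x₀)
    ((chartAt (Fin r → ℂ) x).map_source (mem_chart_source _ x)) (by rwa [hx'])
  have hf := (hc.differentiableAt (by simp)).hasFDerivAt.restrictScalars ℝ
  have e : chartDeriv x₀ x = fderivWithin ℝ (writtenInExtChartAt 𝓘(ℝ, Fin r → ℂ)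
      𝓘(ℝ, Fin r → ℂ) x (extChartAt 𝓘(ℝ, Fin r → ℂ) x₀)) (Set.range 𝓘(ℝ, Fin r → ℂ))
      (extChartAt 𝓘(ℝ, Fin r → ℂ) x x) := hd.mfderiv
  rw [ModelWithCorners.range_eq_univ, fderivWithin_univ] at e
  rw [e.trans hf.fderiv]
  exact map_smul (fderiv ℂ _ _) Complex.I _

/-- `dZ` in a chart and a frame. -/
theorem IsFrame.baseDZ_frameHom (h : D.IsFrame U s) (x₀ : X) {x : X} (hx : x ∈ U)
    (hx₀ : x ∈ (chartAt (Fin r → ℂ) x₀).source) (v : TangentSpace 𝓘(ℝ, Fin r → ℂ) x)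
    (p : (Fin (2 * r) → ℤ) × D.flavor) :
    D.baseDZ x v (D.frameHom s x p) = intDot p.1 (periodMap s (chartAt (Fin r → ℂ) x₀)
      (chartAt (Fin r → ℂ) x₀ x) (chartDeriv x₀ x v)) := by
  have := isManifold_real (r := r) (X := X)
  have hφ := chart_mem_atlas (Fin r → ℂ) x₀
  have hinv := (chartAt (Fin r → ℂ) x₀).left_inv hx₀
  have hz : chartAt (Fin r → ℂ) x₀ x ∈ (chartAt (Fin r → ℂ) x₀).target ∩
      (chartAt (Fin r → ℂ) x₀).symm ⁻¹' U :=
    ⟨(chartAt (Fin r → ℂ) x₀).map_source hx₀, by rw [Set.mem_preimage, hinv]; exact hx⟩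
  have hG : HasFDerivAt (fun z => intDot p.1 (localZ s (chartAt (Fin r → ℂ) x₀) z) +
      D.Z x (D.incl x p.2)) (((intDot p.1).restrictScalars ℝ).comp
        ((periodMap s (chartAt (Fin r → ℂ) x₀) (chartAt (Fin r → ℂ) x₀ x)).restrictScalars ℝ))
      (extChartAt 𝓘(ℝ, Fin r → ℂ) x₀ x) :=
    ((((intDot p.1).restrictScalars ℝ).hasFDerivAt.comp _
      (h.hasFDerivAt_localZ hφ hz)).add_const _)
  have hc : Filter.Tendsto (chartAt (Fin r → ℂ) x₀).symm (𝓝 (chartAt (Fin r → ℂ) x₀ x)) (𝓝 x) := by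
    have := (chartAt (Fin r → ℂ) x₀).symm.continuousAt hz.1
    rw [ContinuousAt, hinv] at this
    exact this
  have hd := hasMFDerivAt_of_chart (I := 𝓘(ℝ, Fin r → ℂ))
    (f := fun y => D.Z y (D.charge.flatExt x (D.frameHom s x p) y)) x₀
    (by rwa [extChartAt_source]) hG (by
      refine (hc.eventually (h.eventually_Z hx p)).mono fun z hz => ?_
      exact (congrArg (D.Z ((chartAt (Fin r → ℂ) x₀).symm z)) hz).trans (Z_frameHom s x _ p))
  rw [PreSemiflatData.baseDZ, cdiff, hd.mfderiv]
  rfl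

/-- The conditions on `dZ` in a chart and a frame. -/
theorem IsFrame.isPeriodMap (h : D.IsFrame U s) (x₀ : X) {x : X} (hx : x ∈ U)
    (hx₀ : x ∈ (chartAt (Fin r → ℂ) x₀).source) :
    IsPeriodMap (frameMatrix s x)
      (periodMap s (chartAt (Fin r → ℂ) x₀) (chartAt (Fin r → ℂ) x₀ x)) := by
  have := isManifold_real (r := r) (X := X)
  set A := periodMap s (chartAt (Fin r → ℂ) x₀) (chartAt (Fin r → ℂ) x₀ x) with hA
  have hs := h.isGaugeBasis hx
  have hb := D.pairing_antisymm x
  have hgauge := fun v => h.isGaugeFunctional hx (h.baseDZ_frameHom x₀ hx hx₀ v)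
  have hval : ∀ v : Fin r → ℂ, (fun i => D.baseDZ x v (s i x)) = A (chartDeriv x₀ x v) :=
    fun v => (hgauge v).2
  let e : (Fin r → ℂ) → (Fin r → ℂ) := fun v =>
    mfderiv 𝓘(ℝ, Fin r → ℂ) 𝓘(ℝ, Fin r → ℂ) (extChartAt 𝓘(ℝ, Fin r → ℂ) x₀).symm
      (extChartAt 𝓘(ℝ, Fin r → ℂ) x₀ x) v
  have hxe : x ∈ (extChartAt 𝓘(ℝ, Fin r → ℂ) x₀).source := by rwa [extChartAt_source]
  have he : ∀ v, chartDeriv x₀ x (e v) = v := fun v => by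
    have := mfderiv_extChartAt_comp_symm (I := 𝓘(ℝ, Fin r → ℂ)) x₀
      ((extChartAt 𝓘(ℝ, Fin r → ℂ) x₀).map_source hxe) v
    rwa [(extChartAt 𝓘(ℝ, Fin r → ℂ) x₀).left_inv hxe] at this
  have hK := hs.dualMatrix_transpose hb
  refine ⟨hK, hs.dualMatrix_det_ne_zero hb, fun v w => ?_, fun v hv => ?_⟩
  · have h1 := (hs.wedgePairing_eq hb (fun v => (hgauge v).1) (fun v => (hgauge v).1)
      (e v) (e w)).symm.trans (D.dZ_dZ x (e v) (e w))
    rw [hval, hval, he, he, dualForm_swap hK (A w), sub_neg_eq_add, ← two_mul] at h1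
    exact (mul_eq_zero.1 h1).resolve_left two_ne_zero
  · obtain ⟨κ, hκ, hκe⟩ := D.dZ_dZbar
    have hne : e v ≠ 0 := fun h0 => hv (by
      rw [← he v]
      exact (congrArg _ h0).trans (map_zero _))
    have h1 := hκ.positive x (e v) hne
    have h2 := (hs.wedgePairing_eq hb (fun v => (hgauge v).1) (fun v => (hgauge v).1.conj)
      (e v) (Complex.I • e v)).symm.trans (hκe x (e v) (Complex.I • e v))
    have hstar : ∀ v : Fin r → ℂ, (fun i => (starRingEnd ℂ) (D.baseDZ x v (s i x))) =
        star (fun i => D.baseDZ x v (s i x)) := fun v => rfl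
    rw [hstar, hstar, hval, hval, chartDeriv_I_smul hx₀, he] at h2
    have h3 : -2 * Complex.I * dualForm (frameMatrix s x) (A v) (star (A v)) =
        (κ x ![e v, Complex.I • e v] : ℂ) := by
      rw [← h2, map_smul, star_smul, map_smul, map_smul, LinearMap.smul_apply, Complex.star_def,
        Complex.conj_I, frameMatrix]
      simp only [smul_eq_mul]
      ring
    rw [h3, Complex.ofReal_re]
    exact h1

end Manifold

end SemiflatData

/-! ### The differentials of the central charge and of the angles in charts -/

section Charts

variable {E : Type u} [NormedAddCommGroup E] [NormedSpace ℝ E] {H : Type v} [TopologicalSpace H]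
  {I : ModelWithCorners ℝ E H} {M : Type w} [TopologicalSpace M]
  [ChartedSpace H M] [IsManifold I ∞ M]

/-- The logarithmic differential of a function that is an exponential in a chart. -/
theorem inv_mul_cdiff_of_chart {f : M → ℂ} (m₀ : M) {m : M} (hm : m ∈ (extChartAt I m₀).source)
    {G : E → ℂ} {G' : E →L[ℝ] ℂ} (hG : HasFDerivAt G G' (extChartAt I m₀ m))
    (hf : ∀ᶠ y in 𝓝 (extChartAt I m₀ m), f ((extChartAt I m₀).symm y) = Complex.exp (G y))
    (v : TangentSpace I m) :
    (f m)⁻¹ * cdiff I f m v = G' (mfderiv I 𝓘(ℝ, E) (extChartAt I m₀) m v) := by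
  have h1 := hasMFDerivAt_of_chart m₀ hm hG.cexp hf
  have h2 := hf.self_of_nhds
  rw [(extChartAt I m₀).left_inv hm] at h2
  rw [cdiff, h1.mfderiv, h2]
  change _ * (Complex.exp _ * G' (mfderiv I 𝓘(ℝ, E) (extChartAt I m₀) m v)) = _
  rw [← mul_assoc, inv_mul_cancel₀ (Complex.exp_ne_zero _), one_mul]

end Charts

namespace SemiflatData

variable {r : ℕ} {X : Type u} [TopologicalSpace X] [ChartedSpace (Fin r → ℂ) X]
  {D : SemiflatData.{u, v} r X} [IsManifold 𝓘(ℂ, Fin r → ℂ) ω X]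

variable (D) in
/-- The sections of the chosen frame near a point. -/
def sections (x : X) : Fin (2 * r) → ∀ x, D.charge.fiber x :=
  (D.exists_isFrame x).choose_spec.choose

/-- The differential at `m` of the chart at `m₀`, for the identification of the tangent space at `m`
with the model vector space given by the chart at `m`. -/
def coordDeriv (m₀ m : D.Space) :
    (Fin r → ℂ) × (Fin (2 * r) → ℝ) →L[ℝ] (Fin r → ℂ) × (Fin (2 * r) → ℝ) :=
  mfderiv (modelI r) 𝓘(ℝ, (Fin r → ℂ) × (Fin (2 * r) → ℝ)) (extChartAt (modelI r) m₀) m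

/-- The differential of the periods at `m` in the chart at `m₀`. -/
def periods (m₀ m : D.Space) : (Fin r → ℂ) →L[ℂ] (Fin (2 * r) → ℂ) :=
  periodMap (D.sections m₀.base) (chartAt (Fin r → ℂ) m₀.base)
    (chartAt (Fin r → ℂ) m₀.base m.base)

variable {m₀ m : D.Space}

theorem mem_of_mem_source (hm : m ∈ (extChartAt (modelI r) m₀).source) :
    m.base ∈ (D.exists_isFrame m₀.base).choose ∧
      m.base ∈ (chartAt (Fin r → ℂ) m₀.base).source := by
  rw [extChartAt_source] at hm
  exact ⟨hm.1, hm.2.1⟩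

theorem isPeriodMap_periods (hm : m ∈ (extChartAt (modelI r) m₀).source) :
    IsPeriodMap (frameMatrix (D.sections m₀.base) m.base) (periods m₀ m) :=
  (D.chosenFrame m₀.base).isPeriodMap m₀.base (mem_of_mem_source hm).1 (mem_of_mem_source hm).2

theorem mem_localZ_domain (hm : m ∈ (extChartAt (modelI r) m₀).source) :
    chartAt (Fin r → ℂ) m₀.base m.base ∈ (chartAt (Fin r → ℂ) m₀.base).target ∩
      (chartAt (Fin r → ℂ) m₀.base).symm ⁻¹' (D.exists_isFrame m₀.base).choose := by
  obtain ⟨h1, h2⟩ := mem_of_mem_source hm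
  refine ⟨(chartAt (Fin r → ℂ) m₀.base).map_source h2, ?_⟩
  rw [Set.mem_preimage, (chartAt (Fin r → ℂ) m₀.base).left_inv h2]
  exact h1

theorem hasFDerivAt_periods (hm : m ∈ (extChartAt (modelI r) m₀).source)
    (n : Fin (2 * r) → ℤ) (c : ℂ) :
    HasFDerivAt (fun y : (Fin r → ℂ) × (Fin (2 * r) → ℝ) => intDot n
        (localZ (D.sections m₀.base) (chartAt (Fin r → ℂ) m₀.base) y.1) + c)
      (((intDot n).restrictScalars ℝ).comp (((periods m₀ m).restrictScalars ℝ).comp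
        (ContinuousLinearMap.fst ℝ _ _))) (extChartAt (modelI r) m₀ m) := by
  have h1 := (D.chosenFrame m₀.base).hasFDerivAt_localZ (chart_mem_atlas (Fin r → ℂ) m₀.base)
    (mem_localZ_domain hm)
  have h2 : HasFDerivAt (fun y : (Fin r → ℂ) × (Fin (2 * r) → ℝ) =>
      localZ (D.sections m₀.base) (chartAt (Fin r → ℂ) m₀.base) y.1)
      (((periods m₀ m).restrictScalars ℝ).comp (ContinuousLinearMap.fst ℝ _ _))
      (extChartAt (modelI r) m₀ m) :=
    HasFDerivAt.comp (g := localZ (D.sections m₀.base) (chartAt (Fin r → ℂ) m₀.base))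
      (f := (Prod.fst : (Fin r → ℂ) × (Fin (2 * r) → ℝ) → _)) (extChartAt (modelI r) m₀ m) h1
      hasFDerivAt_fst
  exact (((intDot n).restrictScalars ℝ).hasFDerivAt.comp _ h2).add_const c

theorem eventually_Z_chart (hm : m ∈ (extChartAt (modelI r) m₀).source)
    (p : (Fin (2 * r) → ℤ) × D.flavor) : ∃ c : ℂ,
    ∀ᶠ y in 𝓝 (extChartAt (modelI r) m₀ m), D.Z ((extChartAt (modelI r) m₀).symm y).base
      (D.charge.flatExt m.base (D.frameHom (D.sections m₀.base) m.base p)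
        ((extChartAt (modelI r) m₀).symm y).base) =
      intDot p.1 (localZ (D.sections m₀.base) (chartAt (Fin r → ℂ) m₀.base) y.1) + c := by
  obtain ⟨h1, h2⟩ := mem_of_mem_source hm
  have hinv := (chartAt (Fin r → ℂ) m₀.base).left_inv h2
  refine ⟨D.Z m.base (D.incl m.base p.2), ?_⟩
  have hc : Filter.Tendsto (fun y : (Fin r → ℂ) × (Fin (2 * r) → ℝ) =>
      (chartAt (Fin r → ℂ) m₀.base).symm y.1) (𝓝 (extChartAt (modelI r) m₀ m)) (𝓝 m.base) := by
    have := ((chartAt (Fin r → ℂ) m₀.base).symm.continuousAt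
      (mem_localZ_domain hm).1).tendsto
    rw [hinv] at this
    exact this.comp continuous_fst.continuousAt
  filter_upwards [hc.eventually ((D.chosenFrame m₀.base).eventually_Z h1 p)] with y hy
  have hb : ((extChartAt (modelI r) m₀).symm y).base = (chartAt (Fin r → ℂ) m₀.base).symm y.1 :=
    (D.chosenFrame m₀.base).angleChart_symm_base _
      (center (D.sections m₀.base) m₀) y
  rw [hb]
  exact (congrArg (D.Z ((chartAt (Fin r → ℂ) m₀.base).symm y.1)) hy).trans
    (Z_frameHom _ m.base _ p)

theorem eventually_phase_chart (hm : m ∈ (extChartAt (modelI r) m₀).source)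
    (p : (Fin (2 * r) → ℤ) × D.flavor) : ∃ c : ℂ,
    ∀ᶠ y in 𝓝 (extChartAt (modelI r) m₀ m),
      D.phase (D.charge.flatExt m.base (D.frameHom (D.sections m₀.base) m.base p))
        ((extChartAt (modelI r) m₀).symm y) =
      Complex.exp (Complex.I * (intDot p.1 (realToComplex r y.2) + c)) := by
  obtain ⟨h1, h2⟩ := mem_of_mem_source hm
  have hinv := (chartAt (Fin r → ℂ) m₀.base).left_inv h2
  have hm' : m ∈ ((D.chosenFrame m₀.base).angleChart (chartAt (Fin r → ℂ) m₀.base)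
    (center (D.sections m₀.base) m₀)).source := by rwa [extChartAt_source] at hm
  have hk := (D.chosenFrame m₀.base).eventually_Z h1 p
  rw [← hinv] at hk
  obtain ⟨c, hc⟩ := (D.chosenFrame m₀.base).exists_eventually_angle_chart
    (((D.chosenFrame m₀.base).angleChart (chartAt (Fin r → ℂ) m₀.base)
    (center (D.sections m₀.base) m₀)).map_source hm') (t := D.charge.flatExt m.base
      (D.frameHom (D.sections m₀.base) m.base p)) (k := p) (by
        convert! (D.chosenFrame m₀.base).eventually_Z h1 p using 2)
  refine ⟨c, ?_⟩
  filter_upwards [hc] with y hy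
  unfold phase
  refine (congrArg (fun θ : Real.Angle => (θ.toCircle : ℂ)) hy).trans ?_
  rw [Real.Angle.toCircle_coe, Circle.coe_exp, intDot_apply, mul_comm]
  push_cast
  rfl

theorem hasFDerivAt_angles (n : Fin (2 * r) → ℤ) (c : ℂ)
    (y : (Fin r → ℂ) × (Fin (2 * r) → ℝ)) :
    HasFDerivAt (fun y : (Fin r → ℂ) × (Fin (2 * r) → ℝ) => intDot n (realToComplex r y.2) + c)
      (((intDot n).restrictScalars ℝ).comp ((realToComplex r).comp
        (ContinuousLinearMap.snd ℝ _ _))) y :=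
  (((intDot n).restrictScalars ℝ).comp ((realToComplex r).comp
    (ContinuousLinearMap.snd ℝ (Fin r → ℂ) (Fin (2 * r) → ℝ)))).hasFDerivAt.add_const c

theorem dZ_frameHom (hm : m ∈ (extChartAt (modelI r) m₀).source)
    (v : (Fin r → ℂ) × (Fin (2 * r) → ℝ)) (p : (Fin (2 * r) → ℤ) × D.flavor) :
    D.dZ m v (D.frameHom (D.sections m₀.base) m.base p) =
      intDot p.1 (periods m₀ m (coordDeriv m₀ m v).1) := by
  obtain ⟨c, hc⟩ := eventually_Z_chart hm p
  have h := hasMFDerivAt_of_chart m₀ hm (hasFDerivAt_periods hm p.1 c) (f := fun m' : D.Space =>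
    D.Z m'.base (D.charge.flatExt m.base (D.frameHom (D.sections m₀.base) m.base p) m'.base)) hc
  exact congrArg (fun L : (Fin r → ℂ) × (Fin (2 * r) → ℝ) →L[ℝ] ℂ => L v) h.mfderiv

theorem dtheta_frameHom (hm : m ∈ (extChartAt (modelI r) m₀).source)
    (v : (Fin r → ℂ) × (Fin (2 * r) → ℝ)) (p : (Fin (2 * r) → ℤ) × D.flavor) :
    D.dtheta m v (D.frameHom (D.sections m₀.base) m.base p) =
      intDot p.1 (realToComplex r (coordDeriv m₀ m v).2) := by
  obtain ⟨c, hc⟩ := eventually_phase_chart hm p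
  have h := inv_mul_cdiff_of_chart m₀ hm
    ((hasFDerivAt_angles p.1 c (extChartAt (modelI r) m₀ m)).const_mul Complex.I) hc v
  refine Eq.trans (b := Complex.I⁻¹ *
    (Complex.I * intDot p.1 (realToComplex r (coordDeriv m₀ m v).2))) ?_ ?_
  · change (Complex.I * _)⁻¹ * _ = _
    rw [mul_inv, mul_assoc]
    exact congrArg _ h
  · rw [← mul_assoc, inv_mul_cancel₀ Complex.I_ne_zero, one_mul]

theorem dlogX_frameHom (ζ : ℂ) (hm : m ∈ (extChartAt (modelI r) m₀).source)
    (v : (Fin r → ℂ) × (Fin (2 * r) → ℝ)) (p : (Fin (2 * r) → ℤ) × D.flavor) :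
    D.dlogX ζ m v (D.frameHom (D.sections m₀.base) m.base p) =
      intDot p.1 (logVal ζ (periods m₀ m (coordDeriv m₀ m v).1)
        (realToComplex r (coordDeriv m₀ m v).2)) := by
  obtain ⟨c, hc⟩ := eventually_Z_chart hm p
  obtain ⟨c', hc'⟩ := eventually_phase_chart hm p
  have hZ := hasFDerivAt_periods hm p.1 c
  have hconj := (Complex.conjCLE : ℂ →L[ℝ] ℂ).hasFDerivAt.comp _ hZ
  have hθ := (hasFDerivAt_angles p.1 c' (extChartAt (modelI r) m₀ m)).const_mul Complex.I
  have h := inv_mul_cdiff_of_chart m₀ hm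
    (((hZ.const_mul ζ⁻¹).add (hconj.const_mul ζ)).add hθ)
    (f := D.calX ζ (D.charge.flatExt m.base (D.frameHom (D.sections m₀.base) m.base p))) (by
      filter_upwards [hc, hc'] with y h1 h2
      rw [calX, h1, h2, ← Complex.exp_add]
      rfl) v
  refine Eq.trans h ?_
  have hstar : ∀ a : Fin (2 * r) → ℂ, intDot p.1 (star a) = star (intDot p.1 a) := fun a => by
    simp [intDot_apply]
  rw [logVal, map_add, map_add, map_smul, map_smul, map_smul, hstar]
  change ζ⁻¹ * _ + ζ * _ + Complex.I * _ = ζ⁻¹ * _ + Complex.I * _ + ζ * _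
  rw [add_right_comm]
  rfl

/-- `ω₊` in the chart and the frame at `m₀`. -/
theorem omegaPlus_eq (hm : m ∈ (extChartAt (modelI r) m₀).source)
    (v w : (Fin r → ℂ) × (Fin (2 * r) → ℝ)) :
    D.omegaPlus m v w = plusVal (frameMatrix (D.sections m₀.base) m.base)
      (periods m₀ m (coordDeriv m₀ m v).1) (realToComplex r (coordDeriv m₀ m v).2)
      (periods m₀ m (coordDeriv m₀ m w).1) (realToComplex r (coordDeriv m₀ m w).2) := by
  have h := D.chosenFrame m₀.base
  have hx := (mem_of_mem_source hm).1
  have hZ := fun v => h.isGaugeFunctional hx (dZ_frameHom hm v)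
  have hθ := fun v => h.isGaugeFunctional hx (dtheta_frameHom hm v)
  have e := (h.isGaugeBasis hx).wedgePairing_eq (D.pairing_antisymm m.base)
    (fun v => (hZ v).1) (fun v => (hθ v).1) v w
  rw [plusVal, ← (hZ v).2, ← (hZ w).2, ← (hθ v).2, ← (hθ w).2]
  exact congrArg _ e

/-- `ω₃` in the chart and the frame at `m₀`. -/
theorem omegaThree_eq (hm : m ∈ (extChartAt (modelI r) m₀).source)
    (v w : (Fin r → ℂ) × (Fin (2 * r) → ℝ)) :
    D.omegaThree m v w = threeVal (frameMatrix (D.sections m₀.base) m.base)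
      (periods m₀ m (coordDeriv m₀ m v).1) (realToComplex r (coordDeriv m₀ m v).2)
      (periods m₀ m (coordDeriv m₀ m w).1) (realToComplex r (coordDeriv m₀ m w).2) := by
  have h := D.chosenFrame m₀.base
  have hx := (mem_of_mem_source hm).1
  have hZ := fun v => h.isGaugeFunctional hx (dZ_frameHom hm v)
  have hθ := fun v => h.isGaugeFunctional hx (dtheta_frameHom hm v)
  have e1 := (h.isGaugeBasis hx).wedgePairing_eq (D.pairing_antisymm m.base)
    (fun v => (hZ v).1) (fun v => (hZ v).1.conj) v w
  have e2 := (h.isGaugeBasis hx).wedgePairing_eq (D.pairing_antisymm m.base)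
    (fun v => (hθ v).1) (fun v => (hθ v).1) v w
  rw [threeVal, ← (hZ v).2, ← (hZ w).2, ← (hθ v).2, ← (hθ w).2]
  exact congrArg (fun c : ℂ => 1 / (8 * Real.pi) * c)
    (congrArg₂ (fun a b : ℂ => 2 * a - b) e1 e2)

/-- `ϖ(ζ)` in the chart and the frame at `m₀`. -/
theorem varpi_eq (ζ : ℂ) (hm : m ∈ (extChartAt (modelI r) m₀).source)
    (v w : (Fin r → ℂ) × (Fin (2 * r) → ℝ)) :
    D.varpi ζ m v w = varpiVal (frameMatrix (D.sections m₀.base) m.base) ζ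
      (periods m₀ m (coordDeriv m₀ m v).1) (realToComplex r (coordDeriv m₀ m v).2)
      (periods m₀ m (coordDeriv m₀ m w).1) (realToComplex r (coordDeriv m₀ m w).2) := by
  have h := D.chosenFrame m₀.base
  have hx := (mem_of_mem_source hm).1
  have hX := fun v => h.isGaugeFunctional hx (dlogX_frameHom ζ hm v)
  have e := (h.isGaugeBasis hx).wedgePairing_eq (D.pairing_antisymm m.base)
    (fun v => (hX v).1) (fun v => (hX v).1) v w
  rw [varpiVal, ← (hX v).2, ← (hX w).2]
  exact congrArg _ e

end SemiflatData

/-! ### The 2-forms are closed -/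

section Bilinear

variable {r : ℕ}

/-- The bilinear form `(v, w) ↦ K(f v, g w)`. -/
def dualBilin (K : Matrix (Fin (2 * r)) (Fin (2 * r)) ℝ)
    (f g : (Fin (2 * r) → ℂ) × (Fin (2 * r) → ℝ) →L[ℝ] (Fin (2 * r) → ℂ)) :
    (Fin (2 * r) → ℂ) × (Fin (2 * r) → ℝ) →L[ℝ]
      (Fin (2 * r) → ℂ) × (Fin (2 * r) → ℝ) →L[ℝ] ℂ :=
  LinearMap.toContinuousBilinearMap <| LinearMap.mk₂ ℝ (fun v w => dualForm K (f v) (g w))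
    (fun v v' w => by rw [map_add, map_add, LinearMap.add_apply])
    (fun c v w => by
      rw [map_smul, LinearMap.map_smul_of_tower (dualForm K), LinearMap.smul_apply])
    (fun v w w' => by rw [map_add, map_add])
    (fun c v w => by rw [map_smul, LinearMap.map_smul_of_tower])

theorem dualBilin_apply (K : Matrix (Fin (2 * r)) (Fin (2 * r)) ℝ)
    (f g : (Fin (2 * r) → ℂ) × (Fin (2 * r) → ℝ) →L[ℝ] (Fin (2 * r) → ℂ))
    (v w : (Fin (2 * r) → ℂ) × (Fin (2 * r) → ℝ)) :
    dualBilin K f g v w = dualForm K (f v) (g w) := rfl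

/-- The value of `dZ` from the values of `dZ` and `dθ`. -/
abbrev fstL (r : ℕ) : (Fin (2 * r) → ℂ) × (Fin (2 * r) → ℝ) →L[ℝ] (Fin (2 * r) → ℂ) :=
  ContinuousLinearMap.fst ℝ _ _

/-- The value of `dθ` as a complex vector. -/
abbrev sndL (r : ℕ) : (Fin (2 * r) → ℂ) × (Fin (2 * r) → ℝ) →L[ℝ] (Fin (2 * r) → ℂ) :=
  (realToComplex r).comp (ContinuousLinearMap.snd ℝ _ _)

/-- The value of the conjugate of `dZ`. -/
abbrev starFstL (r : ℕ) : (Fin (2 * r) → ℂ) × (Fin (2 * r) → ℝ) →L[ℝ] (Fin (2 * r) → ℂ) :=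
  ((starL' ℝ : (Fin (2 * r) → ℂ) ≃L[ℝ] (Fin (2 * r) → ℂ)) :
    (Fin (2 * r) → ℂ) →L[ℝ] (Fin (2 * r) → ℂ)).comp (fstL r)

/-- The value of `d log 𝒳(ζ)`, as a linear function of the values of `dZ` and `dθ`. -/
def logL (r : ℕ) (ζ : ℂ) : (Fin (2 * r) → ℂ) × (Fin (2 * r) → ℝ) →L[ℝ] (Fin (2 * r) → ℂ) :=
  ζ⁻¹ • fstL r + Complex.I • sndL r + ζ • starFstL r

end Bilinear

namespace SemiflatData

variable {r : ℕ} {X : Type u} [TopologicalSpace X] [ChartedSpace (Fin r → ℂ) X]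
  {D : SemiflatData.{u, v} r X} [IsManifold 𝓘(ℂ, Fin r → ℂ) ω X]

/-- The values of `dZ` and `dθ` in the frame at `m₀`. -/
def periodCoord (m₀ m : D.Space) : (Fin r → ℂ) × (Fin (2 * r) → ℝ) →L[ℝ]
    (Fin (2 * r) → ℂ) × (Fin (2 * r) → ℝ) :=
  (((periods m₀ m).restrictScalars ℝ).prodMap (ContinuousLinearMap.id ℝ _)).comp
    (coordDeriv m₀ m)

/-- The coordinates `(Z(s_i), θ_{s_i})` in the chart at `m₀`. -/
def periodChart (m₀ : D.Space) (y : (Fin r → ℂ) × (Fin (2 * r) → ℝ)) :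
    (Fin (2 * r) → ℂ) × (Fin (2 * r) → ℝ) :=
  (localZ (D.sections m₀.base) (chartAt (Fin r → ℂ) m₀.base) y.1, y.2)

variable {m₀ m : D.Space}

theorem contDiffAt_periodChart (hm : m ∈ (extChartAt (modelI r) m₀).source) :
    ContDiffAt ℝ ∞ (periodChart m₀) (extChartAt (modelI r) m₀ m) := by
  have h1 := ((D.chosenFrame m₀.base).contDiffAt_localZ (chart_mem_atlas (Fin r → ℂ) m₀.base)
    (mem_localZ_domain hm)).restrict_scalars ℝ
  exact ContDiffAt.prodMk (ContDiffAt.comp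
    (g := localZ (D.sections m₀.base) (chartAt (Fin r → ℂ) m₀.base))
    (f := (Prod.fst : (Fin r → ℂ) × (Fin (2 * r) → ℝ) → _)) (extChartAt (modelI r) m₀ m) h1
    contDiffAt_fst) contDiffAt_snd

theorem fderiv_periodChart (hm : m ∈ (extChartAt (modelI r) m₀).source)
    (v : (Fin r → ℂ) × (Fin (2 * r) → ℝ)) :
    fderiv ℝ (periodChart m₀) (extChartAt (modelI r) m₀ m) v = (periods m₀ m v.1, v.2) := by
  have h1 := (D.chosenFrame m₀.base).hasFDerivAt_localZ (chart_mem_atlas (Fin r → ℂ) m₀.base)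
    (mem_localZ_domain hm)
  have h2 : HasFDerivAt (fun y : (Fin r → ℂ) × (Fin (2 * r) → ℝ) =>
      localZ (D.sections m₀.base) (chartAt (Fin r → ℂ) m₀.base) y.1)
      (((periods m₀ m).restrictScalars ℝ).comp (ContinuousLinearMap.fst ℝ _ _))
      (extChartAt (modelI r) m₀ m) :=
    HasFDerivAt.comp (g := localZ (D.sections m₀.base) (chartAt (Fin r → ℂ) m₀.base))
      (f := (Prod.fst : (Fin r → ℂ) × (Fin (2 * r) → ℝ) → _)) (extChartAt (modelI r) m₀ m) h1
      hasFDerivAt_fst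
  have h3 : HasFDerivAt (periodChart m₀) _ (extChartAt (modelI r) m₀ m) :=
    h2.prodMk hasFDerivAt_snd
  rw [h3.fderiv]
  rfl

theorem eventually_frameMatrix_chart {y : (Fin r → ℂ) × (Fin (2 * r) → ℝ)}
    (hy : y ∈ (extChartAt (modelI r) m₀).target) :
    ∀ᶠ y' in 𝓝 y, frameMatrix (D.sections m₀.base) ((chartAt (Fin r → ℂ) m₀.base).symm y'.1) =
      frameMatrix (D.sections m₀.base) ((chartAt (Fin r → ℂ) m₀.base).symm y.1) := by
  have hy' : y ∈ ((D.chosenFrame m₀.base).angleChart (chartAt (Fin r → ℂ) m₀.base)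
    (center (D.sections m₀.base) m₀)).target := by
    rw [extChartAt_target] at hy
    exact hy.1
  have hc : Filter.Tendsto (fun y : (Fin r → ℂ) × (Fin (2 * r) → ℝ) =>
      (chartAt (Fin r → ℂ) m₀.base).symm y.1) (𝓝 y)
      (𝓝 ((chartAt (Fin r → ℂ) m₀.base).symm y.1)) :=
    ((chartAt (Fin r → ℂ) m₀.base).symm.continuousAt hy'.1).tendsto.comp
      continuous_fst.continuousAt
  exact hc.eventually ((D.chosenFrame m₀.base).eventually_frameMatrix hy'.2.1)

/-- A 2-form that in every frame is the antisymmetrization of a bilinear form in the values of `dZ`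
and `dθ`, with coefficients that depend only on the locally constant matrix of the pairing, is smooth
and closed. -/
theorem exists_isClosedForm {F : Type*} [NormedAddCommGroup F] [NormedSpace ℝ F] (L : ℂ →L[ℝ] F)
    (B : Matrix (Fin (2 * r)) (Fin (2 * r)) ℝ → (Fin (2 * r) → ℂ) × (Fin (2 * r) → ℝ) →L[ℝ]
      (Fin (2 * r) → ℂ) × (Fin (2 * r) → ℝ) →L[ℝ] ℂ)
    {val : ∀ m : D.Space, TangentSpace (modelI r) m → TangentSpace (modelI r) m → ℂ}
    (hval : ∀ m₀ m : D.Space, m ∈ (extChartAt (modelI r) m₀).source →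
      ∀ v w : (Fin r → ℂ) × (Fin (2 * r) → ℝ), val m v w =
        B (frameMatrix (D.sections m₀.base) m.base) (periodCoord m₀ m v) (periodCoord m₀ m w) -
        B (frameMatrix (D.sections m₀.base) m.base) (periodCoord m₀ m w) (periodCoord m₀ m v)) :
    ∃ Ω : ∀ m : D.Space, TangentSpace (modelI r) m [⋀^Fin 2]→L[ℝ] F,
      IsClosedForm (modelI r) Ω ∧ ∀ m v w, Ω m ![v, w] = L (val m v w) := by
  let Ω : ∀ m : D.Space, ((Fin r → ℂ) × (Fin (2 * r) → ℝ)) [⋀^Fin 2]→L[ℝ] F := fun m =>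
    L.compContinuousAlternatingMap
      ((altForm (B (frameMatrix (D.sections m.base) m.base))).compContinuousLinearMap
        (periodCoord m m))
  have hΩ : ∀ m (v w : (Fin r → ℂ) × (Fin (2 * r) → ℝ)), Ω m ![v, w] = L (val m v w) :=
    fun m v w => by
      rw [hval m m (mem_extChartAt_source m)]
      rfl
  refine ⟨Ω, isClosedForm_of_chart_pullback (W := (Fin (2 * r) → ℂ) × (Fin (2 * r) → ℝ))
    fun m₀ => ?_, hΩ⟩
  refine ⟨periodChart m₀, fun y => (ContinuousLinearMap.compL ℝ
    ((Fin (2 * r) → ℂ) × (Fin (2 * r) → ℝ)) ℂ F L).comp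
    (B (frameMatrix (D.sections m₀.base) ((chartAt (Fin r → ℂ) m₀.base).symm y.1))),
    fun y hy => ?_⟩
  have hm := (extChartAt (modelI r) m₀).map_target hy
  have hr := (extChartAt (modelI r) m₀).right_inv hy
  have hb : ((extChartAt (modelI r) m₀).symm y).base = (chartAt (Fin r → ℂ) m₀.base).symm y.1 :=
    (D.chosenFrame m₀.base).angleChart_symm_base _ (center (D.sections m₀.base) m₀) y
  have h1 := contDiffAt_periodChart hm
  have h2 := fderiv_periodChart hm
  rw [hr] at h1 h2
  refine ⟨h1, (eventually_frameMatrix_chart hy).mono fun y' hy' =>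
    congrArg (fun K => (ContinuousLinearMap.compL ℝ
      ((Fin (2 * r) → ℂ) × (Fin (2 * r) → ℝ)) ℂ F L).comp (B K)) hy', fun v w => ?_⟩
  refine (hΩ _ v w).trans ((congrArg L (hval m₀ _ hm v w)).trans ?_)
  rw [map_sub, hb]
  change _ = L (B _ (fderiv ℝ (periodChart m₀) y (coordDeriv m₀ _ v))
    (fderiv ℝ (periodChart m₀) y (coordDeriv m₀ _ w))) -
    L (B _ (fderiv ℝ (periodChart m₀) y (coordDeriv m₀ _ w))
    (fderiv ℝ (periodChart m₀) y (coordDeriv m₀ _ v)))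
  rw [h2, h2]
  rfl

variable (D) in
theorem exists_omegaPlus {F : Type*} [NormedAddCommGroup F] [NormedSpace ℝ F] (L : ℂ →L[ℝ] F) :
    ∃ Ω : ∀ m : D.Space, TangentSpace (modelI r) m [⋀^Fin 2]→L[ℝ] F,
      IsClosedForm (modelI r) Ω ∧ ∀ m v w, Ω m ![v, w] = L (D.omegaPlus m v w) :=
  exists_isClosedForm L (fun K => (-(1 / (2 * Real.pi)) : ℂ) • dualBilin K (fstL r) (sndL r))
    fun m₀ m hm v w => by
      rw [omegaPlus_eq hm, plusVal, mul_sub]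
      rfl

variable (D) in
theorem exists_omegaThree {F : Type*} [NormedAddCommGroup F] [NormedSpace ℝ F] (L : ℂ →L[ℝ] F) :
    ∃ Ω : ∀ m : D.Space, TangentSpace (modelI r) m [⋀^Fin 2]→L[ℝ] F,
      IsClosedForm (modelI r) Ω ∧ ∀ m v w, Ω m ![v, w] = L (D.omegaThree m v w) :=
  exists_isClosedForm L (fun K => (1 / (8 * Real.pi) : ℂ) •
      ((2 : ℂ) • dualBilin K (fstL r) (starFstL r) - dualBilin K (sndL r) (sndL r)))
    fun m₀ m hm v w => by
      rw [omegaThree_eq hm, threeVal]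
      change _ = _ * (2 * dualForm _ _ _ - dualForm _ _ _) -
        _ * (2 * dualForm _ _ _ - dualForm _ _ _)
      rw [← mul_sub]
      congr 1
      rw [sub_sub_sub_comm, ← mul_sub]
      rfl

variable (D) in
theorem exists_varpi (ζ : ℂ) : ∃ Ω : ∀ m : D.Space, TangentSpace (modelI r) m [⋀^Fin 2]→L[ℝ] ℂ,
    IsClosedForm (modelI r) Ω ∧ ∀ m v w, Ω m ![v, w] = D.varpi ζ m v w :=
  exists_isClosedForm (val := fun m v w => D.varpi ζ m v w) (ContinuousLinearMap.id ℝ ℂ)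
    (fun K => (1 / (8 * Real.pi) : ℂ) •
      dualBilin K (logL r ζ) (logL r ζ)) fun m₀ m hm v w => by
      rw [varpi_eq ζ hm, varpiVal, mul_sub]
      rfl

end SemiflatData

/-! ### The hyper-Kähler structure on the tangent spaces -/

namespace IsPeriodMap

variable {r : ℕ} {K : Matrix (Fin (2 * r)) (Fin (2 * r)) ℝ}
  {A : (Fin r → ℂ) →L[ℂ] (Fin (2 * r) → ℂ)}

/-- For every `ζ ≠ 0` the value of `d log 𝒳(ζ)` determines the tangent vector. -/
def logEquiv (h : IsPeriodMap K A) {ζ : ℂ} (hζ : ζ ≠ 0) :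
    ((Fin r → ℂ) × (Fin (2 * r) → ℝ)) ≃ₗ[ℝ] (Fin (2 * r) → ℂ) :=
  LinearMap.linearEquivOfInjective
    ((logL r ζ).comp ((A.restrictScalars ℝ).prodMap (ContinuousLinearMap.id ℝ _)) :
      (Fin r → ℂ) × (Fin (2 * r) → ℝ) →ₗ[ℝ] (Fin (2 * r) → ℂ))
    ((injective_iff_map_eq_zero _).2 fun _ hv =>
      Prod.ext (h.logVal_injective hζ hv).1 (h.logVal_injective hζ hv).2)
    (by
      rw [Module.finrank_prod, Module.finrank_pi_fintype, Module.finrank_pi_fintype,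
        Module.finrank_pi_fintype]
      simp [Complex.finrank_real_complex]
      ring)

end IsPeriodMap

namespace SemiflatData

variable {r : ℕ} {X : Type u} [TopologicalSpace X] [ChartedSpace (Fin r → ℂ) X]
  {D : SemiflatData.{u, v} r X} [IsManifold 𝓘(ℂ, Fin r → ℂ) ω X] {m₀ m : D.Space}

/-- The differential of the chart at `m₀` as an isomorphism. -/
def coordEquiv (hm : m ∈ (extChartAt (modelI r) m₀).source) :
    ((Fin r → ℂ) × (Fin (2 * r) → ℝ)) ≃L[ℝ] ((Fin r → ℂ) × (Fin (2 * r) → ℝ)) :=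
  ContinuousLinearEquiv.equivOfInverse (coordDeriv m₀ m)
    (mfderiv 𝓘(ℝ, (Fin r → ℂ) × (Fin (2 * r) → ℝ)) (modelI r) (extChartAt (modelI r) m₀).symm
      (extChartAt (modelI r) m₀ m))
    (fun v => mfderiv_symm_comp_extChartAt m₀ hm v) (fun v => by
      have h := mfderiv_extChartAt_comp_symm m₀ ((extChartAt (modelI r) m₀).map_source hm) v
      rw [(extChartAt (modelI r) m₀).left_inv hm] at h
      exact h)

/-- The values of the real 2-forms `Re ω₊`, `Im ω₊` and `Re ω₃`. -/
def kahlerValue (m : D.Space) (i : Fin 3) (v w : (Fin r → ℂ) × (Fin (2 * r) → ℝ)) : ℝ :=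
  ![(D.omegaPlus m v w).re, (D.omegaPlus m v w).im, (D.omegaThree m v w).re] i

theorem kahlerValue_eq (hm : m ∈ (extChartAt (modelI r) m₀).source) :
    kahlerValue m = fun i v w => modelForm (frameMatrix (D.sections m₀.base) m.base)
      (periods m₀ m) i (coordEquiv hm v) (coordEquiv hm w) := by
  ext i v w
  have h1 := omegaPlus_eq hm v w
  have h2 := omegaThree_eq hm v w
  fin_cases i
  · exact congrArg Complex.re h1
  · exact congrArg Complex.im h1
  · exact congrArg Complex.re h2

/-- The metric at a point. -/
def metricAt (m : D.Space) : (Fin r → ℂ) × (Fin (2 * r) → ℝ) →L[ℝ]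
    (Fin r → ℂ) × (Fin (2 * r) → ℝ) →L[ℝ] ℝ :=
  let e := coordEquiv (mem_extChartAt_source (I := modelI r) m)
  (ContinuousLinearMap.precomp ℝ (e : _ →L[ℝ] (Fin r → ℂ) × (Fin (2 * r) → ℝ))).comp
    ((isPeriodMap_periods (mem_extChartAt_source m)).metric.comp
      (e : _ →L[ℝ] (Fin r → ℂ) × (Fin (2 * r) → ℝ)))

/-- The complex structures on the tangent space at `m`, computed in the chart at `m₀`. -/
def structureIn (hm : m ∈ (extChartAt (modelI r) m₀).source) (i : Fin 3) :
    (Fin r → ℂ) × (Fin (2 * r) → ℝ) →L[ℝ] (Fin r → ℂ) × (Fin (2 * r) → ℝ) :=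
  ((coordEquiv hm).symm : _ →L[ℝ] (Fin r → ℂ) × (Fin (2 * r) → ℝ)).comp
    (((isPeriodMap_periods hm).complexStructure i).comp
      (coordEquiv hm : _ →L[ℝ] (Fin r → ℂ) × (Fin (2 * r) → ℝ)))

/-- The complex structures at a point. -/
def structureAt (m : D.Space) (i : Fin 3) :
    (Fin r → ℂ) × (Fin (2 * r) → ℝ) →L[ℝ] (Fin r → ℂ) × (Fin (2 * r) → ℝ) :=
  structureIn (mem_extChartAt_source (I := modelI r) m) i

theorem isHyperkahlerPoint_metricAt (m : D.Space) :
    IsHyperkahlerPoint (kahlerValue m) (metricAt m) (structureAt m) := by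
  rw [kahlerValue_eq (mem_extChartAt_source m)]
  exact (isPeriodMap_periods (mem_extChartAt_source m)).isHyperkahlerPoint.comap _

/-- The complex structures do not depend on the chart, because the 2-forms determine them. -/
theorem coordDeriv_structureAt (hm : m ∈ (extChartAt (modelI r) m₀).source) (i : Fin 3)
    (v : (Fin r → ℂ) × (Fin (2 * r) → ℝ)) : coordDeriv m₀ m (structureAt m i v) =
      (isPeriodMap_periods hm).complexStructure i (coordDeriv m₀ m v) := by
  have h := (isPeriodMap_periods hm).isHyperkahlerPoint.comap (coordEquiv hm)
  rw [← kahlerValue_eq hm] at h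
  rw [(isHyperkahlerPoint_metricAt m).J_unique h i v]
  exact (coordEquiv hm).apply_symm_apply _

/-! ### The holomorphic symplectic forms -/

theorem isCompl_varpi {ζ : ℂ} (hζ : ζ ≠ 0)
    {Ω : ((Fin r → ℂ) × (Fin (2 * r) → ℝ)) [⋀^Fin 2]→L[ℝ] ℂ}
    (hΩ : ∀ v w, Ω ![v, w] = D.varpi ζ m v w) :
    IsCompl (formKer Ω) (formKer (conjForm Ω)) := by
  have hm := mem_extChartAt_source (I := modelI r) m
  have hK := isPeriodMap_periods hm
  let α := (coordEquiv hm).toLinearEquiv.trans (hK.logEquiv hζ)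
  have hα : ∀ v w, Ω ![v, w] = 1 / (8 * Real.pi) *
      (dualForm (frameMatrix (D.sections m.base) m.base) (α v) (α w) -
      dualForm (frameMatrix (D.sections m.base) m.base) (α w) (α v)) := fun v w =>
    (hΩ v w).trans (varpi_eq ζ hm v w)
  -- the complex structure pulled back from `ℂ^{2r}` by `d log 𝒳(ζ)`
  refine isCompl_formKer (J := fun v => α.symm (Complex.I • α v)) (fun v => ?_) (fun v w => ?_)
    (fun v w => ?_) fun v hv => ?_
  · simp only [LinearEquiv.apply_symm_apply]
    rw [smul_smul, Complex.I_mul_I, neg_one_smul, map_neg, LinearEquiv.symm_apply_apply]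
  · rw [map_add, smul_add, map_add]
  · rw [hα, hα, LinearEquiv.apply_symm_apply, map_smul, map_smul, LinearMap.smul_apply,
      smul_eq_mul, smul_eq_mul]
    ring
  · refine α.injective ?_
    rw [map_zero]
    refine dualForm_eq_zero hK.det_ne_zero fun b => ?_
    have h := hv (α.symm b)
    rw [hα, LinearEquiv.apply_symm_apply, dualForm_swap hK.antisymm b] at h
    have hpi : (Real.pi : ℂ) ≠ 0 := by exact_mod_cast Real.pi_ne_zero
    have h2 := (mul_eq_zero.1 h).resolve_left (by simp [hpi])
    rw [sub_neg_eq_add, add_self_eq_zero] at h2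
    exact h2

theorem isCompl_omegaPlus {Ω : ((Fin r → ℂ) × (Fin (2 * r) → ℝ)) [⋀^Fin 2]→L[ℝ] ℂ}
    (hΩ : ∀ v w, Ω ![v, w] = D.omegaPlus m v w) :
    IsCompl (formKer Ω) (formKer (conjForm Ω)) := by
  have hm := mem_extChartAt_source (I := modelI r) m
  have hK := isPeriodMap_periods hm
  have h := isHyperkahlerPoint_metricAt m
  refine isCompl_formKer (J := structureAt m 2) (h.sq 2) (map_add _) (fun v w => ?_) fun v hv => ?_
  · refine (hΩ _ _).trans ((omegaPlus_eq hm _ w).trans (Eq.trans ?_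
      (congrArg (Complex.I * ·) ((hΩ v w).trans (omegaPlus_eq hm v w)).symm)))
    have e := coordDeriv_structureAt hm 2 v
    rw [e]
    simp only [plusVal]
    rw [hK.dualForm_complexStructure_two, hK.complexStructure_two, map_smul, map_smul,
      LinearMap.smul_apply, smul_eq_mul]
    ring
  · refine h.form_nondegenerate 0 fun w => ?_
    exact (congrArg Complex.re ((hΩ v w).symm.trans (hv w))).trans Complex.zero_re

variable (D) in
theorem exists_isHolomorphicSymplectic_varpi {ζ : ℂ} (hζ : ζ ≠ 0) :
    ∃ Ω : ∀ m : D.Space, TangentSpace (modelI r) m [⋀^Fin 2]→L[ℝ] ℂ,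
      IsHolomorphicSymplectic (modelI r) Ω ∧ ∀ m v w, Ω m ![v, w] = D.varpi ζ m v w := by
  obtain ⟨Ω, h1, h2⟩ := D.exists_varpi ζ
  exact ⟨Ω, ⟨h1, fun m => isCompl_varpi hζ (h2 m)⟩, h2⟩

variable (D) in
theorem exists_isHolomorphicSymplectic_omegaPlus :
    ∃ Ω : ∀ m : D.Space, TangentSpace (modelI r) m [⋀^Fin 2]→L[ℝ] ℂ,
      IsHolomorphicSymplectic (modelI r) Ω ∧ ∀ m v w, Ω m ![v, w] = D.omegaPlus m v w := by
  obtain ⟨Ω, h1, h2⟩ := D.exists_omegaPlus (ContinuousLinearMap.id ℝ ℂ)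
  exact ⟨Ω, ⟨h1, fun m => isCompl_omegaPlus (h2 m)⟩, h2⟩

end SemiflatData

/-! ### Integrability of the complex structures -/

namespace SemiflatData

variable {r : ℕ} {X : Type u} [TopologicalSpace X] [ChartedSpace (Fin r → ℂ) X]
  {D : SemiflatData.{u, v} r X} [IsManifold 𝓘(ℂ, Fin r → ℂ) ω X]

/-- A complex structure for which `d log 𝒳(ζ)` is of type `(1, 0)` is integrable: the functions
`log 𝒳_{s_i}(ζ)` are holomorphic coordinates. -/
theorem isComplexStructure_of_log {ζ : ℂ} (hζ : ζ ≠ 0) (i : Fin 3)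
    (h : ∀ (m₀ m : D.Space) (hm : m ∈ (extChartAt (modelI r) m₀).source)
      (v : (Fin r → ℂ) × (Fin (2 * r) → ℝ)),
      (isPeriodMap_periods hm).logEquiv hζ ((isPeriodMap_periods hm).complexStructure i v) =
        Complex.I • (isPeriodMap_periods hm).logEquiv hζ v) :
    IsComplexStructure (modelI r) (fun m : D.Space => structureAt m i) := by
  refine isComplexStructure_of_chart (fun m v => (isHyperkahlerPoint_metricAt m).sq i v)
    (Fin (2 * r) → ℂ) fun m₀ => ⟨fun y => logL r ζ (periodChart m₀ y), ?_⟩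
  filter_upwards [extChartAt_source_mem_nhds (I := modelI r) m₀] with m hm
  have hs := contDiffAt_periodChart hm
  have hd : ∀ v, fderiv ℝ (fun y => logL r ζ (periodChart m₀ y)) (extChartAt (modelI r) m₀ m) v =
      (isPeriodMap_periods hm).logEquiv hζ v := fun v => by
    have h1 := ((logL r ζ).hasFDerivAt.comp _
      (hs.differentiableAt (by simp)).hasFDerivAt).fderiv
    refine (congrArg (fun L : (Fin r → ℂ) × (Fin (2 * r) → ℝ) →L[ℝ] (Fin (2 * r) → ℂ) => L v)
      h1).trans (congrArg (logL r ζ) (fderiv_periodChart hm v))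
  refine ⟨(logL r ζ).contDiff.contDiffAt.comp _ hs, fun a b hab => ?_, fun b => ?_, fun v => ?_⟩
  · rw [hd, hd] at hab
    exact (LinearEquiv.injective _) hab
  · obtain ⟨a, ha⟩ := ((isPeriodMap_periods hm).logEquiv hζ).surjective b
    exact ⟨a, (hd a).trans ha⟩
  · refine (hd _).trans (Eq.trans ?_ (congrArg (Complex.I • ·) (hd _)).symm)
    refine Eq.trans ?_ (h m₀ m hm (coordDeriv m₀ m v))
    exact congrArg _ (coordDeriv_structureAt hm i v)

/-- The partial derivatives of the periods are holomorphic. -/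
theorem IsFrame.differentiableOn_periodMap {U : Set X} {s : Fin (2 * r) → ∀ x, D.charge.fiber x}
    (h : D.IsFrame U s) {φ : OpenPartialHomeomorph X (Fin r → ℂ)} (hφ : φ ∈ atlas (Fin r → ℂ) X)
    (u : Fin r → ℂ) :
    DifferentiableOn ℂ (fun z => periodMap s φ z u) (φ.target ∩ φ.symm ⁻¹' U) := by
  have hO := φ.symm.isOpen_inter_preimage h.isOpen
  refine differentiableOn_pi.2 fun i => (differentiableOn_fderiv_apply
    (differentiableOn_pi.1 (h.differentiableOn_localZ hφ) i) hO u).congr fun z hz => ?_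
  have h1 := ((h.contDiffAt_localZ hφ hz).differentiableAt (by simp)).hasFDerivAt
  rw [(hasFDerivAt_pi'.1 h1 i).fderiv]
  rfl

theorem IsFrame.contDiffAt_periodMap {U : Set X} {s : Fin (2 * r) → ∀ x, D.charge.fiber x}
    (h : D.IsFrame U s) {φ : OpenPartialHomeomorph X (Fin r → ℂ)} (hφ : φ ∈ atlas (Fin r → ℂ) X)
    (u : Fin r → ℂ) {z : Fin r → ℂ} (hz : z ∈ φ.target ∩ φ.symm ⁻¹' U) :
    ContDiffAt ℂ ∞ (fun z => periodMap s φ z u) z := by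
  have hO := φ.symm.isOpen_inter_preimage h.isOpen
  refine contDiffAt_pi.2 fun i => ?_
  exact (contDiffOn_of_differentiableOn_complex (f := fun z => periodMap s φ z u i)
    (differentiableOn_pi.1 (h.differentiableOn_periodMap hφ u) i) hO).contDiffAt (hO.mem_nhds hz)

/-- The function `⟨∂_u Z, θ⟩` in the chart at `m₀`, for the pairing of functionals with the
matrix `K`. -/
def fiberCoord (K : Matrix (Fin (2 * r)) (Fin (2 * r)) ℝ) (m₀ : D.Space) (u : Fin r → ℂ)
    (y : (Fin r → ℂ) × (Fin (2 * r) → ℝ)) : ℂ :=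
  dualForm K (periodMap (D.sections m₀.base) (chartAt (Fin r → ℂ) m₀.base) y.1 u)
    (realToComplex r y.2)

variable {m₀ m : D.Space}

/-- The coordinates `(∂_u Z(s_i), θ_{s_i})` in the chart at `m₀`. -/
def periodDerivChart (m₀ : D.Space) (u : Fin r → ℂ) (y : (Fin r → ℂ) × (Fin (2 * r) → ℝ)) :
    (Fin (2 * r) → ℂ) × (Fin (2 * r) → ℝ) :=
  (periodMap (D.sections m₀.base) (chartAt (Fin r → ℂ) m₀.base) y.1 u, y.2)

theorem contDiffAt_periodDerivChart (hm : m ∈ (extChartAt (modelI r) m₀).source)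
    (u : Fin r → ℂ) : ContDiffAt ℝ ∞ (periodDerivChart m₀ u) (extChartAt (modelI r) m₀ m) := by
  have h0 := ((D.chosenFrame m₀.base).contDiffAt_periodMap
    (chart_mem_atlas (Fin r → ℂ) m₀.base) u (mem_localZ_domain hm)).restrict_scalars ℝ
  exact ContDiffAt.prodMk (ContDiffAt.comp
    (g := fun z => periodMap (D.sections m₀.base) (chartAt (Fin r → ℂ) m₀.base) z u)
    (f := (Prod.fst : (Fin r → ℂ) × (Fin (2 * r) → ℝ) → _)) (extChartAt (modelI r) m₀ m) h0
    contDiffAt_fst) contDiffAt_snd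

theorem hasFDerivAt_periodDerivChart (hm : m ∈ (extChartAt (modelI r) m₀).source)
    (u : Fin r → ℂ) : ∃ L : (Fin r → ℂ) →L[ℂ] (Fin (2 * r) → ℂ),
      HasFDerivAt (periodDerivChart m₀ u)
        (((L.restrictScalars ℝ).comp (ContinuousLinearMap.fst ℝ _ _)).prod
          (ContinuousLinearMap.snd ℝ _ _)) (extChartAt (modelI r) m₀ m) := by
  have h0 := (D.chosenFrame m₀.base).contDiffAt_periodMap
    (chart_mem_atlas (Fin r → ℂ) m₀.base) u (mem_localZ_domain hm)
  have h1 := (h0.differentiableAt (by simp)).hasFDerivAt.restrictScalars ℝ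
  exact ⟨_, HasFDerivAt.prodMk (HasFDerivAt.comp
    (g := fun z => periodMap (D.sections m₀.base) (chartAt (Fin r → ℂ) m₀.base) z u)
    (f := (Prod.fst : (Fin r → ℂ) × (Fin (2 * r) → ℝ) → _)) (extChartAt (modelI r) m₀ m) h1
    hasFDerivAt_fst) hasFDerivAt_snd⟩

theorem contDiffAt_fiberCoord (K : Matrix (Fin (2 * r)) (Fin (2 * r)) ℝ)
    (hm : m ∈ (extChartAt (modelI r) m₀).source) (u : Fin r → ℂ) :
    ContDiffAt ℝ ∞ (fiberCoord K m₀ u) (extChartAt (modelI r) m₀ m) := by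
  have hs := contDiffAt_periodDerivChart hm u
  have h := (((dualBilin K (fstL r) (sndL r)).contDiff.contDiffAt (n := ∞)).comp _ hs).clm_apply hs
  exact h

theorem hasFDerivAt_fiberCoord (K : Matrix (Fin (2 * r)) (Fin (2 * r)) ℝ)
    (hm : m ∈ (extChartAt (modelI r) m₀).source) (u : Fin r → ℂ) :
    ∃ L : (Fin r → ℂ) →L[ℂ] (Fin (2 * r) → ℂ), ∃ F : (Fin r → ℂ) × (Fin (2 * r) → ℝ) →L[ℝ] ℂ,
      (∀ v, F v = dualForm K (periods m₀ m u) (realToComplex r v.2) +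
        dualForm K (L v.1) (realToComplex r (extChartAt (modelI r) m₀ m).2)) ∧
      HasFDerivAt (fiberCoord K m₀ u) F (extChartAt (modelI r) m₀ m) := by
  obtain ⟨L, hL⟩ := hasFDerivAt_periodDerivChart hm u
  have h := (dualBilin K (fstL r) (sndL r)).hasFDerivAt_of_bilinear hL hL
  refine ⟨L, _, fun v => ?_, h⟩
  rw [add_apply, ContinuousLinearMap.precompR_apply, ContinuousLinearMap.precompL_apply,
    dualBilin_apply]
  rfl

/-- `J₃` is integrable: the coordinates of the base and the functions `⟨∂_k Z, θ⟩` are holomorphic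
coordinates. -/
theorem isComplexStructure_two :
    IsComplexStructure (modelI r) (fun m : D.Space => structureAt m 2) := by
  refine isComplexStructure_of_chart (fun m v => (isHyperkahlerPoint_metricAt m).sq 2 v)
    ((Fin r → ℂ) × (Fin r → ℂ)) fun m₀ => ⟨fun y => (y.1, fun k => fiberCoord
      (frameMatrix (D.sections m₀.base) m₀.base) m₀ (Pi.single k 1) y), ?_⟩
  have hev : ∀ᶠ m in 𝓝 m₀, frameMatrix (D.sections m₀.base)
      ((chartAt (Fin r → ℂ) m₀.base).symm (extChartAt (modelI r) m₀ m).1) =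
      frameMatrix (D.sections m₀.base)
      ((chartAt (Fin r → ℂ) m₀.base).symm (extChartAt (modelI r) m₀ m₀).1) :=
    (continuousAt_extChartAt (I := modelI r) m₀).eventually
      (eventually_frameMatrix_chart (mem_extChartAt_target m₀))
  filter_upwards [extChartAt_source_mem_nhds (I := modelI r) m₀, hev] with m hm hK
  have hinv : ∀ m' : D.Space, m' ∈ (extChartAt (modelI r) m₀).source →
      (chartAt (Fin r → ℂ) m₀.base).symm (extChartAt (modelI r) m₀ m').1 = m'.base := fun m' hm' =>
    (chartAt (Fin r → ℂ) m₀.base).left_inv (mem_of_mem_source hm').2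
  rw [hinv m hm, hinv m₀ (mem_extChartAt_source m₀)] at hK
  rw [← hK]
  have hp := isPeriodMap_periods hm
  have hs := fun k : Fin r => contDiffAt_fiberCoord
    (frameMatrix (D.sections m₀.base) m.base) hm (Pi.single k 1)
  have hd := fun k : Fin r => hasFDerivAt_fiberCoord
    (frameMatrix (D.sections m₀.base) m.base) hm (Pi.single k 1)
  choose L F hF hd using hd
  have hG : HasFDerivAt (fun y : (Fin r → ℂ) × (Fin (2 * r) → ℝ) => (y.1, fun k => fiberCoord
      (frameMatrix (D.sections m₀.base) m.base) m₀ (Pi.single k 1) y))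
      ((ContinuousLinearMap.fst ℝ _ _).prod (ContinuousLinearMap.pi F))
      (extChartAt (modelI r) m₀ m) := hasFDerivAt_fst.prodMk (hasFDerivAt_pi.2 hd)
  have hinj : Function.Injective
      ((ContinuousLinearMap.fst ℝ _ _).prod (ContinuousLinearMap.pi F) :
        (Fin r → ℂ) × (Fin (2 * r) → ℝ) →ₗ[ℝ] (Fin r → ℂ) × (Fin r → ℂ)) := by
    refine (injective_iff_map_eq_zero _).2 fun v hv => ?_
    have h1 : v.1 = 0 := congrArg Prod.fst hv
    refine Prod.ext h1 (hp.eq_zero_of_dualForm fun x => ?_)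
    have h2 : ∀ k, dualForm (frameMatrix (D.sections m₀.base) m.base)
        (periods m₀ m (Pi.single k 1)) (realToComplex r v.2) = 0 := fun k => by
      have h3 : F k v = 0 := congrFun (congrArg Prod.snd hv) k
      rw [hF, h1, map_zero, map_zero, LinearMap.zero_apply, add_zero] at h3
      exact h3
    rw [pi_eq_sum_univ' x, map_sum, map_sum, LinearMap.sum_apply]
    refine Finset.sum_eq_zero fun k _ => ?_
    rw [map_smul, map_smul, LinearMap.smul_apply]
    simp [h2]
  rw [hG.fderiv]
  refine ⟨contDiffAt_fst.prodMk (contDiffAt_pi.2 hs), hinj, ?_, fun v => ?_⟩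
  · refine (LinearMap.injective_iff_surjective_of_finrank_eq_finrank ?_).1 hinj
    simp only [Module.finrank_prod, Module.finrank_pi_fintype]
    simp [Complex.finrank_real_complex]
    ring
  · have e := coordDeriv_structureAt hm 2 v
    refine (congrArg ((ContinuousLinearMap.fst ℝ _ _).prod (ContinuousLinearMap.pi F)) e).trans ?_
    refine Prod.ext rfl (funext fun k => ?_)
    refine (hF k _).trans (Eq.trans ?_ (congrArg (Complex.I * ·) (hF k (coordDeriv m₀ m v))).symm)
    rw [hp.dualForm_complexStructure_two, hp.complexStructure_two]
    dsimp only
    rw [map_smul, map_smul, LinearMap.smul_apply, smul_eq_mul, mul_add]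

theorem isComplexStructure_structureAt (i : Fin 3) :
    IsComplexStructure (modelI r) (fun m : D.Space => structureAt m i) := by
  fin_cases i
  · exact isComplexStructure_of_log Complex.I_ne_zero 0 fun m₀ m hm v =>
      (isPeriodMap_periods hm).logVal_complexStructure_zero v
  · exact isComplexStructure_of_log (neg_ne_zero.2 one_ne_zero) 1 fun m₀ m hm v =>
      (isPeriodMap_periods hm).logVal_complexStructure_one v
  · exact isComplexStructure_two

/-! ### The semi-flat hyper-Kähler structure -/

variable (D) in
theorem exists_kahlerForm (i : Fin 3) :
    ∃ Ω : ∀ m : D.Space, TangentSpace (modelI r) m [⋀^Fin 2]→L[ℝ] ℝ,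
      IsClosedForm (modelI r) Ω ∧ ∀ m v w, Ω m ![v, w] = kahlerValue m i v w := by
  fin_cases i
  · exact D.exists_omegaPlus Complex.reCLM
  · exact D.exists_omegaPlus Complex.imCLM
  · exact D.exists_omegaThree Complex.reCLM

variable (D) in
theorem exists_hyperKahlerStructure : ∃ h : HyperKahlerStructure (modelI r) D.Space,
    ∀ i m v w, h.form i m ![v, w] = kahlerValue m i v w := by
  choose form hclosed hform using D.exists_kahlerForm
  have hp := fun m : D.Space => isHyperkahlerPoint_metricAt m
  exact ⟨{
    g := {
      inner := fun m => metricAt m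
      symm := fun m v w => (hp m).symm v w
      pos := fun m v hv => (hp m).pos v hv
      isVonNBounded := fun m => isVonNBounded_of_pos (hp m).pos
      contMDiff := contMDiff_metric (J := fun m => structureAt m) hclosed fun m => by
        have e : (fun i (v w : TangentSpace (modelI r) m) => form i m ![v, w]) =
          kahlerValue m := by
            ext i v w
            exact hform i m v w
        rw [e]
        exact hp m }
    J := fun i m => structureAt m i
    form := form
    isComplexStructure := isComplexStructure_structureAt
    quaternion := fun m v => (hp m).quaternion v
    orthogonal := fun i m v w => (hp m).orthogonal i v w
    form_eq := fun i m v w => (hform i m v w).trans ((hp m).form i v w)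
    closed := hclosed }, hform⟩

theorem omegaPlus_eq_kahlerValue (m : D.Space) (v w : TangentSpace (modelI r) m) :
    D.omegaPlus m v w = (kahlerValue m 0 v w : ℂ) + Complex.I * (kahlerValue m 1 v w : ℂ) := by
  rw [mul_comm]
  exact (Complex.re_add_im _).symm

theorem omegaThree_eq_kahlerValue (m : D.Space) (v w : TangentSpace (modelI r) m) :
    D.omegaThree m v w = (kahlerValue m 2 v w : ℂ) := by
  have hm := mem_extChartAt_source (I := modelI r) m
  have h := (omegaThree_eq hm v w).trans ((isPeriodMap_periods hm).threeVal_eq _ _)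
  refine h.trans (congrArg Complex.ofReal ?_)
  exact ((congrArg Complex.re h).trans (Complex.ofReal_re _)).symm

theorem varpi_eq_kahlerValue {ζ : ℂ} (hζ : ζ ≠ 0) (m : D.Space)
    (v w : TangentSpace (modelI r) m) : D.varpi ζ m v w =
      -(Complex.I / (2 * ζ)) *
          ((kahlerValue m 0 v w : ℂ) + Complex.I * (kahlerValue m 1 v w : ℂ)) +
        (kahlerValue m 2 v w : ℂ) -
        Complex.I / 2 * ζ *
          ((kahlerValue m 0 v w : ℂ) - Complex.I * (kahlerValue m 1 v w : ℂ)) := by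
  have hm := mem_extChartAt_source (I := modelI r) m
  have hp := isPeriodMap_periods hm
  have e : (kahlerValue m 0 v w : ℂ) - Complex.I * (kahlerValue m 1 v w : ℂ) =
      star (D.omegaPlus m v w) := by
    rw [omegaPlus_eq_kahlerValue]
    simp [sub_eq_add_neg]
  have h := (varpi_eq ζ hm v w).trans (varpiVal_eq hp.antisymm hζ (star_realToComplex _)
    (star_realToComplex _) (hp.isotropic _ _))
  have h1 := omegaPlus_eq hm v w
  have h2 := omegaThree_eq hm v w
  rw [e, ← omegaPlus_eq_kahlerValue, ← omegaThree_eq_kahlerValue]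
  refine h.trans ?_
  rw [← h1, ← h2]

end SemiflatData

end

theorem mainTheorem2 {r : ℕ} {B : Type u} [TopologicalSpace B] [T2Space B]
    [SecondCountableTopology B] [ConnectedSpace B] [ChartedSpace (Fin r → ℂ) B]
    [IsManifold 𝓘(ℂ, Fin r → ℂ) ω B] {S : Set B} (hS : IsDivisor r S)
    (D : SemiflatData.{u, v} r (regularLocus hS)) :
    (∀ x : regularLocus hS, ∃ U s, x ∈ U ∧ D.IsFrame U s) ∧
    ∃ (_ : TopologicalSpace D.Space) (_ : ChartedSpace (SemiflatData.Model r) D.Space)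
      (_ : IsManifold (SemiflatData.modelI r) ∞ D.Space),
      T2Space D.Space ∧ SecondCountableTopology D.Space ∧ D.HasAngleCoordinates ∧
      (∀ ζ : ℂ, ζ ≠ 0 →
        ∃ Ω : ∀ m : D.Space, TangentSpace (SemiflatData.modelI r) m [⋀^Fin 2]→L[ℝ] ℂ,
          IsHolomorphicSymplectic (SemiflatData.modelI r) Ω ∧
          ∀ m v w, Ω m ![v, w] = D.varpi ζ m v w) ∧
      (∃ Ω : ∀ m : D.Space, TangentSpace (SemiflatData.modelI r) m [⋀^Fin 2]→L[ℝ] ℂ,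
          IsHolomorphicSymplectic (SemiflatData.modelI r) Ω ∧
          ∀ m v w, Ω m ![v, w] = D.omegaPlus m v w) ∧
      ∃ h : HyperKahlerStructure (SemiflatData.modelI r) D.Space,
        (∀ m v w, D.omegaPlus m v w =
          (h.form 0 m ![v, w] : ℂ) + Complex.I * (h.form 1 m ![v, w] : ℂ)) ∧
        (∀ m v w, D.omegaThree m v w = (h.form 2 m ![v, w] : ℂ)) ∧
        ∀ ζ : ℂ, ζ ≠ 0 → ∀ m v w, D.varpi ζ m v w =
          -(Complex.I / (2 * ζ)) *
              ((h.form 0 m ![v, w] : ℂ) + Complex.I * (h.form 1 m ![v, w] : ℂ)) +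
            (h.form 2 m ![v, w] : ℂ) -
            Complex.I / 2 * ζ *
              ((h.form 0 m ![v, w] : ℂ) - Complex.I * (h.form 1 m ![v, w] : ℂ)) := by
  refine ⟨D.exists_isFrame, inferInstance, inferInstance, inferInstance, SemiflatData.t2Space_space,
    SemiflatData.secondCountable_space, SemiflatData.hasAngleCoordinates,
    fun ζ hζ => D.exists_isHolomorphicSymplectic_varpi hζ,
    D.exists_isHolomorphicSymplectic_omegaPlus, ?_⟩
  obtain ⟨h, hform⟩ := D.exists_hyperKahlerStructure
  refine ⟨h, fun m v w => ?_, fun m v w => ?_, fun ζ hζ m v w => ?_⟩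
  · rw [hform, hform, SemiflatData.omegaPlus_eq_kahlerValue]
  · rw [hform, SemiflatData.omegaThree_eq_kahlerValue]
  · rw [hform, hform, hform, SemiflatData.varpi_eq_kahlerValue hζ]
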